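/- **Conventions.** A Turing machine $(Q,\mathrm{START},\mathrm{HALT},\Sigma,\delta)$ consists of a finite set $Q$ with elements $\mathrm{START},\mathrm{HALT}$, a finite alphabet $\Sigma$ with at least two elements, and a map $\delta\colon (Q\setminus\{\mathrm{HALT}\})\times\Sigma\to Q\times\Sigma\times\{-1,0,1\}$. On an input tape $s\in\Sigma^{\mathbb Z}$ it starts in state $\mathrm{START}$ with tape $t=s$. It halts with output tape $t$ when the state is $\mathrm{HALT}$; otherwise, with $\delta(q,t_0)=(q',t_0',\epsilon)$, it replaces $q$ by $q'$, the symbol $t_0$ by $t_0'$, and then the tape $(t_n)_n$ by the shifted tape $(t_{n-\epsilon})_n$, and repeats. For an integer $k\ge 1$ put $b=10k$ and let $f\colon\{0,\dots,k\}^{\mathbb Z}\to(\mathbb R/\mathbb Z)^2$ be $$f(u)=\Big(\sum_{n\ge1}u_n b^{-n}\bmod 1,\ \sum_{n\ge1}u_{1-n}b^{-n}\bmod 1\Big),$$ whose image is a product of two Cantor sets. The circle $\mathbb R/\mathbb Z$ is identified with the unit circle in $\mathbb C$ through $\theta\mapsto e^{2\pi i\theta}$ and carries the distance of $\mathbb C$;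 products carry the maximum distance. **Proposition (Diffeomorphisms can be universal Turing machines).** Let $M=(\mathbb R/\mathbb Z)^2\times(\mathbb R/\mathbb Z)^2$ be the 4-torus. There exist a $C^\infty$ diffeomorphism $\Phi\colon M\to M$ that is computable (an algorithm computes the coordinates of $\Phi(z)$, for dyadic rational points $z$, to any prescribed accuracy), an integer $k\ge1$, points $x,h\in(\mathbb R/\mathbb Z)^2$ with rational coordinates, a rational number $\rho$, and an algorithm which, given the table of any Turing machine (with its states and symbols numbered in any way), produces * a block length $L\ge1$, * for each $a\in\Sigma$ two words $w_a,w_a^0\in\{0,\dots,k\}^L$, * a rule $r$ that assigns to each word in $\{0,\dots,k\}^L$ a natural number, computable from the table and the word, such that the following holds for every Turing machine. For $s\in\Sigma^{\mathbb Z}$ let $e(s)\in\{0,\dots,k\}^{\mathbb Z}$ be the tape whose block in the positions $Li,\dots,Li+L-1$ is $w_{s_i}$ for $i\ne0$ and $w^0_{s_0}$ for $i=0$, and let $$y_s=(x,f(e(s)))\in M.$$ For a finite string $t_{-n},\dots,t_n\in\Sigma$ let $C_{t_{-n},\dots,t_n}$ be the set of the tapes $u\in\{0,\dots,k\}^{\mathbb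 Z}$ such that $r(u_{Li},\dots,u_{Li+L-1})$ is the number of the symbol $t_i$ for all $-n\le i\le n$, and let $U_{t_{-n},\dots,t_n}=V\times W_{t_{-n},\dots,t_n}\subset M$, where $V$ is the open ball with centre $h$ and radius $\rho$, and $W_{t_{-n},\dots,t_n}$ is the open set of points at distance less than $b^{-(n+1)L}$ from some point of $f(C_{t_{-n},\dots,t_n})$. Then, for all $s\in\Sigma^{\mathbb Z}$, all $n\ge 0$ and all $t_{-n},\dots,t_n\in\Sigma$, the Turing machine with input tape $s$ halts with an output tape having coefficients $t_{-n},\dots,t_n$ in positions $-n,\dots,n$ respectively if and only if the orbit $y_s,\Phi(y_s),\Phi^2(y_s),\dots$ enters $U_{t_{-n},\dots,t_n}$, that is, $\Phi^m(y_s)\in U_{t_{-n},\dots,t_n}$ for some $m\ge0$. -/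

import Mathlib

open scoped Manifold ContDiff

/-! ### Turing machines with a two-sided infinite tape and a shifting tape -/

/-- A Turing machine with state set `Q` and alphabet `A`. The transition function is defined on
non-halting states only; its last output in `SignType = {-1, 0, 1}` is the shift of the tape. -/
structure TuringMachine (Q : Type*) (A : Type*) where
  start : Q
  halt : Q
  δ : {q : Q // q ≠ halt} → A → Q × A × SignType

namespace TuringMachine

variable {Q : Type*} {A : Type*}

open Classical in
/-- One step on a pair (state, tape): nothing happens in the halting state; otherwise the
symbol in position `0` is overwritten and the tape `t` is replaced by `n ↦ t (n - ε)`. -/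
noncomputable def next (T : TuringMachine Q A) (c : Q × (ℤ → A)) : Q × (ℤ → A) :=
  if h : c.1 = T.halt then c
  else
    ((T.δ ⟨c.1, h⟩ (c.2 0)).1,
      fun n => Function.update c.2 0 (T.δ ⟨c.1, h⟩ (c.2 0)).2.1
        (n - ((T.δ ⟨c.1, h⟩ (c.2 0)).2.2 : ℤ)))

/-- The machine, run on the input tape `s`, halts with output tape `t`. -/
def HaltsWithTape (T : TuringMachine Q A) (s t : ℤ → A) : Prop :=
  ∃ m : ℕ, T.next^[m] (T.start, s) = (T.halt, t)

/-- The machine, run on `s`, halts and its output tape has coefficients `t i` in the positions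
`-n ≤ i ≤ n`. -/
def HaltsWithOutput (T : TuringMachine Q A) (s : ℤ → A) (n : ℕ)
    (t : Set.Icc (-(n : ℤ)) (n : ℤ) → A) : Prop :=
  ∃ t' : ℤ → A, T.HaltsWithTape s t' ∧ ∀ i : Set.Icc (-(n : ℤ)) (n : ℤ), t' i = t i

/-- Finite descriptions of machines: number of states, number of symbols, initial state, halting
state, and the table of the transition function. -/
abbrev Code : Type := ℕ × ℕ × ℕ × ℕ × List (List (ℕ × ℕ × ℕ))

open Classical in
/-- The description of a machine with respect to numberings of its states and of its symbols.
The shift `ε` is written as `ε + 1`; the row of the halting state is filled with a dummy. -/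
noncomputable def code (T : TuringMachine Q A) {m l : ℕ} (eQ : Q ≃ Fin m) (eA : A ≃ Fin l) : Code :=
  (m, l, (eQ T.start : ℕ), (eQ T.halt : ℕ),
    List.ofFn fun q : Fin m => List.ofFn fun a : Fin l =>
      if h : eQ.symm q = T.halt then (0, 0, 0)
      else
        ((eQ (T.δ ⟨eQ.symm q, h⟩ (eA.symm a)).1 : ℕ),
          (eA (T.δ ⟨eQ.symm q, h⟩ (eA.symm a)).2.1 : ℕ),
          (((T.δ ⟨eQ.symm q, h⟩ (eA.symm a)).2.2 : ℤ) + 1).toNat))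

end TuringMachine

/-! ### The torus -/

abbrev Torus2 : Type := Circle × Circle

abbrev Torus4 : Type := Torus2 × Torus2

/-- The model with corners of the smooth manifold `Torus4` (a product of four circles). -/
noncomputable abbrev torus4Model :=
  (((𝓡 1).prod (𝓡 1)).prod ((𝓡 1).prod (𝓡 1)))

/-- The point of the torus `(ℝ/ℤ)²` with coordinates `x mod 1`, where `ℝ/ℤ` is identified with the
unit circle through `θ ↦ exp (2πiθ)`. -/
noncomputable def toTorus2 (x : ℝ × ℝ) : Torus2 :=
  (Circle.exp (2 * Real.pi * x.1), Circle.exp (2 * Real.pi * x.2))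

noncomputable def toTorus4 (x : (ℝ × ℝ) × (ℝ × ℝ)) : Torus4 :=
  (toTorus2 x.1, toTorus2 x.2)

/-- The point with dyadic coordinates `aᵢ / 2 ^ p`. -/
noncomputable def dyadic (p : ℕ) (a : (ℕ × ℕ) × (ℕ × ℕ)) : (ℝ × ℝ) × (ℝ × ℝ) :=
  (((a.1.1 : ℝ) / 2 ^ p, (a.1.2 : ℝ) / 2 ^ p), ((a.2.1 : ℝ) / 2 ^ p, (a.2.2 : ℝ) / 2 ^ p))

/-- There is an algorithm that computes, for each dyadic point, the coordinates of its image
under `F` up to an error `2 ^ (-r)`, with `r` part of the input. For Lipschitz `F`, in particular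
for smooth `F`, this is computability of `F` in the sense of computable analysis, because the
Lipschitz constant provides the modulus of continuity. -/
def IsComputableTorusMap (F : Torus4 → Torus4) : Prop :=
  ∃ g : ℕ × ℕ × ((ℕ × ℕ) × (ℕ × ℕ)) → (ℕ × ℕ) × (ℕ × ℕ), Computable g ∧
    ∀ (p r : ℕ) (a : (ℕ × ℕ) × (ℕ × ℕ)), ∃ θ : (ℝ × ℝ) × (ℝ × ℝ),
      F (toTorus4 (dyadic p a)) = toTorus4 θ ∧ dist θ (dyadic r (g (p, r, a))) ≤ (1 / 2) ^ r

/-! ### Tapes as points of a Cantor set -/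

/-- The embedding of the tapes over `{0, …, k}` into the 2-torus, with base `b = 10 k`: the
tape `t` goes to `(∑_{n ≥ 1} t_n b^{-n} mod 1, ∑_{n ≥ 1} t_{1-n} b^{-n} mod 1)`. -/
noncomputable def cantorPoint (k : ℕ) (t : ℤ → Fin (k + 1)) : Torus2 :=
  toTorus2
    (∑' n : ℕ, ((t ((n : ℤ) + 1) : ℕ) : ℝ) / (10 * (k : ℝ)) ^ (n + 1),
      ∑' n : ℕ, ((t (-(n : ℤ)) : ℕ) : ℝ) / (10 * (k : ℝ)) ^ (n + 1))

/-- The `i`-th block of length `L` of a tape. -/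
def tapeBlock {B : Type*} (L : ℕ) (t : ℤ → B) (i : ℤ) : List B :=
  List.ofFn fun r : Fin L => t ((L : ℤ) * i + ((r : ℕ) : ℤ))

/-- An algorithm that turns a description of a Turing machine into a block code over the
alphabet `{0, …, k}`: a block length, the words that stand for the symbols (one word for a symbol
in position `0` of the tape, one for the same symbol in any other position), and a map that reads
a symbol off a word. -/
structure BlockCoding (k : ℕ) where
  /-- block length -/
  len : TuringMachine.Code → ℕ
  /-- `digit (c, o, a, r)` is the letter number `r` in the word for the symbol number `a`; `o` says
  whether the symbol stands in position `0` of the tape -/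
  digit : TuringMachine.Code × Bool × ℕ × ℕ → Fin (k + 1)
  /-- the number of the symbol that is read off a word -/
  read : TuringMachine.Code × List (Fin (k + 1)) → ℕ
  len_pos : ∀ c, 0 < len c
  computable_len : Computable len
  computable_digit : Computable digit
  computable_read : Computable read

namespace BlockCoding

variable {k : ℕ} {A : Type*} {l : ℕ}

/-- The tape over `{0, …, k}` obtained from `s` by writing, for each symbol of `s`, its word. -/
def encode (K : BlockCoding k) (c : TuringMachine.Code) (eA : A ≃ Fin l) (s : ℤ → A) :
    ℤ → Fin (k + 1) :=
  fun j => K.digit (c, decide (j / (K.len c : ℤ) = 0), (eA (s (j / (K.len c : ℤ))) : ℕ),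
    (j % (K.len c : ℤ)).toNat)

/-- The set of tapes over `{0, …, k}` from whose blocks number `-n, …, n` the string `t` is read. -/
def cylinder (K : BlockCoding k) (c : TuringMachine.Code) (eA : A ≃ Fin l) (n : ℕ)
    (t : Set.Icc (-(n : ℤ)) (n : ℤ) → A) : Set (ℤ → Fin (k + 1)) :=
  {u | ∀ i : Set.Icc (-(n : ℤ)) (n : ℤ), K.read (c, tapeBlock (K.len c) u i) = (eA (t i) : ℕ)}

/-- The point `y_s`: a fixed rational point in the first 2-torus, and in the second one the point
of the Cantor set that encodes `s`. -/
noncomputable def inputPoint (K : BlockCoding k) (c : TuringMachine.Code) (eA : A ≃ Fin l)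
    (x : ℚ × ℚ) (s : ℤ → A) : Torus4 :=
  (toTorus2 ((x.1 : ℝ), (x.2 : ℝ)), cantorPoint k (K.encode c eA s))

/-- The open set `U_t = V × W_t`: here `V` is the ball with rational centre `h` and rational
radius `ρ`, and `W_t` is the neighbourhood with radius `b ^ (-(n + 1) L)`, where `b = 10 k` and
`L` is the block length, of the part of the Cantor set that encodes tapes from which `t` is read. -/
noncomputable def outputSet (K : BlockCoding k) (c : TuringMachine.Code) (eA : A ≃ Fin l)
    (h : ℚ × ℚ) (ρ : ℚ) (n : ℕ) (t : Set.Icc (-(n : ℤ)) (n : ℤ) → A) :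
    TopologicalSpace.Opens Torus4 :=
  ⟨Metric.ball (toTorus2 ((h.1 : ℝ), (h.2 : ℝ))) (ρ : ℝ) ×ˢ
      Metric.thickening (((10 * (k : ℝ)) ^ ((n + 1) * K.len c))⁻¹)
        (cantorPoint k '' K.cylinder c eA n t),
    Metric.isOpen_ball.prod Metric.isOpen_thickening⟩

end BlockCoding

/-! A tape cut at the origin gives two streams, and digit expansion in base `10k` turns them into
two real numbers. Replacing a prefix of a stream is then an affine map, and smooth bumps living in
the gaps of the Cantor set detect which prefix is present. A machine that keeps its state as a
letter on the tape acts by such replacements (`rewriteStep`). The step need not be injective, so the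
window about to be overwritten is first stored as a new leading digit of a history coordinate, `t ↦
(j + t) / β`. From then on the affine map is selected by the history alone, and three shears using a
clean work coordinate perform it (`exists_selected_affine`). The four circles are history, work
space, right stream and left stream. A composition of shears is a global diffeomorphism, although it
simulates the machine only on the Cantor set (`exists_diffeo_rewriteStep`). It is computable because
its bumps are built from `exp (-1/x)`, which has explicit rational approximations.

The fixed rewriting machine must simulate every Turing machine `T`. Each symbol becomes a block that
contains the whole table of `T`, and the symbol is recorded by marking one row as active; the state
of `T` is a unary counter that the head carries along. A step of `T` takes two lookups inside the
current block. The first, in the active row, deactivates this row and yields the position of a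
second entry in the row of the symbol to be written. The second activates that row, loads the new
state into the counter and moves the head (`exists_lookup_step`).

Halting puts the letter `halt` in front of block `0`. Position `0` always holds a state letter, and
`readWord` rejects words that begin with neither `halt` nor a delimiter, so a symbol is read off
block `0` only after halting. Points of the Cantor set closer than `b ^ (-N)` share `N` digits on
both sides (`eq_of_dist_cantorPoint_lt`), hence the thickening adds no orbit points. The history
stays in `[0, 1/8]`, so membership in the ball `V` is automatic. -/

/-! ### Uniformly computable families of real numbers -/

/-- The rational number `(n₁ - n₂) / d` that a triple `(n₁, n₂, d)` stands for. -/
noncomputable def tripleVal (t : ℕ × ℕ × ℕ) : ℝ := ((t.1 : ℝ) - t.2.1) / t.2.2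

theorem primrec_nat_pow : Primrec₂ ((· ^ ·) : ℕ → ℕ → ℕ) :=
  Primrec₂.unpaired'.1 Nat.Primrec.pow

/-- A family of real numbers is computable if rational approximations of any prescribed accuracy
are computed uniformly in the index. -/
def IsComputableFamily {ι : Type*} [Primcodable ι] (v : ι → ℝ) : Prop :=
  ∃ c : ι × ℕ → ℕ × ℕ × ℕ, Computable c ∧
    ∀ i r, 0 < (c (i, r)).2.2 ∧ |v i - tripleVal (c (i, r))| ≤ (1 / 2) ^ r

namespace IsComputableFamily

variable {ι κ : Type*} [Primcodable ι] [Primcodable κ] {v w : ι → ℝ}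

theorem comp (hv : IsComputableFamily v) {f : κ → ι} (hf : Computable f) :
    IsComputableFamily fun j => v (f j) := by
  obtain ⟨c, hc, h⟩ := hv
  exact ⟨fun x => c (f x.1, x.2), hc.comp ((hf.comp Computable.fst).pair Computable.snd),
    fun i r => h (f i) r⟩

theorem congr (hv : IsComputableFamily v) (h : ∀ i, v i = w i) : IsComputableFamily w := by
  rwa [show w = v from funext fun i => (h i).symm]

theorem const (q : ℚ) : IsComputableFamily fun _ : ι => (q : ℝ) := by
  refine ⟨fun _ => (q.num.toNat, (-q.num).toNat, q.den), Computable.const _, fun i r =>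
    ⟨q.den_pos, ?_⟩⟩
  have h : ((q.num.toNat : ℝ) - ((-q.num).toNat : ℝ)) = (q.num : ℝ) := by
    exact_mod_cast Int.toNat_sub_toNat_neg q.num
  simp only [tripleVal, h]
  rw [← Rat.cast_def q, sub_self, abs_zero]
  positivity

theorem neg (hv : IsComputableFamily v) : IsComputableFamily fun i => -v i := by
  obtain ⟨c, hc, h⟩ := hv
  refine ⟨fun x => ((c x).2.1, (c x).1, (c x).2.2), ?_, fun i r => ⟨(h i r).1, ?_⟩⟩
  · exact (Computable.fst.comp (Computable.snd.comp hc)).pair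
      ((Computable.fst.comp hc).pair (Computable.snd.comp (Computable.snd.comp hc)))
  · have := (h i r).2
    rw [← abs_neg]
    convert this using 2
    simp only [tripleVal]
    ring

theorem add (hv : IsComputableFamily v) (hw : IsComputableFamily w) :
    IsComputableFamily fun i => v i + w i := by
  obtain ⟨c, hc, h⟩ := hv
  obtain ⟨d, hd, h'⟩ := hw
  have hs : Computable fun x : ι × ℕ => (x.1, x.2 + 1) :=
    Computable.fst.pair (Computable.succ.comp Computable.snd)
  have hT : Primrec fun y : (ℕ × ℕ × ℕ) × (ℕ × ℕ × ℕ) =>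
      (y.1.1 * y.2.2.2 + y.2.1 * y.1.2.2, y.1.2.1 * y.2.2.2 + y.2.2.1 * y.1.2.2,
        y.1.2.2 * y.2.2.2) := by
    have a1 : Primrec fun y : (ℕ × ℕ × ℕ) × (ℕ × ℕ × ℕ) => y.1.1 := Primrec.fst.comp Primrec.fst
    have a2 : Primrec fun y : (ℕ × ℕ × ℕ) × (ℕ × ℕ × ℕ) => y.1.2.1 :=
      Primrec.fst.comp (Primrec.snd.comp Primrec.fst)
    have a3 : Primrec fun y : (ℕ × ℕ × ℕ) × (ℕ × ℕ × ℕ) => y.1.2.2 :=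
      Primrec.snd.comp (Primrec.snd.comp Primrec.fst)
    have b1 : Primrec fun y : (ℕ × ℕ × ℕ) × (ℕ × ℕ × ℕ) => y.2.1 := Primrec.fst.comp Primrec.snd
    have b2 : Primrec fun y : (ℕ × ℕ × ℕ) × (ℕ × ℕ × ℕ) => y.2.2.1 :=
      Primrec.fst.comp (Primrec.snd.comp Primrec.snd)
    have b3 : Primrec fun y : (ℕ × ℕ × ℕ) × (ℕ × ℕ × ℕ) => y.2.2.2 :=
      Primrec.snd.comp (Primrec.snd.comp Primrec.snd)
    exact (Primrec.nat_add.comp (Primrec.nat_mul.comp a1 b3) (Primrec.nat_mul.comp b1 a3)).pair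
      ((Primrec.nat_add.comp (Primrec.nat_mul.comp a2 b3) (Primrec.nat_mul.comp b2 a3)).pair
        (Primrec.nat_mul.comp a3 b3))
  refine ⟨_, hT.to_comp.comp ((hc.comp hs).pair (hd.comp hs)), fun i r => ?_⟩
  obtain ⟨h1, h2⟩ := h i (r + 1)
  obtain ⟨h3, h4⟩ := h' i (r + 1)
  refine ⟨Nat.mul_pos h1 h3, ?_⟩
  have e1 : ((c (i, r + 1)).2.2 : ℝ) ≠ 0 := by exact_mod_cast h1.ne'
  have e2 : ((d (i, r + 1)).2.2 : ℝ) ≠ 0 := by exact_mod_cast h3.ne'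
  have key : tripleVal (c (i, r + 1)) + tripleVal (d (i, r + 1)) =
      tripleVal ((c (i, r + 1)).1 * (d (i, r + 1)).2.2 + (d (i, r + 1)).1 * (c (i, r + 1)).2.2,
        (c (i, r + 1)).2.1 * (d (i, r + 1)).2.2 + (d (i, r + 1)).2.1 * (c (i, r + 1)).2.2,
        (c (i, r + 1)).2.2 * (d (i, r + 1)).2.2) := by
    simp only [tripleVal]
    push_cast
    field_simp
    ring
  simp only [← key]
  have : (1 / 2 : ℝ) ^ r = (1 / 2) ^ (r + 1) + (1 / 2) ^ (r + 1) := by ring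
  rw [this]
  calc |v i + w i - (tripleVal (c (i, r + 1)) + tripleVal (d (i, r + 1)))|
      = |(v i - tripleVal (c (i, r + 1))) + (w i - tripleVal (d (i, r + 1)))| := by ring_nf
    _ ≤ _ := (abs_add_le _ _).trans (add_le_add h2 h4)

theorem exists_pow_two_ge (B : ℝ) : ∃ s : ℕ, B ≤ 2 ^ s := by
  obtain ⟨s, hs⟩ := pow_unbounded_of_one_lt B (one_lt_two)
  exact ⟨s, hs.le⟩

theorem mul (hv : IsComputableFamily v) (hw : IsComputableFamily w) {B : ℝ}
    (hvB : ∀ i, |v i| ≤ B) (hwB : ∀ i, |w i| ≤ B) :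
    IsComputableFamily fun i => v i * w i := by
  obtain ⟨c, hc, h⟩ := hv
  obtain ⟨d, hd, h'⟩ := hw
  -- The error is at most `|v| |w - y| + |v - x| |y|`, with `|v| ≤ B` and `|y| ≤ B + 1` for the
  -- approximation `y` of `w`.
  obtain ⟨s, hs⟩ := exists_pow_two_ge (B + (B + 1))
  have hss : Computable fun x : ι × ℕ => (x.1, x.2 + s) :=
    Computable.fst.pair (Primrec.nat_add.to_comp.comp Computable.snd (Computable.const s))
  have hT : Primrec fun y : (ℕ × ℕ × ℕ) × (ℕ × ℕ × ℕ) =>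
      (y.1.1 * y.2.1 + y.1.2.1 * y.2.2.1, y.1.1 * y.2.2.1 + y.1.2.1 * y.2.1,
        y.1.2.2 * y.2.2.2) := by
    have a1 : Primrec fun y : (ℕ × ℕ × ℕ) × (ℕ × ℕ × ℕ) => y.1.1 := Primrec.fst.comp Primrec.fst
    have a2 : Primrec fun y : (ℕ × ℕ × ℕ) × (ℕ × ℕ × ℕ) => y.1.2.1 :=
      Primrec.fst.comp (Primrec.snd.comp Primrec.fst)
    have a3 : Primrec fun y : (ℕ × ℕ × ℕ) × (ℕ × ℕ × ℕ) => y.1.2.2 :=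
      Primrec.snd.comp (Primrec.snd.comp Primrec.fst)
    have b1 : Primrec fun y : (ℕ × ℕ × ℕ) × (ℕ × ℕ × ℕ) => y.2.1 := Primrec.fst.comp Primrec.snd
    have b2 : Primrec fun y : (ℕ × ℕ × ℕ) × (ℕ × ℕ × ℕ) => y.2.2.1 :=
      Primrec.fst.comp (Primrec.snd.comp Primrec.snd)
    have b3 : Primrec fun y : (ℕ × ℕ × ℕ) × (ℕ × ℕ × ℕ) => y.2.2.2 :=
      Primrec.snd.comp (Primrec.snd.comp Primrec.snd)
    exact (Primrec.nat_add.comp (Primrec.nat_mul.comp a1 b1) (Primrec.nat_mul.comp a2 b2)).pair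
      ((Primrec.nat_add.comp (Primrec.nat_mul.comp a1 b2) (Primrec.nat_mul.comp a2 b1)).pair
        (Primrec.nat_mul.comp a3 b3))
  refine ⟨_, hT.to_comp.comp ((hc.comp hss).pair (hd.comp hss)), fun i r => ?_⟩
  obtain ⟨h1, h2⟩ := h i (r + s)
  obtain ⟨h3, h4⟩ := h' i (r + s)
  refine ⟨Nat.mul_pos h1 h3, ?_⟩
  have e1 : ((c (i, r + s)).2.2 : ℝ) ≠ 0 := by exact_mod_cast h1.ne'
  have e2 : ((d (i, r + s)).2.2 : ℝ) ≠ 0 := by exact_mod_cast h3.ne'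
  have key : tripleVal (c (i, r + s)) * tripleVal (d (i, r + s)) =
      tripleVal ((c (i, r + s)).1 * (d (i, r + s)).1 + (c (i, r + s)).2.1 * (d (i, r + s)).2.1,
        (c (i, r + s)).1 * (d (i, r + s)).2.1 + (c (i, r + s)).2.1 * (d (i, r + s)).1,
        (c (i, r + s)).2.2 * (d (i, r + s)).2.2) := by
    simp only [tripleVal]
    push_cast
    field_simp
    ring
  simp only [← key]
  set x := tripleVal (c (i, r + s))
  set y := tripleVal (d (i, r + s))
  have hε : (0 : ℝ) ≤ (1 / 2) ^ (r + s) := by positivity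
  have hε1 : (1 / 2 : ℝ) ^ (r + s) ≤ 1 := pow_le_one₀ (by norm_num) (by norm_num)
  have hB : 0 ≤ B := (abs_nonneg _).trans (hvB i)
  have hy : |y| ≤ B + 1 := by
    have : |y| ≤ |w i| + |w i - y| := by
      have := abs_sub_abs_le_abs_sub y (w i)
      rw [abs_sub_comm] at this
      linarith
    linarith [hwB i]
  calc |v i * w i - x * y| = |v i * (w i - y) + (v i - x) * y| := by ring_nf
    _ ≤ |v i| * |w i - y| + |v i - x| * |y| := by
      rw [← abs_mul, ← abs_mul]; exact abs_add_le _ _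
    _ ≤ B * (1 / 2) ^ (r + s) + (1 / 2) ^ (r + s) * (B + 1) := by
      gcongr
      · exact hvB i
    _ = (B + (B + 1)) * (1 / 2) ^ (r + s) := by ring
    _ ≤ 2 ^ s * (1 / 2) ^ (r + s) := by gcongr
    _ = (1 / 2) ^ r := by
      rw [pow_add, mul_comm, mul_assoc, ← mul_pow]; norm_num

theorem inv (hv : IsComputableFamily v) {m : ℝ} (hm : 0 < m) (hvm : ∀ i, m ≤ v i) :
    IsComputableFamily fun i => (v i)⁻¹ := by
  obtain ⟨c, hc, h⟩ := hv
  -- The summand `2 / m` forces the approximation to be at least `m / 2`; `2 / m ^ 2` then bounds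
  -- the factor by which inversion enlarges the error.
  obtain ⟨s, hs⟩ := exists_pow_two_ge (2 / m ^ 2 + 2 / m)
  have hss : Computable fun x : ι × ℕ => (x.1, x.2 + s) :=
    Computable.fst.pair (Primrec.nat_add.to_comp.comp Computable.snd (Computable.const s))
  have hT : Primrec fun y : ℕ × ℕ × ℕ => (y.2.2, 0, y.1 - y.2.1) :=
    (Primrec.snd.comp Primrec.snd).pair ((Primrec.const 0).pair
      (Primrec.nat_sub.comp Primrec.fst (Primrec.fst.comp Primrec.snd)))
  refine ⟨_, hT.to_comp.comp (hc.comp hss), fun i r => ?_⟩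
  obtain ⟨h1, h2⟩ := h i (r + s)
  set t := c (i, r + s)
  have hd : (0 : ℝ) < t.2.2 := by exact_mod_cast h1
  have hpow : (1 / 2 : ℝ) ^ (r + s) * 2 ^ s = (1 / 2) ^ r := by
    rw [pow_add, mul_assoc, ← mul_pow]; norm_num
  have hε0 : (0 : ℝ) < (1 / 2) ^ (r + s) := by positivity
  have hr1 : (1 / 2 : ℝ) ^ r ≤ 1 := pow_le_one₀ (by norm_num) (by norm_num)
  have hεm : (1 / 2 : ℝ) ^ (r + s) ≤ m / 2 := by
    have h5 : (1 / 2 : ℝ) ^ (r + s) * (2 / m) ≤ 1 := by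
      have : 2 / m ≤ 2 ^ s := le_trans (by have : 0 ≤ 2 / m ^ 2 := by positivity
                                           linarith) hs
      calc (1 / 2 : ℝ) ^ (r + s) * (2 / m) ≤ (1 / 2 : ℝ) ^ (r + s) * 2 ^ s := by gcongr
        _ ≤ 1 := by rw [hpow]; exact hr1
    rw [mul_div_assoc', div_le_one hm] at h5
    linarith
  have hq : m / 2 ≤ tripleVal t := by
    have := (abs_le.1 h2).2
    linarith [hvm i]
  have hq0 : 0 < tripleVal t := lt_of_lt_of_le (by positivity) hq
  have hlt : t.2.1 < t.1 := by
    have : (0 : ℝ) < (t.1 : ℝ) - t.2.1 := by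
      have h6 := mul_pos hq0 hd
      rwa [tripleVal, div_mul_cancel₀ _ hd.ne'] at h6
    exact_mod_cast sub_pos.1 this
  refine ⟨Nat.sub_pos_of_lt hlt, ?_⟩
  have key : tripleVal (t.2.2, 0, t.1 - t.2.1) = (tripleVal t)⁻¹ := by
    simp only [tripleVal]
    rw [Nat.cast_sub hlt.le]
    simp
  simp only [key]
  set q := tripleVal t
  have hv0 : 0 < v i := hm.trans_le (hvm i)
  have e : (v i)⁻¹ - q⁻¹ = -(v i - q) * ((v i)⁻¹ * q⁻¹) := by
    field_simp
    ring
  rw [e, abs_mul, abs_neg, abs_of_pos (by positivity : 0 < (v i)⁻¹ * q⁻¹)]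
  have hb : (v i)⁻¹ * q⁻¹ ≤ 2 / m ^ 2 := by
    calc (v i)⁻¹ * q⁻¹ ≤ m⁻¹ * (m / 2)⁻¹ := by
          gcongr
          exact hvm i
      _ = 2 / m ^ 2 := by field_simp
  calc |v i - q| * ((v i)⁻¹ * q⁻¹) ≤ (1 / 2) ^ (r + s) * (2 / m ^ 2) := by gcongr
    _ ≤ (1 / 2) ^ (r + s) * 2 ^ s := by
      gcongr
      have : 0 ≤ 2 / m := by positivity
      linarith
    _ = _ := hpow

theorem ratio {n d : ι → ℕ} (hn : Computable n) (hd : Computable d) (hd0 : ∀ i, 0 < d i) :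
    IsComputableFamily fun i => (n i : ℝ) / d i := by
  refine ⟨fun x => (n x.1, 0, d x.1), (hn.comp Computable.fst).pair ((Computable.const 0).pair
    (hd.comp Computable.fst)), fun i r => ⟨hd0 i, ?_⟩⟩
  simp [tripleVal]

end IsComputableFamily

/-- With `h = y / N`, both `exp (-h)` and `1 / (1 + h)` lie between `1 - h` and `1 - h + h ^ 2`.
Taking `N`-th powers of numbers in `[0, 1]` multiplies the difference by at most `N`. -/
theorem abs_exp_neg_sub_le {y : ℝ} (hy : 0 ≤ y) {N : ℕ} (hN : 0 < N) :
    |Real.exp (-y) - (1 / (1 + y / N)) ^ N| ≤ y ^ 2 / N := by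
  have hN' : (0 : ℝ) < N := by exact_mod_cast hN
  set u : ℝ := 1 / (1 + y / N) with hu
  have hyN : 0 ≤ y / N := by positivity
  set w : ℝ := Real.exp (-(y / N)) with hw
  have hwN : Real.exp (-y) = w ^ N := by
    rw [hw, ← Real.exp_nat_mul]; congr 1; field_simp
  have hwu : w ≤ u := by
    rw [hw, hu, Real.exp_neg, ← one_div]
    have := Real.add_one_le_exp (y / N)
    gcongr
    linarith
  have hu1 : u ≤ 1 := by
    rw [hu, div_le_one (by positivity)]; linarith
  have hw0 : 0 ≤ w := (Real.exp_pos _).le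
  have hu0 : 0 ≤ u := hw0.trans hwu
  have hd : u - w ≤ (y / N) ^ 2 := by
    have h1 : 1 - y / N ≤ w := by
      have := Real.add_one_le_exp (-(y / N)); linarith
    have h2 : u ≤ 1 - y / N + (y / N) ^ 2 := by
      rw [hu, div_le_iff₀ (by positivity)]
      nlinarith [pow_nonneg hyN 3]
    linarith
  have hpow : u ^ N - w ^ N ≤ N * (u - w) := by
    have h := abs_pow_sub_pow_le u w N
    rw [abs_of_nonneg (sub_nonneg.2 (pow_le_pow_left₀ hw0 hwu N)),
      abs_of_nonneg (sub_nonneg.2 hwu), abs_of_nonneg hu0, abs_of_nonneg hw0,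
      max_eq_left hwu] at h
    have h3 : u ^ (N - 1) ≤ 1 := pow_le_one₀ hu0 hu1
    have : 0 ≤ (u - w) * N := mul_nonneg (sub_nonneg.2 hwu) hN'.le
    nlinarith
  rw [hwN, abs_sub_comm, abs_of_nonneg (sub_nonneg.2 (pow_le_pow_left₀ hw0 hwu N))]
  calc u ^ N - w ^ N ≤ N * (u - w) := hpow
    _ ≤ N * (y / N) ^ 2 := by gcongr
    _ = y ^ 2 / N := by field_simp

/-- For `y = d / n` with `n ≥ 1`, the choice `N = d ^ 2 * 2 ^ r` makes the error bound `y ^ 2 / N`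
at most `2 ^ (-r)`. For `n = 0` the same formula returns `0`, the correct value, so no case
distinction is computed. -/
theorem IsComputableFamily.expNegInvGlue {ι : Type*} [Primcodable ι] {n d : ι → ℕ}
    (hn : Computable n) (hd : Computable d) (hd0 : ∀ i, 0 < d i) :
    IsComputableFamily fun i => _root_.expNegInvGlue ((n i : ℝ) / d i) := by
  have hT : Primrec fun x : (ℕ × ℕ) × ℕ =>
      ((x.1.1 * (x.1.2 * x.1.2 * 2 ^ x.2)) ^ (x.1.2 * x.1.2 * 2 ^ x.2), 0,
        (x.1.1 * (x.1.2 * x.1.2 * 2 ^ x.2) + x.1.2) ^ (x.1.2 * x.1.2 * 2 ^ x.2)) := by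
    have hx1 : Primrec fun x : (ℕ × ℕ) × ℕ => x.1.1 := Primrec.fst.comp Primrec.fst
    have hx2 : Primrec fun x : (ℕ × ℕ) × ℕ => x.1.2 := Primrec.snd.comp Primrec.fst
    have hN : Primrec fun x : (ℕ × ℕ) × ℕ => x.1.2 * x.1.2 * 2 ^ x.2 :=
      Primrec.nat_mul.comp (Primrec.nat_mul.comp hx2 hx2)
        (primrec_nat_pow.comp (Primrec.const 2) Primrec.snd)
    exact (primrec_nat_pow.comp (Primrec.nat_mul.comp hx1 hN) hN).pair ((Primrec.const 0).pair
      (primrec_nat_pow.comp (Primrec.nat_add.comp (Primrec.nat_mul.comp hx1 hN) hx2) hN))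
  refine ⟨_, hT.to_comp.comp (((hn.comp Computable.fst).pair (hd.comp Computable.fst)).pair
    Computable.snd), fun i r => ⟨?_, ?_⟩⟩
  · have := hd0 i
    positivity
  · dsimp only
    generalize n i = a
    have hb := hd0 i
    generalize d i = b at hb ⊢
    set N : ℕ := b * b * 2 ^ r with hNdef
    have hN : 0 < N := by positivity
    have hb' : (0 : ℝ) < b := by exact_mod_cast hb
    rcases Nat.eq_zero_or_pos a with rfl | ha
    · simp [tripleVal, hN.ne']
    · have ha' : (0 : ℝ) < a := by exact_mod_cast ha
      have ha1 : (1 : ℝ) ≤ a := by exact_mod_cast ha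
      have hN' : (0 : ℝ) < N := by exact_mod_cast hN
      have hy : (0 : ℝ) ≤ b / a := by positivity
      have h := abs_exp_neg_sub_le hy hN
      have e1 : _root_.expNegInvGlue ((a : ℝ) / b) = Real.exp (-((b : ℝ) / a)) := by
        rw [_root_.expNegInvGlue, if_neg (not_le.2 (by positivity)), inv_div]
      have e2 : tripleVal ((a * N) ^ N, 0, (a * N + b) ^ N) = (1 / (1 + (b : ℝ) / a / N)) ^ N := by
        simp only [tripleVal]
        push_cast
        rw [sub_zero, ← div_pow]
        congr 1
        field_simp
      rw [e1, e2]
      refine h.trans ?_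
      rw [hNdef]
      push_cast
      rw [div_pow, div_div, div_le_iff₀ (by positivity)]
      have : (1 / 2 : ℝ) ^ r * (a ^ 2 * (b * b * 2 ^ r)) = a ^ 2 * b ^ 2 * ((1 / 2) ^ r * 2 ^ r) := by
        ring
      have h2 : (1 / 2 : ℝ) ^ r * 2 ^ r = 1 := by rw [← mul_pow]; norm_num
      rw [this, h2, mul_one]
      nlinarith [pow_pos hb' 2, one_le_pow₀ ha1 (n := 2)]

/-! ### Smooth plateau functions on the circle -/

/-- The point of the circle with coordinate `θ mod 1`. -/
noncomputable def circlePt (θ : ℝ) : Circle := Circle.exp (2 * Real.pi * θ)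

theorem circlePt_add (a b : ℝ) : circlePt (a + b) = circlePt a * circlePt b := by
  simp only [circlePt, mul_add, Circle.exp_add]

theorem circlePt_zero : circlePt 0 = 1 := by simp [circlePt]

theorem circlePt_int (n : ℤ) : circlePt n = 1 := Circle.exp_two_pi_mul_int n

theorem circlePt_add_int (a : ℝ) (n : ℤ) : circlePt (a + n) = circlePt a := by
  rw [circlePt_add, circlePt_int, mul_one]

theorem contMDiff_circlePt : ContMDiff 𝓘(ℝ, ℝ) (𝓡 1) ∞ circlePt :=
  contMDiff_circleExp.comp (contDiff_const.mul contDiff_id).contMDiff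

/-- The function on the circle that is `H (θ + 1/2)` at the point with coordinate
`θ ∈ (-1/2, 1/2]`. -/
noncomputable def circleFun (H : ℝ → ℝ) (w : Circle) : ℝ :=
  H (Complex.arg w / (2 * Real.pi) + 1 / 2)

theorem circleFun_circlePt {H : ℝ → ℝ} (h01 : H 0 = H 1) {x : ℝ} (hx0 : 0 ≤ x) (hx1 : x ≤ 1) :
    circleFun H (circlePt (x - 1 / 2)) = H x := by
  have hpi := Real.pi_pos
  rcases hx0.eq_or_lt with rfl | hx0
  · have : circlePt (0 - 1 / 2) = circlePt (1 - 1 / 2) := by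
      have := circlePt_add_int (0 - 1 / 2) 1
      rw [← this]
      norm_num
    rw [this, circleFun, circlePt, Circle.arg_exp, h01]
    · congr 1
      field_simp
      norm_num
    · nlinarith
    · linarith
  · rw [circleFun, circlePt, Circle.arg_exp]
    · congr 1
      field_simp
      ring
    · nlinarith
    · nlinarith

/-- The argument is smooth off the cut at `-1`; near the cut the function is identically zero
because `H` vanishes near `0` and near `1`. -/
theorem contMDiff_circleFun {H : ℝ → ℝ} (hH : ContDiff ℝ ∞ H) {ε : ℝ} (hε : 0 < ε)
    (h0 : ∀ x ≤ ε, H x = 0) (h1 : ∀ x, 1 - ε ≤ x → H x = 0) :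
    ContMDiff (𝓡 1) 𝓘(ℝ, ℝ) ∞ (circleFun H) := by
  have hpi := Real.pi_pos
  have hcoe : ContMDiff (𝓡 1) 𝓘(ℝ, ℂ) ∞ (fun w : Circle => (w : ℂ)) :=
    haveI := finrank_real_complex_fact'
    contMDiff_coe_sphere
  intro w
  by_cases hw : (w : ℂ) ∈ Complex.slitPlane
  · have h2 : ContDiffAt ℝ ∞ (fun z : ℂ => H (Complex.arg z / (2 * Real.pi) + 1 / 2)) (w : ℂ) := by
      have h3 : ContDiffAt ℝ ∞ Complex.arg (w : ℂ) := by
        have h4 : ContDiffAt ℝ ∞ Complex.log (w : ℂ) :=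
          (Complex.contDiffAt_log hw (n := ∞)).restrict_scalars ℝ
        have h5 := Complex.imCLM.contDiff.contDiffAt.comp (w : ℂ) h4 (n := ∞)
        refine h5.congr_of_eventuallyEq (Filter.Eventually.of_forall fun z => ?_)
        simp [Complex.log_im]
      exact hH.contDiffAt.comp (w : ℂ) ((h3.div_const _).add contDiffAt_const)
    exact h2.contMDiffAt.comp w (hcoe w)
  · have harg : Complex.arg (w : ℂ) = Real.pi := by
      by_contra h
      exact hw (Complex.mem_slitPlane_iff_arg.2 ⟨h, w.coe_ne_zero⟩)
    have hre : (w : ℂ).re = -1 := by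
      have := Complex.cos_arg w.coe_ne_zero
      rw [harg, Circle.norm_coe, Real.cos_pi] at this
      linarith
    have hev : circleFun H =ᶠ[nhds w] fun _ => 0 := by
      -- The argument jumps at `-1`, but its absolute value is the arccosine of the real part and
      -- hence continuous.
      have hcont : Continuous fun z : Circle => Real.arccos (z : ℂ).re :=
        Real.continuous_arccos.comp (Complex.continuous_re.comp hcoe.continuous)
      have hlim : ∀ᶠ z : Circle in nhds w, Real.pi * (1 - 2 * ε) < Real.arccos (z : ℂ).re := by
        refine hcont.continuousAt.eventually (lt_mem_nhds ?_)
        beta_reduce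
        rw [hre, Real.arccos_neg_one]
        nlinarith
      filter_upwards [hlim] with z hz
      have habs : Real.arccos (z : ℂ).re = |Complex.arg (z : ℂ)| := by
        have := Complex.cos_arg z.coe_ne_zero
        rw [Circle.norm_coe, div_one] at this
        rw [← this, ← Real.cos_abs, Real.arccos_cos (abs_nonneg _) (Complex.abs_arg_le_pi _)]
      rw [habs] at hz
      rw [circleFun]
      rcases abs_cases (Complex.arg (z : ℂ)) with ⟨h, -⟩ | ⟨h, -⟩
      · rw [h] at hz
        apply h1
        rw [div_add_div _ _ (by positivity) (by norm_num), le_div_iff₀ (by positivity)]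
        nlinarith
      · rw [h] at hz
        apply h0
        rw [div_add_div _ _ (by positivity) (by norm_num), div_le_iff₀ (by positivity)]
        nlinarith
    exact contMDiffAt_const.congr_of_eventuallyEq hev

/-- A smooth function on the circle whose values at dyadic points are uniformly computable. -/
structure IsTameOnCircle (G : Circle → ℝ) : Prop where
  smooth : ContMDiff (𝓡 1) 𝓘(ℝ, ℝ) ∞ G
  computable : IsComputableFamily fun i : ℕ × ℕ => G (circlePt ((i.2 : ℝ) / 2 ^ i.1))

theorem exists_bound_of_continuous_circle {G : Circle → ℝ} (hG : Continuous G) :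
    ∃ B, ∀ w, |G w| ≤ B := by
  obtain ⟨B, hB⟩ := isCompact_univ.exists_bound_of_continuousOn hG.continuousOn
  exact ⟨B, fun w => hB w trivial⟩

/-- The derivative of the lift is continuous and periodic, hence bounded by its maximum over one
period. -/
theorem exists_lipschitzWith_of_contMDiff_circle {G : Circle → ℝ}
    (hG : ContMDiff (𝓡 1) 𝓘(ℝ, ℝ) ∞ G) : ∃ K, LipschitzWith K fun θ => G (circlePt θ) := by
  have hs : ContDiff ℝ ∞ fun θ => G (circlePt θ) :=
    contMDiff_iff_contDiff.1 (hG.comp contMDiff_circlePt)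
  have hper : Function.Periodic (deriv fun θ => G (circlePt θ)) 1 := by
    intro θ
    have : (fun θ => G (circlePt θ)) = fun θ => G (circlePt (θ + 1)) := by
      funext θ
      have := circlePt_add_int θ 1
      push_cast at this
      rw [this]
    conv_rhs => rw [this]
    rw [deriv_comp_add_const (fun θ => G (circlePt θ)) 1 θ]
  have hcont : Continuous (deriv fun θ => G (circlePt θ)) :=
    hs.continuous_deriv (by exact_mod_cast le_top)
  obtain ⟨B, hB⟩ := (isCompact_Icc (a := (0 : ℝ)) (b := 1)).exists_bound_of_continuousOn
    hcont.continuousOn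
  refine ⟨B.toNNReal, lipschitzWith_of_nnnorm_deriv_le (hs.differentiable (by simp)) fun θ => ?_⟩
  obtain ⟨y, hy, hy'⟩ := hper.exists_mem_Ico₀ one_pos θ
  rw [hy']
  have := hB y ⟨hy.1, hy.2.le⟩
  rw [← NNReal.coe_le_coe, coe_nnnorm]
  exact this.trans (Real.le_coe_toNNReal B)

theorem expNegInvGlue_le_one (x : ℝ) : expNegInvGlue x ≤ 1 := by
  rw [expNegInvGlue]
  split_ifs with h
  · exact zero_le_one
  · rw [Real.exp_le_one_iff]
    have := inv_pos.2 (not_le.1 h)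
    linarith

/-- This keeps the denominator of `Real.smoothTransition` away from zero, as
`IsComputableFamily.inv` needs. -/
theorem le_smoothTransition_denom (x : ℝ) :
    expNegInvGlue (1 / 2) ≤ expNegInvGlue x + expNegInvGlue (1 - x) := by
  rcases le_total (1 / 2) x with h | h
  · have h1 := expNegInvGlue.monotone h
    linarith [expNegInvGlue.nonneg (1 - x)]
  · have h1 := expNegInvGlue.monotone (show 1 / 2 ≤ 1 - x by linarith)
    linarith [expNegInvGlue.nonneg x]

/-- Truncated subtraction is harmless under `expNegInvGlue`, which vanishes at all nonpositive
arguments. -/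
theorem cast_sub_div_expNegInvGlue (a b d : ℕ) :
    expNegInvGlue (((a - b : ℕ) : ℝ) / d) = expNegInvGlue (((a : ℝ) - b) / d) := by
  rcases le_total b a with h | h
  · rw [Nat.cast_sub h]
  · rw [Nat.sub_eq_zero_of_le h, Nat.cast_zero, zero_div, expNegInvGlue.zero,
      expNegInvGlue.zero_of_nonpos]
    apply div_nonpos_of_nonpos_of_nonneg _ (Nat.cast_nonneg d)
    rw [sub_nonpos]
    exact_mod_cast h

theorem IsComputableFamily.smoothTransition_of {ι : Type*} [Primcodable ι] {a b a' b' d : ι → ℕ}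
    (ha : Computable a) (hb : Computable b) (ha' : Computable a') (hb' : Computable b') (hd : Computable d)
    (hd0 : ∀ i, 0 < d i) {v : ι → ℝ} (hv : ∀ i, v i = ((a i : ℝ) - b i) / d i)
    (hv' : ∀ i, 1 - v i = ((a' i : ℝ) - b' i) / d i) :
    IsComputableFamily fun i => Real.smoothTransition (v i) := by
  have h1 : IsComputableFamily fun i => _root_.expNegInvGlue (v i) :=
    (IsComputableFamily.expNegInvGlue (Primrec.nat_sub.to_comp.comp ha hb) hd hd0).congr fun i => by
      rw [cast_sub_div_expNegInvGlue, hv]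
  have h2 : IsComputableFamily fun i => _root_.expNegInvGlue (1 - v i) :=
    (IsComputableFamily.expNegInvGlue (Primrec.nat_sub.to_comp.comp ha' hb') hd hd0).congr fun i => by
      rw [cast_sub_div_expNegInvGlue, hv']
  have hm : 0 < _root_.expNegInvGlue (1 / 2) := expNegInvGlue.pos_of_pos (by norm_num)
  have h3 := (h1.add h2).inv hm fun i => le_smoothTransition_denom (v i)
  refine (h1.mul h3 (B := max 1 (_root_.expNegInvGlue (1 / 2))⁻¹) (fun i => ?_) fun i => ?_).congr
    fun i => (div_eq_mul_inv _ _).symm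
  · rw [abs_of_nonneg (expNegInvGlue.nonneg _)]
    exact (expNegInvGlue_le_one _).trans (le_max_left _ _)
  · have h4 := le_smoothTransition_denom (v i)
    rw [abs_of_pos (inv_pos.2 (hm.trans_le h4))]
    exact (inv_anti₀ hm h4).trans (le_max_right _ _)

/-- A smooth function that is `1` for `lo + 1 ≤ N x ≤ hi - 1` and `0` unless `lo < N x < hi`. -/
noncomputable def plateau (N lo hi : ℕ) (x : ℝ) : ℝ :=
  Real.smoothTransition (N * x - lo) * Real.smoothTransition (hi - N * x)

theorem contDiff_plateau (N lo hi : ℕ) : ContDiff ℝ ∞ (plateau N lo hi) := by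
  unfold plateau
  exact (Real.smoothTransition.contDiff.comp ((contDiff_const.mul contDiff_id).sub
    contDiff_const)).mul
      (Real.smoothTransition.contDiff.comp (contDiff_const.sub (contDiff_const.mul contDiff_id)))

theorem plateau_eq_one {N lo hi : ℕ} {x : ℝ} (h : lo + 1 ≤ N * x) (h' : N * x ≤ hi - 1) :
    plateau N lo hi x = 1 := by
  rw [plateau, Real.smoothTransition.one_of_one_le, Real.smoothTransition.one_of_one_le, mul_one] <;>
    linarith

theorem plateau_eq_zero_of_le {N lo hi : ℕ} {x : ℝ} (h : N * x ≤ lo) : plateau N lo hi x = 0 := by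
  rw [plateau, Real.smoothTransition.zero_of_nonpos (sub_nonpos.2 h), zero_mul]

theorem plateau_eq_zero_of_ge {N lo hi : ℕ} {x : ℝ} (h : hi ≤ N * x) : plateau N lo hi x = 0 := by
  rw [plateau, Real.smoothTransition.zero_of_nonpos (sub_nonpos.2 h), mul_zero]

theorem abs_plateau_le_one (N lo hi : ℕ) (x : ℝ) : |plateau N lo hi x| ≤ 1 := by
  rw [plateau, abs_of_nonneg (mul_nonneg (Real.smoothTransition.nonneg _)
    (Real.smoothTransition.nonneg _))]
  exact mul_le_one₀ (Real.smoothTransition.le_one _) (Real.smoothTransition.nonneg _)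
    (Real.smoothTransition.le_one _)

/-- Numerator of the coordinate, shifted by `1/2` and reduced to `[0, 1)`, of the dyadic point
`a / 2 ^ p`; the denominator is `2 ^ (p + 1)`. -/
def shiftedNum (i : ℕ × ℕ) : ℕ := (2 * i.2 + 2 ^ i.1) % 2 ^ (i.1 + 1)

def shiftedDen (i : ℕ × ℕ) : ℕ := 2 ^ (i.1 + 1)

theorem primrec_shiftedDen : Primrec shiftedDen :=
  primrec_nat_pow.comp (Primrec.const 2) (Primrec.succ.comp Primrec.fst)

theorem primrec_shiftedNum : Primrec shiftedNum :=
  Primrec.nat_mod.comp (Primrec.nat_add.comp (Primrec.nat_mul.comp (Primrec.const 2) Primrec.snd)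
    (primrec_nat_pow.comp (Primrec.const 2) Primrec.fst)) primrec_shiftedDen

theorem shiftedDen_pos (i : ℕ × ℕ) : 0 < shiftedDen i := by
  rw [shiftedDen]; positivity

theorem shifted_nonneg (i : ℕ × ℕ) : (0 : ℝ) ≤ (shiftedNum i : ℝ) / shiftedDen i := by positivity

theorem shifted_le_one (i : ℕ × ℕ) : (shiftedNum i : ℝ) / shiftedDen i ≤ 1 := by
  rw [div_le_one (by exact_mod_cast shiftedDen_pos i)]
  exact_mod_cast (Nat.mod_lt _ (shiftedDen_pos i)).le

theorem circlePt_dyadic (i : ℕ × ℕ) :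
    circlePt ((i.2 : ℝ) / 2 ^ i.1) = circlePt ((shiftedNum i : ℝ) / shiftedDen i - 1 / 2) := by
  have h := Nat.mod_add_div (2 * i.2 + 2 ^ i.1) (2 ^ (i.1 + 1))
  have h' : (shiftedNum i : ℝ) + 2 ^ (i.1 + 1) * ((2 * i.2 + 2 ^ i.1) / 2 ^ (i.1 + 1) : ℕ) =
      2 * i.2 + 2 ^ i.1 := by
    rw [shiftedNum]; exact_mod_cast h
  rw [← circlePt_add_int ((shiftedNum i : ℝ) / shiftedDen i - 1 / 2)
    (((2 * i.2 + 2 ^ i.1) / 2 ^ (i.1 + 1) : ℕ) : ℤ)]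
  congr 1
  rw [Int.cast_natCast]
  generalize (((2 * i.2 + 2 ^ i.1) / 2 ^ (i.1 + 1) : ℕ) : ℝ) = q at h' ⊢
  rw [shiftedDen]
  push_cast
  field_simp
  rw [pow_succ] at h' ⊢
  linear_combination (-(2 : ℝ) ^ i.1 * 2) * h'

theorem isTameOnCircle_circleFun {H : ℝ → ℝ} (hH : ContDiff ℝ ∞ H) {ε : ℝ} (hε : 0 < ε)
    (h0 : ∀ x ≤ ε, H x = 0) (h1 : ∀ x, 1 - ε ≤ x → H x = 0)
    (hc : IsComputableFamily fun i : ℕ × ℕ => H ((shiftedNum i : ℝ) / shiftedDen i)) :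
    IsTameOnCircle (circleFun H) := by
  refine ⟨contMDiff_circleFun hH hε h0 h1, hc.congr fun i => ?_⟩
  rw [circlePt_dyadic, circleFun_circlePt _ (shifted_nonneg i) (shifted_le_one i)]
  rw [h0 0 hε.le, h1 1 (by linarith)]

theorem isComputableFamily_plateau {N lo hi : ℕ} (hhi : 1 ≤ hi) :
    IsComputableFamily fun i : ℕ × ℕ => plateau N lo hi ((shiftedNum i : ℝ) / shiftedDen i) := by
  have hn : Computable fun i => N * shiftedNum i :=
    (Primrec.nat_mul.comp (Primrec.const N) primrec_shiftedNum).to_comp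
  have hm : ∀ k : ℕ, Computable fun i => k * shiftedDen i := fun k =>
    (Primrec.nat_mul.comp (Primrec.const k) primrec_shiftedDen).to_comp
  have hd : ∀ i, ((shiftedDen i : ℕ) : ℝ) ≠ 0 := fun i => by exact_mod_cast (shiftedDen_pos i).ne'
  refine (IsComputableFamily.smoothTransition_of (v := fun i => N * ((shiftedNum i : ℝ) /
    shiftedDen i) - lo) hn (hm lo) (hm (lo + 1)) hn primrec_shiftedDen.to_comp shiftedDen_pos
      (fun i => ?_) fun i => ?_).mul (B := 1) (IsComputableFamily.smoothTransition_of
      (v := fun i => hi - N * ((shiftedNum i : ℝ) / shiftedDen i)) (hm hi) hn hn (hm (hi - 1))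
      primrec_shiftedDen.to_comp shiftedDen_pos (fun i => ?_) fun i => ?_) (fun i => ?_) fun i => ?_
  iterate 4
    · have := hd i
      push_cast [Nat.cast_sub hhi]
      field_simp
      try ring1
  iterate 2
    · rw [abs_of_nonneg (Real.smoothTransition.nonneg _)]
      exact Real.smoothTransition.le_one _

theorem plateau_margin {N lo hi : ℕ} (hlo : 1 ≤ lo) (hhi : hi + 1 ≤ N) :
    (∀ x ≤ 1 / (N : ℝ), plateau N lo hi x = 0) ∧
      ∀ x, 1 - 1 / (N : ℝ) ≤ x → plateau N lo hi x = 0 := by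
  have hN : (0 : ℝ) < N := by exact_mod_cast (by omega : 0 < N)
  have h1 : (1 : ℝ) ≤ lo := by exact_mod_cast hlo
  have h2 : (hi : ℝ) + 1 ≤ N := by exact_mod_cast hhi
  refine ⟨fun x hx => plateau_eq_zero_of_le ?_, fun x hx => plateau_eq_zero_of_ge ?_⟩
  · rw [le_div_iff₀ hN] at hx; linarith
  · have := mul_le_mul_of_nonneg_left hx hN.le
    rw [mul_sub, mul_one, mul_one_div_cancel hN.ne'] at this
    linarith

theorem isTameOnCircle_plateau {N lo hi : ℕ} (hlo : 1 ≤ lo) (hhi1 : 1 ≤ hi) (hhi : hi + 1 ≤ N) :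
    IsTameOnCircle (circleFun (plateau N lo hi)) := by
  have hN : (0 : ℝ) < N := by exact_mod_cast (by omega : 0 < N)
  obtain ⟨h0, h1⟩ := plateau_margin hlo hhi
  exact isTameOnCircle_circleFun (contDiff_plateau N lo hi) (one_div_pos.2 hN) h0 h1
    (isComputableFamily_plateau hhi1)

/-- The bump function that detects the first digit `j` in base `β`. -/
noncomputable def digitBump (β j : ℕ) : Circle → ℝ :=
  circleFun (plateau (4 * β) (2 * β + 4 * j - 1) (2 * β + 4 * j + 2))

theorem isTameOnCircle_digitBump {β j : ℕ} (h : 4 * j + 3 ≤ 2 * β) :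
    IsTameOnCircle (digitBump β j) :=
  isTameOnCircle_plateau (by omega) (by omega) (by omega)

/-- After the shift by `1/2`, multiplication by `4β` sends the point into `[2β + 4i, 2β + 4i + 1]`.
The plateau of the bump is this interval for `i = j`, and its support misses the intervals of the
other digits. -/
theorem digitBump_circlePt {β j i : ℕ} (hj : 4 * j + 3 ≤ 2 * β) (hi : 4 * i + 3 ≤ 2 * β) {v : ℝ}
    (hv0 : 0 ≤ v) (hv1 : v ≤ 1 / 4) :
    digitBump β j (circlePt ((i + v) / β)) = if i = j then 1 else 0 := by
  have hβ : (0 : ℝ) < β := by exact_mod_cast (by omega : 0 < β)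
  have hi' : 4 * (i : ℝ) + 3 ≤ 2 * β := by exact_mod_cast hi
  have e : ((i : ℝ) + v) / β = (((i : ℝ) + v) / β + 1 / 2) - 1 / 2 := by ring
  have hx0 : (0 : ℝ) ≤ ((i : ℝ) + v) / β + 1 / 2 := by positivity
  have hx1 : ((i : ℝ) + v) / β + 1 / 2 ≤ 1 := by
    have : ((i : ℝ) + v) / β ≤ 1 / 2 := by
      rw [div_le_iff₀ hβ]; linarith
    linarith
  have hN : ((4 * β : ℕ) : ℝ) * (((i : ℝ) + v) / β + 1 / 2) = 4 * (i + v) + 2 * β := by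
    push_cast; field_simp; ring
  have hlo : ((2 * β + 4 * j - 1 : ℕ) : ℝ) = 2 * β + 4 * j - 1 := by
    rw [Nat.cast_sub (by omega)]; push_cast; ring
  obtain ⟨h0, h1⟩ := plateau_margin (N := 4 * β) (lo := 2 * β + 4 * j - 1)
    (hi := 2 * β + 4 * j + 2) (by omega) (by omega)
  have hNpos : (0 : ℝ) < 1 / ((4 * β : ℕ) : ℝ) := by push_cast; positivity
  rw [digitBump, e, circleFun_circlePt (by rw [h0 0 hNpos.le, h1 1 (by linarith)]) hx0 hx1]
  split_ifs with hij
  · subst hij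
    apply plateau_eq_one <;> rw [hN]
    · rw [hlo]; linarith
    · push_cast; linarith
  · rcases lt_or_gt_of_ne hij with h | h
    · apply plateau_eq_zero_of_le
      have : (i : ℝ) + 1 ≤ j := by exact_mod_cast h
      rw [hN, hlo]; linarith
    · apply plateau_eq_zero_of_ge
      have : (j : ℝ) + 1 ≤ i := by exact_mod_cast h
      rw [hN]; push_cast; linarith

/-- A smooth function on the circle that coincides with the coordinate `θ` for `0 ≤ θ ≤ 1/4`. -/
noncomputable def coordFun : Circle → ℝ := circleFun fun x => (x - 1 / 2) * plateau 8 3 7 x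

theorem isTameOnCircle_coordFun : IsTameOnCircle coordFun := by
  obtain ⟨h0, h1⟩ := plateau_margin (N := 8) (lo := 3) (hi := 7) (by omega) (by omega)
  refine isTameOnCircle_circleFun ((contDiff_id.sub contDiff_const).mul (contDiff_plateau 8 3 7))
    (ε := 1 / ((8 : ℕ) : ℝ)) (by norm_num) (fun x hx => ?_) (fun x hx => ?_) ?_
  · rw [h0 x hx, mul_zero]
  · rw [h1 x hx, mul_zero]
  · refine IsComputableFamily.mul (B := 1) (((IsComputableFamily.ratio primrec_shiftedNum.to_comp
      primrec_shiftedDen.to_comp shiftedDen_pos).add (IsComputableFamily.const (-1 / 2))).congr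
        fun i => ?_) (isComputableFamily_plateau (by norm_num)) (fun i => ?_)
        fun i => abs_plateau_le_one _ _ _ _
    · push_cast; ring
    · have := shifted_nonneg i
      have := shifted_le_one i
      rw [abs_le]
      constructor <;> linarith

/-- For `x = θ + 1/2` one has `4 ≤ 8x ≤ 6`, where `plateau 8 3 7` equals `1`. -/
theorem coordFun_circlePt {θ : ℝ} (h0 : 0 ≤ θ) (h1 : θ ≤ 1 / 4) : coordFun (circlePt θ) = θ := by
  obtain ⟨h2, h3⟩ := plateau_margin (N := 8) (lo := 3) (hi := 7) (by omega) (by omega)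
  have e : θ = (θ + 1 / 2) - 1 / 2 := by ring
  rw [coordFun]
  conv_lhs => rw [e]
  rw [circleFun_circlePt _ (by linarith) (by linarith), plateau_eq_one, mul_one]
  · ring
  · push_cast; linarith
  · push_cast; linarith
  · rw [h2 0 (by norm_num), h3 1 (by norm_num)]; ring

/-! ### Computable shears of the torus -/

theorem IsComputableFamily.exists_nat_approx {ι : Type*} [Primcodable ι] {v : ι → ℝ}
    (hv : IsComputableFamily v) (h0 : ∀ i, 0 ≤ v i) :
    ∃ g : ι × ℕ → ℕ, Computable g ∧ ∀ i r, |v i - (g (i, r) : ℝ) / 2 ^ r| ≤ (1 / 2) ^ r := by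
  obtain ⟨c, hc, h⟩ := hv
  -- Adding half the divisor before the integer division rounds to the nearest multiple of `2 ^
  -- (-r)`. Half of the allowed error goes to the rounding, half to the given approximation.
  have hT : Primrec fun x : (ℕ × ℕ × ℕ) × ℕ =>
      (2 * (x.1.1 - x.1.2.1) * 2 ^ x.2 + x.1.2.2) / (2 * x.1.2.2) := by
    have a1 : Primrec fun x : (ℕ × ℕ × ℕ) × ℕ => x.1.1 := Primrec.fst.comp Primrec.fst
    have a2 : Primrec fun x : (ℕ × ℕ × ℕ) × ℕ => x.1.2.1 :=
      Primrec.fst.comp (Primrec.snd.comp Primrec.fst)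
    have a3 : Primrec fun x : (ℕ × ℕ × ℕ) × ℕ => x.1.2.2 :=
      Primrec.snd.comp (Primrec.snd.comp Primrec.fst)
    exact Primrec.nat_div.comp (Primrec.nat_add.comp (Primrec.nat_mul.comp
      (Primrec.nat_mul.comp (Primrec.const 2) (Primrec.nat_sub.comp a1 a2))
        (primrec_nat_pow.comp (Primrec.const 2) Primrec.snd)) a3)
      (Primrec.nat_mul.comp (Primrec.const 2) a3)
  refine ⟨_, hT.to_comp.comp ((hc.comp (Computable.fst.pair
    (Computable.succ.comp Computable.snd))).pair Computable.snd), fun i r => ?_⟩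
  obtain ⟨h1, h2⟩ := h i (r + 1)
  dsimp only [Nat.succ_eq_add_one]
  generalize c (i, r + 1) = t at h1 h2 ⊢
  obtain ⟨A, B, D⟩ := t
  dsimp only [tripleVal] at h1 h2 ⊢
  have hD : (0 : ℝ) < D := by exact_mod_cast h1
  have h3 : |v i - ((A - B : ℕ) : ℝ) / D| ≤ (1 / 2) ^ (r + 1) := by
    rcases le_total B A with hBA | hBA
    · rwa [Nat.cast_sub hBA]
    · rw [Nat.sub_eq_zero_of_le hBA, Nat.cast_zero, zero_div, sub_zero, abs_of_nonneg (h0 i)]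
      have : ((A : ℝ) - B) / D ≤ 0 := by
        apply div_nonpos_of_nonpos_of_nonneg _ hD.le
        rw [sub_nonpos]; exact_mod_cast hBA
      linarith [(abs_le.1 h2).2]
  generalize A - B = n at h3 ⊢
  set q := (2 * n * 2 ^ r + D) / (2 * D) with hq
  have h4 : (q : ℝ) * (2 * D) ≤ 2 * n * 2 ^ r + D := by
    exact_mod_cast Nat.div_mul_le_self (2 * n * 2 ^ r + D) (2 * D)
  have h5 : 2 * (n : ℝ) * 2 ^ r + D < (q + 1) * (2 * D) := by
    have := Nat.lt_mul_div_succ (2 * n * 2 ^ r + D) (show 0 < 2 * D by omega)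
    rw [← hq, mul_comm (2 * D)] at this
    exact_mod_cast this
  have hp : (0 : ℝ) < 2 ^ r := by positivity
  have h6 : |(n : ℝ) / D - q / 2 ^ r| ≤ (1 / 2) ^ (r + 1) := by
    have e : (n : ℝ) / D - q / 2 ^ r = (n * 2 ^ r - q * D) / (D * 2 ^ r) := by field_simp
    have e2 : (1 / 2 : ℝ) ^ (r + 1) = (D / 2) / (D * 2 ^ r) := by
      rw [pow_succ, one_div, inv_pow]; field_simp
    rw [e, e2, abs_div, abs_of_pos (show 0 < (D : ℝ) * 2 ^ r by positivity)]
    apply div_le_div_of_nonneg_right _ (by positivity)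
    rw [abs_le]; constructor <;> linarith
  calc |v i - q / 2 ^ r| = |(v i - n / D) + (n / D - q / 2 ^ r)| := by ring_nf
    _ ≤ (1 / 2) ^ (r + 1) + (1 / 2) ^ (r + 1) := (abs_add_le _ _).trans (add_le_add h3 h6)
    _ = (1 / 2) ^ r := by ring

/-- Multiplication of the `i`-th coordinate of a point of the torus. -/
noncomputable def mulAt (i : Fin 4) (w : Circle) (z : Torus4) : Torus4 :=
  match i with
  | 0 => ((w * z.1.1, z.1.2), z.2)
  | 1 => ((z.1.1, w * z.1.2), z.2)
  | 2 => (z.1, (w * z.2.1, z.2.2))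
  | 3 => (z.1, (z.2.1, w * z.2.2))

noncomputable def addAt (i : Fin 4) (t : ℝ) (x : (ℝ × ℝ) × (ℝ × ℝ)) : (ℝ × ℝ) × (ℝ × ℝ) :=
  match i with
  | 0 => ((t + x.1.1, x.1.2), x.2)
  | 1 => ((x.1.1, t + x.1.2), x.2)
  | 2 => (x.1, (t + x.2.1, x.2.2))
  | 3 => (x.1, (x.2.1, t + x.2.2))

theorem toTorus4_eq (x : (ℝ × ℝ) × (ℝ × ℝ)) :
    toTorus4 x = ((circlePt x.1.1, circlePt x.1.2), (circlePt x.2.1, circlePt x.2.2)) := rfl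

theorem toTorus4_addAt (i : Fin 4) (t : ℝ) (x : (ℝ × ℝ) × (ℝ × ℝ)) :
    toTorus4 (addAt i t x) = mulAt i (circlePt t) (toTorus4 x) := by
  fin_cases i <;> simp only [addAt, mulAt, toTorus4_eq, circlePt_add]

theorem mulAt_mulAt (i : Fin 4) (w w' : Circle) (z : Torus4) :
    mulAt i w (mulAt i w' z) = mulAt i (w * w') z := by
  fin_cases i <;> simp only [mulAt, mul_assoc]

theorem mulAt_one (i : Fin 4) (z : Torus4) : mulAt i 1 z = z := by
  fin_cases i <;> simp only [mulAt, one_mul]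

theorem contMDiff_mulAt (i : Fin 4) {W : Torus4 → Circle} (hW : ContMDiff torus4Model (𝓡 1) ∞ W) :
    ContMDiff torus4Model torus4Model ∞ fun z => mulAt i (W z) z := by
  have h1 : ContMDiff torus4Model ((𝓡 1).prod (𝓡 1)) ∞ fun z : Torus4 => z.1 := contMDiff_fst
  have h2 : ContMDiff torus4Model ((𝓡 1).prod (𝓡 1)) ∞ fun z : Torus4 => z.2 := contMDiff_snd
  fin_cases i
  · exact ((hW.mul h1.fst).prodMk h1.snd).prodMk h2
  · exact (h1.fst.prodMk (hW.mul h1.snd)).prodMk h2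
  · exact h1.prodMk ((hW.mul h2.fst).prodMk h2.snd)
  · exact h1.prodMk (h2.fst.prodMk (hW.mul h2.snd))

/-- A smooth function on the torus whose values at dyadic points are uniformly computable,
together with the bounds that make such functions an algebra. -/
structure IsTame (Γ : Torus4 → ℝ) : Prop where
  smooth : ContMDiff torus4Model 𝓘(ℝ, ℝ) ∞ Γ
  bounded : ∃ B, ∀ z, |Γ z| ≤ B
  lipschitz : ∃ K, LipschitzWith K fun x => Γ (toTorus4 x)
  computable : IsComputableFamily fun i : ℕ × ((ℕ × ℕ) × (ℕ × ℕ)) => Γ (toTorus4 (dyadic i.1 i.2))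

namespace IsTame

variable {Γ Δ : Torus4 → ℝ}

theorem const (q : ℚ) : IsTame fun _ => (q : ℝ) :=
  ⟨contMDiff_const, ⟨_, fun _ => le_rfl⟩, ⟨0, LipschitzWith.const _⟩, IsComputableFamily.const q⟩

theorem neg (h : IsTame Γ) : IsTame fun z => -Γ z := by
  obtain ⟨B, hB⟩ := h.bounded
  obtain ⟨K, hK⟩ := h.lipschitz
  exact ⟨contDiff_neg.contMDiff.comp h.smooth, ⟨B, fun z => by rw [abs_neg]; exact hB z⟩,
    ⟨K, hK.neg⟩, h.computable.neg⟩

theorem add (h : IsTame Γ) (h' : IsTame Δ) : IsTame fun z => Γ z + Δ z := by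
  obtain ⟨B, hB⟩ := h.bounded
  obtain ⟨K, hK⟩ := h.lipschitz
  obtain ⟨B', hB'⟩ := h'.bounded
  obtain ⟨K', hK'⟩ := h'.lipschitz
  exact ⟨h.smooth.add h'.smooth, ⟨B + B', fun z => (abs_add_le _ _).trans
    (add_le_add (hB z) (hB' z))⟩, ⟨_, hK.add hK'⟩, h.computable.add h'.computable⟩

theorem mul (h : IsTame Γ) (h' : IsTame Δ) : IsTame fun z => Γ z * Δ z := by
  obtain ⟨B, hB⟩ := h.bounded
  obtain ⟨K, hK⟩ := h.lipschitz
  obtain ⟨B', hB'⟩ := h'.bounded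
  obtain ⟨K', hK'⟩ := h'.lipschitz
  have hB0 : 0 ≤ B := (abs_nonneg _).trans (hB (toTorus4 0))
  have hB0' : 0 ≤ B' := (abs_nonneg _).trans (hB' (toTorus4 0))
  refine ⟨h.smooth.mul h'.smooth, ⟨B * B', fun z => ?_⟩,
    ⟨B.toNNReal * K' + B'.toNNReal * K, LipschitzWith.of_dist_le_mul fun x y => ?_⟩,
    h.computable.mul h'.computable (B := max B B') (fun i => (hB _).trans (le_max_left _ _))
      fun i => (hB' _).trans (le_max_right _ _)⟩
  · rw [abs_mul]
    exact mul_le_mul (hB z) (hB' z) (abs_nonneg _) hB0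
  · have h1 := hK.dist_le_mul x y
    have h2 := hK'.dist_le_mul x y
    rw [Real.dist_eq] at h1 h2 ⊢
    push_cast
    rw [Real.coe_toNNReal B hB0, Real.coe_toNNReal B' hB0']
    calc |Γ (toTorus4 x) * Δ (toTorus4 x) - Γ (toTorus4 y) * Δ (toTorus4 y)|
        = |Γ (toTorus4 x) * (Δ (toTorus4 x) - Δ (toTorus4 y)) +
            Δ (toTorus4 y) * (Γ (toTorus4 x) - Γ (toTorus4 y))| := by ring_nf
      _ ≤ |Γ (toTorus4 x)| * |Δ (toTorus4 x) - Δ (toTorus4 y)| +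
            |Δ (toTorus4 y)| * |Γ (toTorus4 x) - Γ (toTorus4 y)| := by
          rw [← abs_mul, ← abs_mul]; exact abs_add_le _ _
      _ ≤ B * (K' * dist x y) + B' * (K * dist x y) := by
          gcongr
          · exact hB _
          · exact hB' _
      _ = _ := by ring

theorem sum {σ : Type*} (s : Finset σ) {F : σ → Torus4 → ℝ} (h : ∀ a ∈ s, IsTame (F a)) :
    IsTame fun z => ∑ a ∈ s, F a z := by
  classical
  induction s using Finset.induction_on with
  | empty => simpa using const 0
  | insert a s ha ih =>
    simp only [Finset.sum_insert ha]
    exact (h a (Finset.mem_insert_self a s)).add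
      (ih fun b hb => h b (Finset.mem_insert_of_mem hb))

theorem of_circle {G : Circle → ℝ} (hG : IsTameOnCircle G) {π : Torus4 → Circle}
    (hπ : ContMDiff torus4Model (𝓡 1) ∞ π) {ϖ : (ℝ × ℝ) × (ℝ × ℝ) → ℝ} (hϖ : LipschitzWith 1 ϖ)
    (hπϖ : ∀ x, π (toTorus4 x) = circlePt (ϖ x)) {s : (ℕ × ℕ) × (ℕ × ℕ) → ℕ} (hs : Computable s)
    (hϖs : ∀ p a, ϖ (dyadic p a) = (s a : ℝ) / 2 ^ p) : IsTame fun z => G (π z) := by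
  obtain ⟨B, hB⟩ := exists_bound_of_continuous_circle hG.smooth.continuous
  obtain ⟨K, hK⟩ := exists_lipschitzWith_of_contMDiff_circle hG.smooth
  refine ⟨hG.smooth.comp hπ, ⟨B, fun z => hB _⟩, ⟨K * 1, ?_⟩,
    (hG.computable.comp (Computable.fst.pair (hs.comp Computable.snd))).congr fun i => ?_⟩
  · simp only [hπϖ]
    exact hK.comp hϖ
  · simp only [hπϖ, hϖs]

theorem coord0 {G : Circle → ℝ} (hG : IsTameOnCircle G) : IsTame fun z => G z.1.1 :=
  of_circle hG contMDiff_fst.fst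
    ((LipschitzWith.prod_fst.comp LipschitzWith.prod_fst).weaken (by simp)) (fun _ => rfl)
    (Computable.fst.comp Computable.fst) fun _ _ => rfl

theorem coord1 {G : Circle → ℝ} (hG : IsTameOnCircle G) : IsTame fun z => G z.1.2 :=
  of_circle hG contMDiff_fst.snd
    ((LipschitzWith.prod_snd.comp LipschitzWith.prod_fst).weaken (by simp)) (fun _ => rfl)
    (Computable.snd.comp Computable.fst) fun _ _ => rfl

theorem coord2 {G : Circle → ℝ} (hG : IsTameOnCircle G) : IsTame fun z => G z.2.1 :=
  of_circle hG contMDiff_snd.fst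
    ((LipschitzWith.prod_fst.comp LipschitzWith.prod_snd).weaken (by simp)) (fun _ => rfl)
    (Computable.fst.comp Computable.snd) fun _ _ => rfl

theorem coord3 {G : Circle → ℝ} (hG : IsTameOnCircle G) : IsTame fun z => G z.2.2 :=
  of_circle hG contMDiff_snd.snd
    ((LipschitzWith.prod_snd.comp LipschitzWith.prod_snd).weaken (by simp)) (fun _ => rfl)
    (Computable.snd.comp Computable.snd) fun _ _ => rfl

end IsTame

/-- A self-map of the torus with a Lipschitz lift whose values at dyadic points are computable. -/
def HasComputableLift (F : Torus4 → Torus4) : Prop :=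
  ∃ f : (ℝ × ℝ) × (ℝ × ℝ) → (ℝ × ℝ) × (ℝ × ℝ), (∀ x, F (toTorus4 x) = toTorus4 (f x)) ∧
    (∃ K, LipschitzWith K f) ∧
    ∃ g : ℕ × ℕ × ((ℕ × ℕ) × (ℕ × ℕ)) → (ℕ × ℕ) × (ℕ × ℕ), Computable g ∧
      ∃ C : ℝ, ∀ p r a, dist (f (dyadic p a)) (dyadic r (g (p, r, a))) ≤ C * (1 / 2) ^ r

/-- Rounding of `n / 2 ^ (r + s + 1)` to the nearest multiple of `1 / 2 ^ r`. -/
def roundNat (s n : ℕ) : ℕ := (n + 2 ^ s) / 2 ^ (s + 1)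

theorem abs_sub_roundNat_le (r s n : ℕ) :
    |(n : ℝ) / 2 ^ (r + s + 1) - (roundNat s n : ℝ) / 2 ^ r| ≤ (1 / 2) ^ (r + 1) := by
  have h4 : (roundNat s n : ℝ) * 2 ^ (s + 1) ≤ n + 2 ^ s := by
    exact_mod_cast Nat.div_mul_le_self (n + 2 ^ s) (2 ^ (s + 1))
  have h5 : (n : ℝ) + 2 ^ s < 2 ^ (s + 1) * (roundNat s n + 1) := by
    exact_mod_cast Nat.lt_mul_div_succ (n + 2 ^ s) (show 0 < 2 ^ (s + 1) by positivity)
  have e : (n : ℝ) / 2 ^ (r + s + 1) - (roundNat s n : ℝ) / 2 ^ r =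
      (n - roundNat s n * 2 ^ (s + 1)) / 2 ^ (r + s + 1) := by
    field_simp
    ring
  have e2 : (1 / 2 : ℝ) ^ (r + 1) = 2 ^ s / 2 ^ (r + s + 1) := by
    rw [one_div, inv_pow]; field_simp; ring
  rw [e, e2, abs_div, abs_of_pos (show (0 : ℝ) < 2 ^ (r + s + 1) by positivity)]
  apply div_le_div_of_nonneg_right _ (by positivity)
  rw [pow_succ] at h4 h5 ⊢
  rw [abs_le]
  constructor <;> linarith

def roundNat4 (s : ℕ) (a : (ℕ × ℕ) × (ℕ × ℕ)) : (ℕ × ℕ) × (ℕ × ℕ) :=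
  ((roundNat s a.1.1, roundNat s a.1.2), (roundNat s a.2.1, roundNat s a.2.2))

theorem computable_roundNat4 (s : ℕ) : Computable (roundNat4 s) := by
  have h : Primrec (roundNat s) :=
    Primrec.nat_div.comp (Primrec.nat_add.comp Primrec.id (Primrec.const _)) (Primrec.const _)
  exact (((h.comp (Primrec.fst.comp Primrec.fst)).pair
    (h.comp (Primrec.snd.comp Primrec.fst))).pair
      ((h.comp (Primrec.fst.comp Primrec.snd)).pair
        (h.comp (Primrec.snd.comp Primrec.snd)))).to_comp

namespace HasComputableLift

variable {F G : Torus4 → Torus4}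

/-- The constant `C` is absorbed by computing `s + 1` additional binary digits, where `C ≤ 2 ^ s`,
and rounding them away. -/
theorem isComputableTorusMap (h : HasComputableLift F) : IsComputableTorusMap F := by
  obtain ⟨f, hf, -, g, hg, C, hfg⟩ := h
  obtain ⟨s, hs⟩ := IsComputableFamily.exists_pow_two_ge C
  refine ⟨fun x => roundNat4 s (g (x.1, x.2.1 + s + 1, x.2.2)), (computable_roundNat4 s).comp
    (hg.comp (Computable.fst.pair ((Computable.succ.comp (Primrec.nat_add.to_comp.comp
      (Computable.fst.comp Computable.snd) (Computable.const s))).pair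
        (Computable.snd.comp Computable.snd)))), fun p r a => ⟨_, hf _, ?_⟩⟩
  have h1 : dist (f (dyadic p a)) (dyadic (r + s + 1) (g (p, r + s + 1, a))) ≤
      (1 / 2) ^ (r + 1) := by
    refine (hfg p (r + s + 1) a).trans ?_
    calc C * (1 / 2) ^ (r + s + 1) ≤ (2 : ℝ) ^ s * (1 / 2) ^ (r + s + 1) := by gcongr
      _ = (1 / 2) ^ (r + 1) * ((1 / 2) ^ s * 2 ^ s) := by ring
      _ = (1 / 2) ^ (r + 1) := by rw [← mul_pow]; norm_num
  have h2 : ∀ b : (ℕ × ℕ) × (ℕ × ℕ), dist (dyadic (r + s + 1) b) (dyadic r (roundNat4 s b)) ≤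
      (1 / 2) ^ (r + 1) := fun b =>
    max_le (max_le (abs_sub_roundNat_le r s _) (abs_sub_roundNat_le r s _))
      (max_le (abs_sub_roundNat_le r s _) (abs_sub_roundNat_le r s _))
  calc _ ≤ _ := dist_triangle _ (dyadic (r + s + 1) (g (p, r + s + 1, a))) _
    _ ≤ (1 / 2) ^ (r + 1) + (1 / 2) ^ (r + 1) := add_le_add h1 (h2 _)
    _ = (1 / 2) ^ r := by ring

/-- The outer map is evaluated at a dyadic approximation of the inner value; its Lipschitz constant
multiplies the inner error. This is why the definition admits an arbitrary constant `C`. -/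
theorem comp (hG : HasComputableLift G) (hF : HasComputableLift F) :
    HasComputableLift (G ∘ F) := by
  obtain ⟨f, hf, ⟨K, hK⟩, c, hc, C, hfc⟩ := hF
  obtain ⟨g, hg, ⟨K', hK'⟩, d, hd, C', hgd⟩ := hG
  refine ⟨g ∘ f, fun x => by simp only [Function.comp_apply, hf, hg], ⟨_, hK'.comp hK⟩,
    fun x => d (x.2.1, x.2.1, c x), ?_, K' * C + C', fun p r a => ?_⟩
  · have h1 : Computable fun x : ℕ × ℕ × ((ℕ × ℕ) × (ℕ × ℕ)) => x.2.1 :=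
      Computable.fst.comp Computable.snd
    exact hd.comp (h1.pair (h1.pair hc))
  · calc _ ≤ _ := dist_triangle _ (g (dyadic r (c (p, r, a)))) _
      _ ≤ K' * (C * (1 / 2) ^ r) + C' * (1 / 2) ^ r :=
        add_le_add ((hK'.dist_le_mul _ _).trans
          (mul_le_mul_of_nonneg_left (hfc p r a) K'.coe_nonneg)) (hgd _ _ _)
      _ = _ := by ring

theorem shear (i : Fin 4) {Γ : Torus4 → ℝ} (hΓ : IsTame Γ) :
    HasComputableLift fun z => mulAt i (circlePt (Γ z)) z := by
  obtain ⟨B, hB⟩ := hΓ.bounded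
  obtain ⟨K, hK⟩ := hΓ.lipschitz
  -- Adding the integer `N` to the displacement changes nothing modulo `1` and makes it nonnegative,
  -- so that natural numerators suffice.
  obtain ⟨N, hN⟩ := exists_nat_ge B
  have hpos : ∀ z, 0 ≤ Γ z + N := fun z => by have := (abs_le.1 (hB z)).1; linarith
  have hL : LipschitzWith K fun x => Γ (toTorus4 x) + N := by
    simpa using hK.add (LipschitzWith.const (N : ℝ))
  refine ⟨fun x => addAt i (Γ (toTorus4 x) + N) x, fun x => ?_, ?_, ?_⟩
  · have := circlePt_add_int (Γ (toTorus4 x)) N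
    push_cast at this
    rw [toTorus4_addAt, this]
  · have h1 : LipschitzWith 1 fun x : (ℝ × ℝ) × (ℝ × ℝ) => x.1 := LipschitzWith.prod_fst
    have h2 : LipschitzWith 1 fun x : (ℝ × ℝ) × (ℝ × ℝ) => x.2 := LipschitzWith.prod_snd
    have h11 := LipschitzWith.prod_fst.comp h1
    have h12 := LipschitzWith.prod_snd.comp h1
    have h21 := LipschitzWith.prod_fst.comp h2
    have h22 := LipschitzWith.prod_snd.comp h2
    fin_cases i
    · exact ⟨_, ((hL.add h11).prodMk h12).prodMk h2⟩
    · exact ⟨_, (h11.prodMk (hL.add h12)).prodMk h2⟩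
    · exact ⟨_, h1.prodMk ((hL.add h21).prodMk h22)⟩
    · exact ⟨_, h1.prodMk (h21.prodMk (hL.add h22))⟩
  · have hc : ∀ s : (ℕ × ℕ) × (ℕ × ℕ) → ℕ, Computable s →
        IsComputableFamily fun i : ℕ × ((ℕ × ℕ) × (ℕ × ℕ)) => (s i.2 : ℝ) / 2 ^ i.1 := by
      intro s hs
      refine (IsComputableFamily.ratio (d := fun i : ℕ × ((ℕ × ℕ) × (ℕ × ℕ)) => 2 ^ i.1)
        (hs.comp Computable.snd)
        ((primrec_nat_pow.comp (Primrec.const 2) Primrec.fst).to_comp)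
        fun i => by positivity).congr fun i => ?_
      push_cast
      rfl
    have hΓN := (hΓ.computable.add (IsComputableFamily.const (N : ℚ))).congr
      (w := fun i => Γ (toTorus4 (dyadic i.1 i.2)) + N) fun i => by push_cast; rfl
    have hix : Computable fun x : ℕ × ℕ × ((ℕ × ℕ) × (ℕ × ℕ)) => ((x.1, x.2.2), x.2.1) :=
      (Computable.fst.pair (Computable.snd.comp Computable.snd)).pair
        (Computable.fst.comp Computable.snd)
    have s1 : Computable fun a : (ℕ × ℕ) × (ℕ × ℕ) => a.1.1 :=
      Computable.fst.comp Computable.fst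
    have s2 : Computable fun a : (ℕ × ℕ) × (ℕ × ℕ) => a.1.2 :=
      Computable.snd.comp Computable.fst
    have s3 : Computable fun a : (ℕ × ℕ) × (ℕ × ℕ) => a.2.1 :=
      Computable.fst.comp Computable.snd
    have s4 : Computable fun a : (ℕ × ℕ) × (ℕ × ℕ) => a.2.2 :=
      Computable.snd.comp Computable.snd
    have key : ∀ s : (ℕ × ℕ) × (ℕ × ℕ) → ℕ, Computable s → ∀ j : Bool,
        ∃ g : (ℕ × ((ℕ × ℕ) × (ℕ × ℕ))) × ℕ → ℕ, Computable g ∧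
        ∀ i r, |(if j then Γ (toTorus4 (dyadic i.1 i.2)) + N + (s i.2 : ℝ) / 2 ^ i.1 else
          (s i.2 : ℝ) / 2 ^ i.1) - (g (i, r) : ℝ) / 2 ^ r| ≤ (1 / 2) ^ r := by
      intro s hs j
      cases j
      · exact (hc s hs).exists_nat_approx fun i => by positivity
      · exact (hΓN.add (hc s hs)).exists_nat_approx fun i => add_nonneg (hpos _) (by positivity)
    obtain ⟨g1, hg1, h1⟩ := key _ s1 (i == 0)
    obtain ⟨g2, hg2, h2⟩ := key _ s2 (i == 1)
    obtain ⟨g3, hg3, h3⟩ := key _ s3 (i == 2)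
    obtain ⟨g4, hg4, h4⟩ := key _ s4 (i == 3)
    refine ⟨fun x => ((g1 ((x.1, x.2.2), x.2.1), g2 ((x.1, x.2.2), x.2.1)),
      (g3 ((x.1, x.2.2), x.2.1), g4 ((x.1, x.2.2), x.2.1))),
      ((hg1.comp hix).pair (hg2.comp hix)).pair ((hg3.comp hix).pair (hg4.comp hix)), 1,
      fun p r a => ?_⟩
    have h := max_le (max_le (h1 (p, a) r) (h2 (p, a) r)) (max_le (h3 (p, a) r) (h4 (p, a) r))
    rw [one_mul]
    fin_cases i <;> exact h

end HasComputableLift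

/-- The shear that adds to the `i`-th coordinate a function of the other coordinates. -/
noncomputable def shear (i : Fin 4) (Γ : Torus4 → ℝ) (hΓ : ContMDiff torus4Model 𝓘(ℝ, ℝ) ∞ Γ)
    (hi : ∀ w z, Γ (mulAt i w z) = Γ z) :
    Diffeomorph torus4Model torus4Model Torus4 Torus4 ∞ where
  toFun z := mulAt i (circlePt (Γ z)) z
  invFun z := mulAt i (circlePt (-Γ z)) z
  left_inv z := by
    simp only [hi, mulAt_mulAt, ← circlePt_add, neg_add_cancel, circlePt_zero, mulAt_one]
  right_inv z := by
    simp only [hi, mulAt_mulAt, ← circlePt_add, add_neg_cancel, circlePt_zero, mulAt_one]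
  contMDiff_toFun := contMDiff_mulAt i (contMDiff_circlePt.comp hΓ)
  contMDiff_invFun := contMDiff_mulAt i
    (contMDiff_circlePt.comp (contDiff_neg.contMDiff.comp hΓ))

/-- Diffeomorphisms of the torus with a computable Lipschitz lift. -/
def IsComputableDiffeo (F : Torus4 → Torus4) : Prop :=
  HasComputableLift F ∧ ∃ Φ : Diffeomorph torus4Model torus4Model Torus4 Torus4 ∞, ⇑Φ = F

theorem IsComputableDiffeo.comp {F G : Torus4 → Torus4} (hG : IsComputableDiffeo G)
    (hF : IsComputableDiffeo F) : IsComputableDiffeo (G ∘ F) := by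
  obtain ⟨h1, Φ, rfl⟩ := hG
  obtain ⟨h2, Ψ, rfl⟩ := hF
  exact ⟨h1.comp h2, Ψ.trans Φ, rfl⟩

theorem isComputableDiffeo_shear (i : Fin 4) {Γ : Torus4 → ℝ} (hΓ : IsTame Γ)
    (hi : ∀ w z, Γ (mulAt i w z) = Γ z) :
    IsComputableDiffeo fun z => mulAt i (circlePt (Γ z)) z :=
  ⟨HasComputableLift.shear i hΓ, shear i Γ hΓ.smooth hi, rfl⟩

/-! ### Prefix rewriting as a diffeomorphism of the torus -/

/-- The `j`-th coordinate of a point of the torus. -/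
def coordAt (j : Fin 4) (z : Torus4) : Circle :=
  match j with
  | 0 => z.1.1
  | 1 => z.1.2
  | 2 => z.2.1
  | 3 => z.2.2

theorem coordAt_mulAt (i j : Fin 4) (w : Circle) (z : Torus4) :
    coordAt j (mulAt i w z) = if j = i then w * coordAt j z else coordAt j z := by
  fin_cases i <;> fin_cases j <;> rfl

theorem coordAt_mulAt_self (i : Fin 4) (w : Circle) (z : Torus4) :
    coordAt i (mulAt i w z) = w * coordAt i z := by simp [coordAt_mulAt]

theorem coordAt_mulAt_of_ne {i j : Fin 4} (h : j ≠ i) (w : Circle) (z : Torus4) :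
    coordAt j (mulAt i w z) = coordAt j z := by simp [coordAt_mulAt, h]

theorem mulAt_comm {i j : Fin 4} (h : i ≠ j) (w w' : Circle) (z : Torus4) :
    mulAt i w (mulAt j w' z) = mulAt j w' (mulAt i w z) := by
  fin_cases i <;> fin_cases j <;> first | rfl | exact absurd rfl h

theorem IsTame.coord {G : Circle → ℝ} (hG : IsTameOnCircle G) (j : Fin 4) :
    IsTame fun z => G (coordAt j z) := by
  fin_cases j
  · exact IsTame.coord0 hG
  · exact IsTame.coord1 hG
  · exact IsTame.coord2 hG
  · exact IsTame.coord3 hG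

/-- A computable diffeomorphism that applies to the `i`-th coordinate an affine map selected by
functions of the remaining coordinates; the coordinate number `1`, which is `0` before and after,
serves as work space. -/
theorem exists_selected_affine {σ : Type*} [Fintype σ] [DecidableEq σ] {i : Fin 4} (hi : i ≠ 1)
    {S : σ → Torus4 → ℝ} (hS : ∀ s, IsTame (S s)) (hSi : ∀ s w z, S s (mulAt i w z) = S s z)
    (hS1 : ∀ s w z, S s (mulAt 1 w z) = S s z) (lam c : σ → ℚ) (hlam : ∀ s, lam s ≠ 0) :
    ∃ F, IsComputableDiffeo F ∧ ∀ z s₀ x, (∀ s, S s z = if s = s₀ then 1 else 0) →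
      coordAt 1 z = 1 → coordAt i z = circlePt x → 0 ≤ x → x ≤ 1 / 4 → 0 ≤ lam s₀ * x + c s₀ →
      lam s₀ * x + c s₀ ≤ 1 / 4 → F z = mulAt i (circlePt (lam s₀ * x + c s₀ - x)) z := by
  have hφ : ∀ j, IsTame fun z => coordFun (coordAt j z) :=
    IsTame.coord isTameOnCircle_coordFun
  -- Let `y = lam * x + c`. The first shear copies `x` to the work coordinate, the second adds `(lam
  -- - 1) * x + c` computed from this copy, and the third adds `(c - y) / lam = -x`, computed from
  -- `y`, which clears the work coordinate again.
  set Γ₂ : Torus4 → ℝ := fun z => ∑ s, S s z * (((lam s - 1 : ℚ) : ℝ) * coordFun (coordAt 1 z) +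
    ((c s : ℚ) : ℝ)) with hΓ₂
  set Γ₃ : Torus4 → ℝ := fun z => ∑ s, S s z * ((((lam s)⁻¹ : ℚ) : ℝ) * (((c s : ℚ) : ℝ) +
    -coordFun (coordAt i z))) with hΓ₃
  have hT₂ : IsTame Γ₂ := IsTame.sum _ fun s _ =>
    (hS s).mul (((IsTame.const _).mul (hφ 1)).add (IsTame.const _))
  have hT₃ : IsTame Γ₃ := IsTame.sum _ fun s _ =>
    (hS s).mul ((IsTame.const _).mul ((IsTame.const _).add (hφ i).neg))
  have h1 := isComputableDiffeo_shear 1 (hφ i) fun w z => by rw [coordAt_mulAt_of_ne hi]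
  have h2 := isComputableDiffeo_shear i hT₂ fun w z => by
    simp only [hΓ₂, hSi, coordAt_mulAt_of_ne hi.symm]
  have h3 := isComputableDiffeo_shear 1 hT₃ fun w z => by
    simp only [hΓ₃, hS1, coordAt_mulAt_of_ne hi]
  refine ⟨_, h3.comp (h2.comp h1), fun z s₀ x hsel hz1 hzi hx0 hx1 hy0 hy1 => ?_⟩
  have hl : ((lam s₀ : ℚ) : ℝ) ≠ 0 := by exact_mod_cast hlam s₀
  have e2 : ∀ w, Γ₂ (mulAt 1 w z) = (lam s₀ - 1) * coordFun (w * coordAt 1 z) + c s₀ := by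
    intro w
    simp only [hΓ₂, hS1, hsel, coordAt_mulAt_self, ite_mul, one_mul, zero_mul,
      Finset.sum_ite_eq', Finset.mem_univ, if_true]
    push_cast
    rfl
  have e3 : ∀ w w', Γ₃ (mulAt i w (mulAt 1 w' z)) =
      (lam s₀ : ℝ)⁻¹ * (c s₀ + -coordFun (w * coordAt i z)) := by
    intro w w'
    simp only [hΓ₃, hSi, hS1, hsel, coordAt_mulAt_self, ite_mul, one_mul, zero_mul,
      Finset.sum_ite_eq', Finset.mem_univ, if_true, coordAt_mulAt_of_ne hi]
    push_cast
    rfl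
  simp only [Function.comp_apply]
  rw [e2, hz1, mul_one, hzi, coordFun_circlePt hx0 hx1, coordFun_circlePt hx0 hx1, e3, hzi,
    ← circlePt_add, show ((lam s₀ : ℝ) - 1) * x + c s₀ + x = lam s₀ * x + c s₀ by ring,
    coordFun_circlePt hy0 hy1, mulAt_comm hi, mulAt_mulAt, ← circlePt_add]
  have : (lam s₀ : ℝ)⁻¹ * (c s₀ + -(lam s₀ * x + c s₀)) + x = 0 := by
    field_simp
    ring
  rw [this, circlePt_zero, mulAt_comm hi.symm, mulAt_one]
  congr 2
  ring

/-- The real number `∑ dg (X n) b ^ (-n - 1)` with the digits `dg (X n)`. -/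
noncomputable def streamVal {B : Type*} (k : ℕ) (dg : B → ℕ) (X : Stream' B) : ℝ :=
  ∑' n : ℕ, (dg (X.get n) : ℝ) / (10 * (k : ℝ)) ^ (n + 1)

/-! ### Digit expansions of streams and replacement of prefixes -/

section streamVal

variable {B : Type*} {k : ℕ} {dg : B → ℕ}

theorem summable_streamVal (hk : 1 ≤ k) (hdg : ∀ a, dg a ≤ k) (X : Stream' B) :
    Summable fun n : ℕ => (dg (X.get n) : ℝ) / (10 * (k : ℝ)) ^ (n + 1) := by
  have hk' : (1 : ℝ) ≤ k := by exact_mod_cast hk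
  have hs : Summable fun n : ℕ => (k : ℝ) * ((1 / (10 * (k : ℝ))) ^ (n + 1)) := by
    refine Summable.mul_left _ ((summable_nat_add_iff 1).2 (summable_geometric_of_lt_one
      (by positivity) ?_))
    rw [div_lt_one (by positivity)]
    linarith
  refine Summable.of_nonneg_of_le (fun n => by positivity) (fun n => ?_) hs
  rw [one_div_pow, ← div_eq_mul_one_div]
  have : (dg (X.get n) : ℝ) ≤ k := by exact_mod_cast hdg _
  gcongr

theorem streamVal_nonneg (X : Stream' B) : 0 ≤ streamVal k dg X :=
  tsum_nonneg fun n => by positivity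

theorem streamVal_eq (hk : 1 ≤ k) (hdg : ∀ a, dg a ≤ k) (X : Stream' B) :
    streamVal k dg X = (dg X.head + streamVal k dg X.tail) / (10 * k) := by
  have hk' : (1 : ℝ) ≤ k := by exact_mod_cast hk
  rw [streamVal, (summable_streamVal hk hdg X).tsum_eq_zero_add, add_div, zero_add, pow_one,
    streamVal, ← tsum_div_const]
  congr 2
  funext n
  rw [Stream'.get_tail, div_div, ← pow_succ]

/-- Each digit is at most one tenth of the base. So the remainder behind any digit lies in `[0,
1/9]`, which provides the gaps needed by the bumps. -/
theorem streamVal_le (hk : 1 ≤ k) (hdg : ∀ a, dg a ≤ k) (X : Stream' B) :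
    streamVal k dg X ≤ 1 / 9 := by
  have hk' : (1 : ℝ) ≤ k := by exact_mod_cast hk
  have hs : HasSum (fun n : ℕ => (1 : ℝ) / 10 * (1 / 10) ^ n) (1 / 10 * (1 - 1 / 10)⁻¹) :=
    (hasSum_geometric_of_lt_one (by norm_num) (by norm_num)).mul_left _
  have : (1 : ℝ) / 10 * (1 - 1 / 10)⁻¹ = 1 / 9 := by norm_num
  rw [← this, ← hs.tsum_eq]
  refine (summable_streamVal hk hdg X).tsum_le_tsum (fun n => ?_) hs.summable
  have h1 : (dg (X.get n) : ℝ) ≤ k := by exact_mod_cast hdg _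
  have h2 : (1 : ℝ) ≤ (k : ℝ) ^ n := one_le_pow₀ hk'
  rw [div_le_iff₀ (by positivity), mul_pow, pow_succ (10 : ℝ), pow_succ (k : ℝ)]
  have h3 : (1 : ℝ) / 10 * (1 / 10) ^ n * (10 ^ n * 10 * (k ^ n * k)) =
      ((1 / 10) ^ n * 10 ^ n) * (k ^ n * k) := by ring
  rw [h3, ← mul_pow]
  norm_num
  nlinarith

/-- The value of a finite digit string. -/
def listVal (k : ℕ) (dg : B → ℕ) : List B → ℚ
  | [] => 0
  | a :: l => (dg a + listVal k dg l) / (10 * k)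

theorem streamVal_append (hk : 1 ≤ k) (hdg : ∀ a, dg a ≤ k) (l : List B) (X : Stream' B) :
    streamVal k dg (l ++ₛ X) = listVal k dg l + streamVal k dg X / (10 * k) ^ l.length := by
  have hk' : (1 : ℝ) ≤ k := by exact_mod_cast hk
  induction l with
  | nil => simp [listVal]
  | cons a l ih =>
    rw [Stream'.cons_append_stream, streamVal_eq hk hdg, Stream'.head_cons, Stream'.tail_cons, ih,
      listVal]
    push_cast
    rw [List.length_cons, pow_succ]
    field_simp
    ring

/-- The slope of the affine map that replaces the prefix `l` by the prefix `l'`. -/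
def prefixSlope (k : ℕ) (l l' : List B) : ℚ := (10 * k) ^ l.length / (10 * k) ^ l'.length

def prefixShift (k : ℕ) (dg : B → ℕ) (l l' : List B) : ℚ :=
  listVal k dg l' - prefixSlope k l l' * listVal k dg l

/-- Both values are affine in the value of the common tail `X`; eliminating it gives an affine map
independent of `X`. -/
theorem streamVal_replace (hk : 1 ≤ k) (hdg : ∀ a, dg a ≤ k) (l l' : List B) (X : Stream' B) :
    streamVal k dg (l' ++ₛ X) =
      prefixSlope k l l' * streamVal k dg (l ++ₛ X) + prefixShift k dg l l' := by
  have hk' : (1 : ℝ) ≤ k := by exact_mod_cast hk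
  rw [streamVal_append hk hdg, streamVal_append hk hdg, prefixShift, prefixSlope]
  push_cast
  field_simp
  ring

end streamVal

/-- The rewriting step on pairs of streams that replaces the first two letters of the left stream
and the first letter of the right stream according to the rule `G`. -/
def rewriteStep {B : Type*} (G : B → B → B → List B × List B) (c : Stream' B × Stream' B) :
    Stream' B × Stream' B :=
  ((G c.1.head c.1.tail.head c.2.head).1 ++ₛ c.1.tail.tail,
    (G c.1.head c.1.tail.head c.2.head).2 ++ₛ c.2.tail)

/-- The window is copied into the history before either stream is touched, so an arbitrary rule `G`
becomes reversible. The existential `t'` hides the growing history, of which only the bound `1/8` is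
needed to iterate. -/
theorem exists_diffeo_rewriteStep {B : Type*} [Fintype B] [DecidableEq B] {k : ℕ} (hk : 1 ≤ k)
    {dg : B → ℕ} (hinj : Function.Injective dg) (hdg : ∀ a, dg a ≤ k)
    (G : B → B → B → List B × List B) :
    ∃ F, IsComputableDiffeo F ∧ ∀ (t : ℝ) (c : Stream' B × Stream' B), 0 ≤ t → t ≤ 1 / 8 →
      ∃ t' : ℝ, 0 ≤ t' ∧ t' ≤ 1 / 8 ∧
        F ((circlePt t, 1), (circlePt (streamVal k dg c.2), circlePt (streamVal k dg c.1))) =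
          ((circlePt t', 1), (circlePt (streamVal k dg (rewriteStep G c).2),
            circlePt (streamVal k dg (rewriteStep G c).1))) := by
  have hk' : (1 : ℝ) ≤ k := by exact_mod_cast hk
  set num : B × B × B ≃ Fin (Fintype.card (B × B × B)) := Fintype.equivFin _ with hnum
  set n := Fintype.card (B × B × B) with hn
  -- This base leaves room for `n` digits below `1/8`: with `t ≤ 1/8` and `j < n` also `(j + t) / β
  -- ≤ 1/8`.
  set β : ℕ := 8 * n + 8 with hβ
  have hβ' : (β : ℝ) = 8 * n + 8 := by rw [hβ]; push_cast; ring
  have hβ0 : (0 : ℝ) < β := by rw [hβ']; positivity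
  have hnumβ : ∀ s, 4 * (num s : ℕ) + 3 ≤ 2 * β := fun s => by
    have := (num s).isLt
    omega
  have hb1 : ∀ a, 4 * dg a + 3 ≤ 2 * (10 * k) := fun a => by have := hdg a; omega
  -- The first two letters of the left stream are detected together, as one digit in base `(10k)²`.
  have hb2 : ∀ a a', 4 * (dg a * (10 * k) + dg a') + 3 ≤ 2 * ((10 * k) * (10 * k)) := fun a a' => by
    have h1 := hdg a
    have h2 := hdg a'
    have h3 : dg a * (10 * k) ≤ k * (10 * k) := Nat.mul_le_mul_right _ h1
    nlinarith
  -- scaling of the history coordinate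
  obtain ⟨F₁, hF₁, h₁⟩ := exists_selected_affine (σ := Unit) (i := 0) (by decide)
    (S := fun _ _ => ((1 : ℚ) : ℝ)) (fun _ => IsTame.const 1) (fun _ _ _ => rfl)
    (fun _ _ _ => rfl) (fun _ => (β : ℚ)⁻¹) (fun _ => 0) fun _ => by
      have : (β : ℚ) ≠ 0 := by exact_mod_cast hβ0.ne'
      exact inv_ne_zero this
  -- recording of the window in the history coordinate
  set D : Torus4 → ℝ := fun z => ∑ s : B × B × B, (((num s : ℕ) / β : ℚ) : ℝ) *
    (digitBump ((10 * k) * (10 * k)) (dg s.1 * (10 * k) + dg s.2.1) (coordAt 3 z) *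
      digitBump (10 * k) (dg s.2.2) (coordAt 2 z)) with hD
  have hDT : IsTame D := IsTame.sum _ fun s _ => (IsTame.const _).mul
    ((IsTame.coord (isTameOnCircle_digitBump (hb2 _ _)) 3).mul
      (IsTame.coord (isTameOnCircle_digitBump (hb1 _)) 2))
  have hF₂ := isComputableDiffeo_shear 0 hDT fun w z => by
    simp only [hD, coordAt_mulAt_of_ne (show (3 : Fin 4) ≠ 0 by decide),
      coordAt_mulAt_of_ne (show (2 : Fin 4) ≠ 0 by decide)]
  -- rewriting of the two stream coordinates
  set S : B × B × B → Torus4 → ℝ := fun s z => digitBump β (num s) (coordAt 0 z) with hS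
  have hST : ∀ s, IsTame (S s) := fun s => IsTame.coord (isTameOnCircle_digitBump (hnumβ s)) 0
  have hSi : ∀ i : Fin 4, i ≠ 0 → ∀ s w z, S s (mulAt i w z) = S s z := fun i hi s w z => by
    simp only [hS, coordAt_mulAt_of_ne hi.symm]
  have hslope : ∀ l l' : List B, prefixSlope k l l' ≠ 0 := fun l l' => by
    have : (k : ℚ) ≠ 0 := by exact_mod_cast (by omega : k ≠ 0)
    unfold prefixSlope
    positivity
  obtain ⟨F₃, hF₃, h₃⟩ := exists_selected_affine (i := 2) (by decide) hST
    (hSi 2 (by decide)) (hSi 1 (by decide))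
    (fun s => prefixSlope k [s.2.2] (G s.1 s.2.1 s.2.2).2)
    (fun s => prefixShift k dg [s.2.2] (G s.1 s.2.1 s.2.2).2) fun s => hslope _ _
  obtain ⟨F₄, hF₄, h₄⟩ := exists_selected_affine (i := 3) (by decide) hST
    (hSi 3 (by decide)) (hSi 1 (by decide))
    (fun s => prefixSlope k [s.1, s.2.1] (G s.1 s.2.1 s.2.2).1)
    (fun s => prefixShift k dg [s.1, s.2.1] (G s.1 s.2.1 s.2.2).1) fun s => hslope _ _
  refine ⟨_, hF₄.comp (hF₃.comp (hF₂.comp hF₁)), fun t c ht0 ht1 => ?_⟩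
  obtain ⟨X, Y⟩ := c
  dsimp only
  set s₀ : B × B × B := (X.head, X.tail.head, Y.head) with hs₀
  have hX : X = [X.head, X.tail.head] ++ₛ X.tail.tail := by
    rw [Stream'.cons_append_stream, Stream'.append_eq_cons, Stream'.eta, Stream'.eta]
  have hY : Y = [Y.head] ++ₛ Y.tail := by rw [Stream'.append_eq_cons, Stream'.eta]
  have hv0 : ∀ Z : Stream' B, 0 ≤ streamVal k dg Z := streamVal_nonneg
  have hv1 : ∀ Z : Stream' B, streamVal k dg Z ≤ 1 / 4 := fun Z =>
    (streamVal_le hk hdg Z).trans (by norm_num)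
  have hnlt : ((num s₀ : ℕ) : ℝ) + 1 ≤ n := by exact_mod_cast (num s₀).isLt
  have ht' : ((num s₀ : ℕ) + t) / (β : ℝ) ≤ 1 / 8 := by
    rw [div_le_iff₀ hβ0, hβ']; linarith
  have ht'0 : 0 ≤ ((num s₀ : ℕ) + t) / (β : ℝ) := by positivity
  refine ⟨((num s₀ : ℕ) + t) / (β : ℝ), ht'0, ht', ?_⟩
  simp only [Function.comp_apply]
  have htβ : t / β ≤ 1 / 4 := by
    rw [div_le_iff₀ hβ0, hβ']
    have : (0 : ℝ) ≤ n := Nat.cast_nonneg n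
    linarith
  have r₁ := h₁ ((circlePt t, 1), (circlePt (streamVal k dg Y), circlePt (streamVal k dg X))) () t
    (fun _ => by simp) rfl rfl ht0 (by linarith)
    (by push_cast; rw [add_zero]; positivity)
    (by push_cast; rw [add_zero, inv_mul_eq_div]; exact htβ)
  have r₁' : F₁ ((circlePt t, 1), (circlePt (streamVal k dg Y), circlePt (streamVal k dg X))) =
      ((circlePt (t / β), 1), (circlePt (streamVal k dg Y), circlePt (streamVal k dg X))) := by
    rw [r₁]
    simp only [mulAt, ← circlePt_add]
    congr 3
    push_cast
    ring
  have hX2 : streamVal k dg X = (((dg X.head * (10 * k) + dg X.tail.head : ℕ) : ℝ) +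
      streamVal k dg X.tail.tail) / ((10 * k) * (10 * k) : ℕ) := by
    rw [streamVal_eq hk hdg, streamVal_eq hk hdg X.tail]
    push_cast
    field_simp
    ring
  have hY2 : streamVal k dg Y = ((dg Y.head : ℝ) + streamVal k dg Y.tail) / (10 * k : ℕ) := by
    rw [streamVal_eq hk hdg]
    push_cast
    rfl
  have hD2 : D ((circlePt (t / β), 1), (circlePt (streamVal k dg Y),
      circlePt (streamVal k dg X))) = (num s₀ : ℕ) / (β : ℝ) := by
    simp only [hD, coordAt]
    rw [Finset.sum_eq_single s₀]
    · rw [hX2, hY2, digitBump_circlePt (hb2 _ _) (hb2 _ _) (hv0 _) (hv1 _),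
        digitBump_circlePt (hb1 _) (hb1 _) (hv0 _) (hv1 _), if_pos rfl, if_pos rfl]
      push_cast
      ring
    · rintro ⟨a, a', r⟩ - hne
      rw [hX2, hY2, digitBump_circlePt (hb2 _ _) (hb2 _ _) (hv0 _) (hv1 _),
        digitBump_circlePt (hb1 _) (hb1 _) (hv0 _) (hv1 _)]
      dsimp only
      split_ifs with e1 e2
      · exfalso
        apply hne
        have hlt : ∀ a, dg a < 10 * k := fun a => by have := hdg a; omega
        -- Division by `10k` recovers the first letter from the two-letter digit; the second one
        -- follows by cancellation.
        have e3 : dg X.head = dg a := by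
          have := congrArg (· / (10 * k)) e1
          simpa [Nat.add_div_of_dvd_right, Nat.mul_div_cancel, Nat.div_eq_of_lt (hlt _),
            (by omega : 0 < k), (by omega : k ≠ 0)] using this
        rw [e3] at e1
        rw [hs₀, hinj e3, hinj (Nat.add_left_cancel e1), hinj e2]
      all_goals simp
    · intro h
      exact absurd (Finset.mem_univ _) h
  have r₂ : mulAt 0 (circlePt (D ((circlePt (t / β), 1), (circlePt (streamVal k dg Y),
      circlePt (streamVal k dg X))))) ((circlePt (t / β), 1), (circlePt (streamVal k dg Y),
      circlePt (streamVal k dg X))) = ((circlePt (((num s₀ : ℕ) + t) / (β : ℝ)), 1),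
        (circlePt (streamVal k dg Y), circlePt (streamVal k dg X))) := by
    rw [hD2]
    simp only [mulAt, ← circlePt_add, ← add_div]
  -- The leading digit of the history is now `num s₀`. The selectors see only the history, so they
  -- remain valid while the streams `y` are being changed.
  have hsel : ∀ y, ∀ s, S s ((circlePt (((num s₀ : ℕ) + t) / (β : ℝ)), 1), y) =
      if s = s₀ then 1 else 0 := fun y s => by
    simp only [hS, coordAt]
    rw [digitBump_circlePt (hnumβ _) (hnumβ _) ht0 (by linarith)]
    congr 1
    rw [Fin.val_inj, num.apply_eq_iff_eq]
    exact propext eq_comm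
  have q₃ := streamVal_replace hk hdg [Y.head] (G X.head X.tail.head Y.head).2 Y.tail
  have q₄ := streamVal_replace hk hdg [X.head, X.tail.head] (G X.head X.tail.head Y.head).1
    X.tail.tail
  rw [← hY] at q₃
  rw [← hX] at q₄
  have r₃ := h₃ ((circlePt (((num s₀ : ℕ) + t) / (β : ℝ)), 1), (circlePt (streamVal k dg Y),
    circlePt (streamVal k dg X))) s₀ (streamVal k dg Y) (hsel _) rfl rfl (hv0 _) (hv1 _)
    (by rw [hs₀]; dsimp only; rw [← q₃]; exact hv0 _)
    (by rw [hs₀]; dsimp only; rw [← q₃]; exact hv1 _)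
  have r₄ := h₄ ((circlePt (((num s₀ : ℕ) + t) / (β : ℝ)), 1),
    (circlePt (streamVal k dg ((G X.head X.tail.head Y.head).2 ++ₛ Y.tail)),
    circlePt (streamVal k dg X))) s₀ (streamVal k dg X) (hsel _) rfl rfl (hv0 _) (hv1 _)
    (by rw [hs₀]; dsimp only; rw [← q₄]; exact hv0 _)
    (by rw [hs₀]; dsimp only; rw [← q₄]; exact hv1 _)
  rw [r₁', r₂, r₃]
  simp only [hs₀] at r₄ ⊢
  rw [← q₃]
  simp only [mulAt, ← circlePt_add, sub_add_cancel]
  rw [r₄, ← q₄]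
  simp only [mulAt, ← circlePt_add, sub_add_cancel, rewriteStep]

/-! ### A universal prefix rewriting machine -/

inductive Act
  | jump | right | stay | left | halt
  deriving DecidableEq

instance : Fintype Act := ⟨{.jump, .right, .stay, .left, .halt}, fun a => by cases a <;> simp⟩

/-- The letters of the words that encode the symbols of a Turing machine. -/
inductive Cell
  | delim | row (active : Bool) | comma | tick | act (a : Act)
  deriving DecidableEq, Fintype

inductive Phase
  | find | skip | read | next | back (a : Act) | home (a : Act)
  deriving DecidableEq, Fintype

/-- Letters of the tape: cells, the tally mark of the counter, and the states of the machine. -/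
inductive Letter
  | cell (c : Cell) | one | start | halt | run (p : Phase) | holdL (p : Phase) (c : Cell)
  | holdR (p : Phase) (c : Cell) | ret (p : Phase)
  deriving DecidableEq, Fintype

open Letter

/-- `find` moves right to the active row. `skip` uses up one tally mark per comma, and a comma met
with empty counter starts `read`, which turns ticks into marks until an action appears. `back`
returns to the row marker and flips it; `home` returns to the delimiter and performs the action;
`next` moves right to the next delimiter. The action `halt` omits `back`, which leaves the table
intact. -/
def runRule (p : Phase) (x y : Letter) : List Letter × List Letter :=
  match p with
  | .find => match y with
    | cell (.row true) => ([holdL .skip (.row true), x], [])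
    | cell c => ([holdL .find c, x], [])
    | _ => ([run p, x], [y])
  | .skip => match y with
    | cell .comma => if x = one then ([holdL .skip .comma], []) else ([holdL .read .comma, x], [])
    | cell c => ([holdL .skip c, x], [])
    | _ => ([run p, x], [y])
  | .read => match y with
    | cell .tick => ([holdL .read .tick, x], [one])
    | cell (.act a) => ([run (if a = .halt then .home .halt else .back a), x], [y])
    | _ => ([run p, x], [y])
  | .next => match y with
    | cell .delim => ([holdL .find .delim, x], [])
    | cell c => ([holdL .next c, x], [])
    | _ => ([run p, x], [y])
  | .back a => match x with
    | one => ([run p], [x, y])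
    | cell (.row b) => ([holdR (.home a) (.row !b)], [y])
    | cell c => ([holdR (.back a) c], [y])
    | _ => ([run p, x], [y])
  | .home a => match x with
    | one => ([run p], [x, y])
    | cell .delim => match a with
      | .jump => ([ret .skip, x], [y])
      | .right => ([ret .next, x], [y])
      | .stay => ([ret .find, x], [y])
      | .left => ([holdR (.home .stay) .delim], [y])
      | .halt => ([Letter.halt], [y])
    | cell c => ([holdR (.home a) c], [y])
    | _ => ([run p, x], [y])

/-- The rewriting rule of the machine: `q` is the state, `x` the letter to the left of it and `y`
the letter to the right. -/
def rule (q x y : Letter) : List Letter × List Letter :=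
  match q with
  | start => ([run .find, cell .delim, x], [y])
  | holdL p c => if x = one then ([q], [x, y]) else ([ret p, cell c, x], [y])
  | holdR p c => if y = one then ([q, y, x], []) else ([run p, x], [cell c, y])
  | ret p => if y = one then ([q, y, x], []) else ([run p, x], [y])
  | run p => runRule p x y
  | _ => ([q, x], [y])

/-! ### The dynamics of the machine and the transport of its counter -/

abbrev Config := Stream' Letter × Stream' Letter

def machineStep : Config → Config := rewriteStep rule

theorem machineStep_cons (q x y : Letter) (X Y : Stream' Letter) :
    machineStep (Stream'.cons q (Stream'.cons x X), Stream'.cons y Y) =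
      ((rule q x y).1 ++ₛ X, (rule q x y).2 ++ₛ Y) := rfl

/-- Reachability by iterating the machine. -/
def Reach (c c' : Config) : Prop := ∃ n, machineStep^[n] c = c'

theorem Reach.refl (c : Config) : Reach c c := ⟨0, rfl⟩

theorem Reach.trans {c c' c'' : Config} (h : Reach c c') (h' : Reach c' c'') : Reach c c'' := by
  obtain ⟨n, rfl⟩ := h
  obtain ⟨m, rfl⟩ := h'
  exact ⟨m + n, Function.iterate_add_apply _ _ _ _⟩

theorem Reach.head {c c' : Config} (h : Reach (machineStep c) c') : Reach c c' := by
  obtain ⟨n, rfl⟩ := h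
  exact ⟨n + 1, rfl⟩

/-- A stream of letters with `n` tally marks in front. -/
def tally (n : ℕ) (X : Stream' Letter) : Stream' Letter := List.replicate n one ++ₛ X

@[simp] theorem tally_zero (X : Stream' Letter) : tally 0 X = X := rfl

theorem tally_succ (n : ℕ) (X : Stream' Letter) : tally (n + 1) X = Stream'.cons one (tally n X) := rfl

theorem tally_cons (n : ℕ) (X : Stream' Letter) :
    tally n (Stream'.cons one X) = Stream'.cons one (tally n X) := by
  induction n with
  | zero => rfl
  | succ n ih => rw [tally_succ, ih, ← tally_succ]

theorem exists_eq_cons {α : Type*} (X : Stream' α) : ∃ a Y, X = Stream'.cons a Y :=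
  ⟨X.head, X.tail, (Stream'.eta X).symm⟩

theorem reach_holdL_tally (p : Phase) (c : Cell) (n : ℕ) (X Y : Stream' Letter) :
    Reach (Stream'.cons (holdL p c) (tally n X), Y) (Stream'.cons (holdL p c) X, tally n Y) := by
  induction n generalizing Y with
  | zero => exact Reach.refl _
  | succ n ih =>
    obtain ⟨y, Y, rfl⟩ := exists_eq_cons Y
    refine Reach.head ?_
    rw [tally_succ, machineStep_cons, tally_succ, ← tally_cons]
    exact ih _

theorem reach_ret_tally (p : Phase) (n : ℕ) (X Y : Stream' Letter) :
    Reach (Stream'.cons (ret p) X, tally n Y) (Stream'.cons (ret p) (tally n X), Y) := by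
  induction n generalizing X with
  | zero => exact Reach.refl _
  | succ n ih =>
    obtain ⟨x, X, rfl⟩ := exists_eq_cons X
    refine Reach.head ?_
    rw [tally_succ, machineStep_cons, tally_succ, ← tally_cons]
    exact ih _

theorem reach_holdR_tally (p : Phase) (c : Cell) (n : ℕ) (X Y : Stream' Letter) :
    Reach (Stream'.cons (holdR p c) X, tally n Y) (Stream'.cons (holdR p c) (tally n X), Y) := by
  induction n generalizing X with
  | zero => exact Reach.refl _
  | succ n ih =>
    obtain ⟨x, X, rfl⟩ := exists_eq_cons X
    refine Reach.head ?_
    rw [tally_succ, machineStep_cons, tally_succ, ← tally_cons]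
    exact ih _

theorem reach_back_tally (a : Act) (n : ℕ) (X Y : Stream' Letter) :
    Reach (Stream'.cons (run (.back a)) (tally n X), Y)
      (Stream'.cons (run (.back a)) X, tally n Y) := by
  induction n generalizing Y with
  | zero => exact Reach.refl _
  | succ n ih =>
    obtain ⟨y, Y, rfl⟩ := exists_eq_cons Y
    refine Reach.head ?_
    rw [tally_succ, machineStep_cons, tally_succ, ← tally_cons]
    exact ih _

theorem reach_home_tally (a : Act) (n : ℕ) (X Y : Stream' Letter) :
    Reach (Stream'.cons (run (.home a)) (tally n X), Y)
      (Stream'.cons (run (.home a)) X, tally n Y) := by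
  induction n generalizing Y with
  | zero => exact Reach.refl _
  | succ n ih =>
    obtain ⟨y, Y, rfl⟩ := exists_eq_cons Y
    refine Reach.head ?_
    rw [tally_succ, machineStep_cons, tally_succ, ← tally_cons]
    exact ih _

/-- The configuration with the head in phase `p`, with counter `n`, between the cells `X` on the
left (read from right to left) and `Y` on the right. -/
def conf (p : Phase) (n : ℕ) (X Y : Stream' Cell) : Config :=
  (Stream'.cons (run p) (tally n (X.map cell)), Y.map cell)

theorem exists_tally_map_eq_cons (n : ℕ) (X : Stream' Cell) :
    ∃ x Z, tally n (X.map cell) = Stream'.cons x Z := exists_eq_cons _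

theorem reach_ret (p : Phase) (n : ℕ) (X Y : Stream' Cell) :
    Reach (Stream'.cons (ret p) (X.map cell), tally n (Y.map cell)) (conf p n X Y) := by
  refine (reach_ret_tally p n _ _).trans (Reach.head ?_)
  obtain ⟨y, Y, rfl⟩ := exists_eq_cons Y
  obtain ⟨x, Z, hx⟩ := exists_tally_map_eq_cons n X
  rw [conf, hx, Stream'.map_cons, machineStep_cons]
  exact Reach.refl _

/-- The cell is kept in the state while the marks pass to the right one at a time; then it is
dropped and `ret` fetches the marks back. Marks already on the right, such as one just created by
`read`, join the counter. -/
theorem reach_holdL (p : Phase) (c : Cell) (n : ℕ) (X Y : Stream' Cell) (m : ℕ) :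
    Reach (Stream'.cons (holdL p c) (tally n (X.map cell)), tally m (Y.map cell))
      (conf p (n + m) (Stream'.cons c X) Y) := by
  refine (reach_holdL_tally p c n _ _).trans (Reach.head ?_)
  have : tally n (tally m (Y.map cell)) = tally (n + m) (Y.map cell) := by
    rw [tally, tally, tally, ← Stream'.append_append_stream, List.replicate_append_replicate]
  rw [this]
  obtain ⟨x, X, rfl⟩ := exists_eq_cons X
  obtain ⟨y, Z, hy⟩ := exists_tally_map_eq_cons (n + m) Y
  rw [hy, Stream'.map_cons, machineStep_cons]
  have h := reach_ret p (n + m) (Stream'.cons c (Stream'.cons x X)) Y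
  rw [hy, Stream'.map_cons, Stream'.map_cons] at h
  exact h

/-- The leftward counterpart of `reach_holdL`: the phases `back` and `home` have pushed the marks to
the right in order to see the cell behind them. -/
theorem reach_holdR (p : Phase) (c : Cell) (n : ℕ) (X Y : Stream' Cell) :
    Reach (Stream'.cons (holdR p c) (X.map cell), tally n (Y.map cell))
      (conf p n X (Stream'.cons c Y)) := by
  refine (reach_holdR_tally p c n _ _).trans (Reach.head ?_)
  obtain ⟨y, Y, rfl⟩ := exists_eq_cons Y
  obtain ⟨x, Z, hx⟩ := exists_tally_map_eq_cons n X
  rw [conf, hx, Stream'.map_cons, machineStep_cons, Stream'.map_cons, Stream'.map_cons]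
  simp only [rule, reduceCtorEq, if_false]
  exact Reach.refl _

/-! ### Moves across a single cell in each phase -/

section PhaseSteps

variable (n : ℕ) (X Y : Stream' Cell)

theorem reach_find {c : Cell} (hc : c ≠ .row true) :
    Reach (conf .find n X (Stream'.cons c Y)) (conf .find n (Stream'.cons c X) Y) := by
  refine Reach.head ?_
  obtain ⟨x, Z, hx⟩ := exists_tally_map_eq_cons n X
  have h := reach_holdL .find c n X Y 0
  rw [hx] at h
  rw [conf, hx, Stream'.map_cons, machineStep_cons]
  rcases c with _ | b | _ | _ | a
  · exact h
  · cases b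
    · exact h
    · exact absurd rfl hc
  all_goals exact h

theorem reach_find_active :
    Reach (conf .find n X (Stream'.cons (.row true) Y))
      (conf .skip n (Stream'.cons (.row true) X) Y) := by
  refine Reach.head ?_
  obtain ⟨x, Z, hx⟩ := exists_tally_map_eq_cons n X
  have h := reach_holdL .skip (.row true) n X Y 0
  rw [hx] at h
  rw [conf, hx, Stream'.map_cons, machineStep_cons]
  exact h

theorem reach_skip {c : Cell} (hc : c ≠ .comma) :
    Reach (conf .skip n X (Stream'.cons c Y)) (conf .skip n (Stream'.cons c X) Y) := by
  refine Reach.head ?_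
  obtain ⟨x, Z, hx⟩ := exists_tally_map_eq_cons n X
  have h := reach_holdL .skip c n X Y 0
  rw [hx] at h
  rw [conf, hx, Stream'.map_cons, machineStep_cons]
  cases c
  case comma => exact absurd rfl hc
  all_goals exact h

theorem reach_skip_comma :
    Reach (conf .skip (n + 1) X (Stream'.cons .comma Y))
      (conf .skip n (Stream'.cons .comma X) Y) := by
  refine Reach.head ?_
  rw [conf, tally_succ, Stream'.map_cons, machineStep_cons]
  exact reach_holdL .skip .comma n X Y 0

theorem reach_skip_zero :
    Reach (conf .skip 0 X (Stream'.cons .comma Y)) (conf .read 0 (Stream'.cons .comma X) Y) := by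
  refine Reach.head ?_
  have h := reach_holdL .read .comma 0 X Y 0
  obtain ⟨x, X, rfl⟩ := exists_eq_cons X
  rw [tally_zero, Stream'.map_cons] at h
  rw [conf, tally_zero, Stream'.map_cons, Stream'.map_cons, machineStep_cons]
  exact h

theorem reach_read_tick :
    Reach (conf .read n X (Stream'.cons .tick Y))
      (conf .read (n + 1) (Stream'.cons .tick X) Y) := by
  refine Reach.head ?_
  obtain ⟨x, Z, hx⟩ := exists_tally_map_eq_cons n X
  have h := reach_holdL .read .tick n X Y 1
  rw [hx] at h
  rw [conf, hx, Stream'.map_cons, machineStep_cons]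
  exact h

theorem reach_read_act {a : Act} (ha : a ≠ .halt) :
    Reach (conf .read n X (Stream'.cons (.act a) Y))
      (conf (.back a) n X (Stream'.cons (.act a) Y)) := by
  refine Reach.head ?_
  obtain ⟨x, Z, hx⟩ := exists_tally_map_eq_cons n X
  rw [conf, conf, hx, Stream'.map_cons, machineStep_cons]
  simp only [rule, runRule, if_neg ha]
  exact Reach.refl _

theorem reach_read_halt :
    Reach (conf .read n X (Stream'.cons (.act .halt) Y))
      (conf (.home .halt) n X (Stream'.cons (.act .halt) Y)) := by
  refine Reach.head ?_
  obtain ⟨x, Z, hx⟩ := exists_tally_map_eq_cons n X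
  rw [conf, conf, hx, Stream'.map_cons, machineStep_cons]
  exact Reach.refl _

theorem reach_next {c : Cell} (hc : c ≠ .delim) :
    Reach (conf .next n X (Stream'.cons c Y)) (conf .next n (Stream'.cons c X) Y) := by
  refine Reach.head ?_
  obtain ⟨x, Z, hx⟩ := exists_tally_map_eq_cons n X
  have h := reach_holdL .next c n X Y 0
  rw [hx] at h
  rw [conf, hx, Stream'.map_cons, machineStep_cons]
  cases c
  case delim => exact absurd rfl hc
  all_goals exact h

theorem reach_next_delim :
    Reach (conf .next n X (Stream'.cons .delim Y)) (conf .find n (Stream'.cons .delim X) Y) := by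
  refine Reach.head ?_
  obtain ⟨x, Z, hx⟩ := exists_tally_map_eq_cons n X
  have h := reach_holdL .find .delim n X Y 0
  rw [hx] at h
  rw [conf, hx, Stream'.map_cons, machineStep_cons]
  exact h

theorem reach_back {a : Act} {c : Cell} (hc : ∀ b, c ≠ .row b) :
    Reach (conf (.back a) n (Stream'.cons c X) Y) (conf (.back a) n X (Stream'.cons c Y)) := by
  refine (reach_back_tally a n _ _).trans (Reach.head ?_)
  obtain ⟨y, Z, hy⟩ := exists_tally_map_eq_cons n Y
  have h := reach_holdR (.back a) c n X Y
  rw [hy] at h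
  rw [hy, Stream'.map_cons, machineStep_cons]
  cases c
  case row b => exact absurd rfl (hc b)
  all_goals exact h

theorem reach_back_row {a : Act} (b : Bool) :
    Reach (conf (.back a) n (Stream'.cons (.row b) X) Y)
      (conf (.home a) n X (Stream'.cons (.row !b) Y)) := by
  refine (reach_back_tally a n _ _).trans (Reach.head ?_)
  obtain ⟨y, Z, hy⟩ := exists_tally_map_eq_cons n Y
  have h := reach_holdR (.home a) (.row !b) n X Y
  rw [hy] at h
  rw [hy, Stream'.map_cons, machineStep_cons]
  exact h

theorem reach_home {a : Act} {c : Cell} (hc : c ≠ .delim) :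
    Reach (conf (.home a) n (Stream'.cons c X) Y) (conf (.home a) n X (Stream'.cons c Y)) := by
  refine (reach_home_tally a n _ _).trans (Reach.head ?_)
  obtain ⟨y, Z, hy⟩ := exists_tally_map_eq_cons n Y
  have h := reach_holdR (.home a) c n X Y
  rw [hy] at h
  rw [hy, Stream'.map_cons, machineStep_cons]
  cases c
  case delim => exact absurd rfl hc
  all_goals exact h

theorem reach_home_jump :
    Reach (conf (.home .jump) n (Stream'.cons .delim X) Y)
      (conf .skip n (Stream'.cons .delim X) Y) := by
  refine (reach_home_tally .jump n _ _).trans (Reach.head ?_)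
  obtain ⟨y, Z, hy⟩ := exists_tally_map_eq_cons n Y
  have h := reach_ret .skip n (Stream'.cons .delim X) Y
  rw [hy, Stream'.map_cons] at h
  rw [hy, Stream'.map_cons, machineStep_cons]
  exact h

theorem reach_home_right :
    Reach (conf (.home .right) n (Stream'.cons .delim X) Y)
      (conf .next n (Stream'.cons .delim X) Y) := by
  refine (reach_home_tally .right n _ _).trans (Reach.head ?_)
  obtain ⟨y, Z, hy⟩ := exists_tally_map_eq_cons n Y
  have h := reach_ret .next n (Stream'.cons .delim X) Y
  rw [hy, Stream'.map_cons] at h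
  rw [hy, Stream'.map_cons, machineStep_cons]
  exact h

theorem reach_home_stay :
    Reach (conf (.home .stay) n (Stream'.cons .delim X) Y)
      (conf .find n (Stream'.cons .delim X) Y) := by
  refine (reach_home_tally .stay n _ _).trans (Reach.head ?_)
  obtain ⟨y, Z, hy⟩ := exists_tally_map_eq_cons n Y
  have h := reach_ret .find n (Stream'.cons .delim X) Y
  rw [hy, Stream'.map_cons] at h
  rw [hy, Stream'.map_cons, machineStep_cons]
  exact h

/-- Once past its own delimiter, the head continues in phase `home` with action `stay` and so
settles at the delimiter of the block on the left. -/
theorem reach_home_left :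
    Reach (conf (.home .left) n (Stream'.cons .delim X) Y)
      (conf (.home .stay) n X (Stream'.cons .delim Y)) := by
  refine (reach_home_tally .left n _ _).trans (Reach.head ?_)
  obtain ⟨y, Z, hy⟩ := exists_tally_map_eq_cons n Y
  have h := reach_holdR (.home .stay) .delim n X Y
  rw [hy] at h
  rw [hy, Stream'.map_cons, machineStep_cons]
  exact h

/-- The letter `halt` takes the place of the delimiter. The counter has to be empty, otherwise marks
would remain on the tape. -/
theorem reach_home_halt :
    Reach (conf (.home .halt) 0 (Stream'.cons .delim X) Y)
      (Stream'.cons Letter.halt (X.map cell), Y.map cell) := by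
  refine Reach.head ?_
  obtain ⟨y, Y, rfl⟩ := exists_eq_cons Y
  rw [conf, tally_zero, Stream'.map_cons, Stream'.map_cons, machineStep_cons]
  exact Reach.refl _

end PhaseSteps

/-! ### Scanning words and looking up table entries -/

theorem reverse_append_cons (w : List Cell) (c : Cell) (X : Stream' Cell) :
    w.reverse ++ₛ Stream'.cons c X = (c :: w).reverse ++ₛ X := by
  rw [List.reverse_cons, Stream'.append_append_stream, Stream'.append_eq_cons]

theorem reach_scan_right {p : Phase} {n : ℕ} {w : List Cell}
    (h : ∀ c ∈ w, ∀ X Y, Reach (conf p n X (Stream'.cons c Y)) (conf p n (Stream'.cons c X) Y))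
    (X Y : Stream' Cell) : Reach (conf p n X (w ++ₛ Y)) (conf p n (w.reverse ++ₛ X) Y) := by
  induction w generalizing X with
  | nil => exact Reach.refl _
  | cons c w ih =>
    rw [← reverse_append_cons]
    exact (h c (by simp) X (w ++ₛ Y)).trans (ih (fun c hc => h c (by simp [hc])) _)

theorem reach_scan_left {p : Phase} {n : ℕ} {w : List Cell}
    (h : ∀ c ∈ w, ∀ X Y, Reach (conf p n (Stream'.cons c X) Y) (conf p n X (Stream'.cons c Y)))
    (X Y : Stream' Cell) : Reach (conf p n (w.reverse ++ₛ X) Y) (conf p n X (w ++ₛ Y)) := by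
  induction w generalizing X with
  | nil => exact Reach.refl _
  | cons c w ih =>
    rw [← reverse_append_cons]
    exact (ih (fun c hc => h c (by simp [hc])) _).trans (h c (by simp) X (w ++ₛ Y))

theorem reach_skip_list (w : List Cell) (n : ℕ) (X Y : Stream' Cell) :
    Reach (conf .skip (w.count .comma + n) X (w ++ₛ Y)) (conf .skip n (w.reverse ++ₛ X) Y) := by
  induction w generalizing X with
  | nil => rw [List.count_nil, zero_add]; exact Reach.refl _
  | cons c w ih =>
    rw [← reverse_append_cons, Stream'.cons_append_stream]
    by_cases hc : c = .comma
    · subst hc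
      rw [List.count_cons_self, add_right_comm]
      exact (reach_skip_comma _ _ _).trans (ih _)
    · rw [List.count_cons_of_ne hc]
      exact (reach_skip _ _ _ hc).trans (ih _)

theorem reach_read_ticks (m n : ℕ) (X Y : Stream' Cell) :
    Reach (conf .read n X (List.replicate m .tick ++ₛ Y))
      (conf .read (n + m) ((List.replicate m .tick).reverse ++ₛ X) Y) := by
  induction m generalizing n X with
  | zero => exact Reach.refl _
  | succ m ih =>
    rw [List.replicate_succ, ← reverse_append_cons, Stream'.cons_append_stream, ← add_assoc,
      add_right_comm]
    exact (reach_read_tick _ _ _).trans (ih _ _)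

/-- A word `R` of inactive rows, then a row whose entries `E` precede the entry `(m, a)`. -/
def tableWord (R E Z : List Cell) (b : Bool) (m : ℕ) (a : Act) : List Cell :=
  R ++ .row b :: (E ++ .comma :: (List.replicate m .tick ++ .act a :: Z))

section TableWord

variable {R E Z : List Cell} {m : ℕ} {a : Act}

theorem tableWord_append (R E Z : List Cell) (b : Bool) (m : ℕ) (a : Act) (Y : Stream' Cell) :
    tableWord R E Z b m a ++ₛ Y = R ++ₛ Stream'.cons (.row b) (E ++ₛ Stream'.cons .comma
      (List.replicate m .tick ++ₛ Stream'.cons (.act a) (Z ++ₛ Y))) := by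
  simp only [tableWord, Stream'.append_append_stream, Stream'.cons_append_stream]

/-- The part common to both lookups: from just behind the row marker, the entry is found and read,
then the head goes home. Since `E` has no row markers, the marker flipped on the way back is that of
this row. -/
theorem reach_entry (hE : ∀ b, .row b ∉ E) (hR : .delim ∉ R) (ha : a ≠ .halt) (b : Bool)
    (X Y : Stream' Cell) :
    Reach (conf .skip (E.count .comma) (Stream'.cons (.row b) (R.reverse ++ₛ X))
      (E ++ₛ Stream'.cons .comma (List.replicate m .tick ++ₛ Stream'.cons (.act a) (Z ++ₛ Y))))
      (conf (.home a) m X (tableWord R E Z (!b) m a ++ₛ Y)) := by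
  rw [tableWord_append]
  refine (reach_skip_list E 0 _ _).trans ((reach_skip_zero _ _).trans
    ((reach_read_ticks m 0 _ _).trans ?_))
  rw [zero_add]
  refine (reach_read_act _ _ _ ha).trans ((reach_scan_left (fun c hc X Y => ?_) _ _).trans
    ((reach_back _ _ _ (by simp)).trans ((reach_scan_left (fun c hc X Y => ?_) _ _).trans
      ((reach_back_row _ _ _ b).trans (reach_scan_left (fun c hc X Y => ?_) _ _)))))
  · rw [List.eq_of_mem_replicate hc]
    exact reach_back _ _ _ (by simp)
  · refine reach_back _ _ _ fun b hb => hE b (hb ▸ hc)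
  · refine reach_home _ _ _ fun hd => hR (hd ▸ hc)

/-- The first lookup: the counter numbers an entry of the active row, which gets deactivated. -/
theorem reach_find_entry (hE : ∀ b, .row b ∉ E) (hR : .delim ∉ R) (hR' : .row true ∉ R)
    (ha : a ≠ .halt) (X Y : Stream' Cell) :
    Reach (conf .find (E.count .comma) X (tableWord R E Z true m a ++ₛ Y))
      (conf (.home a) m X (tableWord R E Z false m a ++ₛ Y)) := by
  rw [tableWord_append]
  refine (reach_scan_right (fun c hc X Y => reach_find _ _ _ fun hd => hR' (hd ▸ hc)) _ _).trans
    ((reach_find_active _ _ _).trans ?_)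
  exact reach_entry hE hR ha true X Y

/-- The second lookup: commas are counted from the delimiter on, so the counter also determines the
row, which gets activated. -/
theorem reach_skip_entry (hE : ∀ b, .row b ∉ E) (hR : .delim ∉ R) (ha : a ≠ .halt)
    (X Y : Stream' Cell) :
    Reach (conf .skip (R.count .comma + E.count .comma) X (tableWord R E Z false m a ++ₛ Y))
      (conf (.home a) m X (tableWord R E Z true m a ++ₛ Y)) := by
  rw [tableWord_append]
  refine (reach_skip_list R _ _ _).trans ((reach_skip _ _ _ (by simp)).trans ?_)
  exact reach_entry hE hR ha false X Y

theorem reach_find_halt (hE : .delim ∉ E) (hR : .delim ∉ R) (hR' : .row true ∉ R)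
    (X Y : Stream' Cell) :
    Reach (conf .find (E.count .comma) (Stream'.cons .delim X)
        (tableWord R E Z true 0 .halt ++ₛ Y))
      (Stream'.cons Letter.halt (X.map cell), (tableWord R E Z true 0 .halt ++ₛ Y).map cell) := by
  rw [tableWord_append]
  refine (reach_scan_right (fun c hc X Y => reach_find _ _ _ fun hd => hR' (hd ▸ hc)) _ _).trans
    ((reach_find_active _ _ _).trans ((reach_skip_list E 0 _ _).trans ((reach_skip_zero _ _).trans
      ((reach_read_halt _ _ _).trans ((reach_home _ _ _ (by simp)).trans
        ((reach_scan_left (fun c hc X Y => reach_home _ _ _ fun hd => hE (hd ▸ hc)) _ _).trans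
          ((reach_home _ _ _ (by simp)).trans
            ((reach_scan_left (fun c hc X Y => reach_home _ _ _ fun hd => hR (hd ▸ hc)) _ _).trans
              (reach_home_halt _ _)))))))))

end TableWord

/-! ### Words for the symbols of a Turing machine -/

namespace TuringMachine.Code

/-- The state with number `v` in the tables: `0` is an alias of the initial state and the state
number `q` of the machine has number `q + 1`. -/
def state (c : Code) (v : ℕ) : ℕ := if v = 0 then c.2.2.1 else v - 1

def transition (c : Code) (q a : ℕ) : ℕ × ℕ × ℕ := (c.2.2.2.2.getD q []).getD a (0, 0, 0)

/-- The entry number `v` in the row of the symbol `a`: a counter and an action. The first entries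
correspond to the states of the machine and jump to one of the other entries, in the row of the
symbol to be written, whose action is the motion of the head. -/
def entry (c : Code) (a v : ℕ) : ℕ × Act :=
  if v ≤ c.1 then
    if c.state v = c.2.2.2.1 then (0, .halt)
    else ((c.transition (c.state v) a).2.1 * (4 * c.1 + 1) +
      (c.1 + 1 + (3 * (c.transition (c.state v) a).1 + (c.transition (c.state v) a).2.2)), .jump)
  else ((v - (c.1 + 1)) / 3 + 1,
    if (v - (c.1 + 1)) % 3 = 0 then .right else if (v - (c.1 + 1)) % 3 = 1 then .stay else .left)

def entryWord (c : Code) (a v : ℕ) : List Cell :=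
  .comma :: (List.replicate (c.entry a v).1 .tick ++ [.act (c.entry a v).2])

/-- For a machine with `m` states there are `m + 1` entries for the states, including the alias `0`,
and `3m` entries for the pairs of a new state and a motion. -/
def rowWord (c : Code) (a : ℕ) (b : Bool) : List Cell :=
  .row b :: (List.range (4 * c.1 + 1)).flatMap (c.entryWord a)

/-- The table of the machine with the row of the symbol `a` activated. -/
def bodyWord (c : Code) (a : ℕ) : List Cell :=
  (List.range c.2.1).flatMap fun i => c.rowWord i (i == a)

def blockWord (c : Code) (a : ℕ) : List Cell := .delim :: c.bodyWord a

def blockLength (c : Code) : ℕ := (c.blockWord 0).length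

theorem blockLength_pos (c : Code) : 0 < c.blockLength := Nat.succ_pos _

/-- Blocks of different symbols differ only in the flags of their rows. -/
theorem length_bodyWord (c : Code) (a a' : ℕ) : (c.bodyWord a).length = (c.bodyWord a').length := by
  simp only [bodyWord, List.length_flatMap, rowWord, List.length_cons]

theorem length_blockWord (c : Code) (a : ℕ) : (c.blockWord a).length = c.blockLength := by
  rw [blockLength, blockWord, blockWord, List.length_cons, List.length_cons, c.length_bodyWord a 0]

end TuringMachine.Code

theorem flatMap_range_split {α : Type*} (f : ℕ → List α) {j n : ℕ} (h : j < n) :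
    (List.range n).flatMap f = (List.range j).flatMap f ++
      (f j ++ (List.range (n - (j + 1))).flatMap fun i => f (j + 1 + i)) := by
  obtain ⟨d, rfl⟩ := Nat.exists_eq_add_of_lt h
  have : j + d + 1 = (j + 1) + d := by ring
  rw [this, List.range_add, List.flatMap_append, List.range_succ, List.flatMap_append,
    List.append_assoc, List.flatMap_map, Nat.add_sub_cancel_left]
  simp

theorem flatMap_range_congr {α : Type*} {f g : ℕ → List α} {n : ℕ} (h : ∀ i < n, f i = g i) :
    (List.range n).flatMap f = (List.range n).flatMap g :=
  List.flatMap_congr fun i hi => h i (List.mem_range.1 hi)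

theorem count_flatMap_range {α : Type*} [DecidableEq α] {f : ℕ → List α} {x : α} {d : ℕ}
    (h : ∀ i, (f i).count x = d) (n : ℕ) : ((List.range n).flatMap f).count x = n * d := by
  induction n with
  | zero => simp
  | succ n ih => rw [List.range_succ, List.flatMap_append, List.count_append, ih]; simp [h]; ring

namespace TuringMachine.Code

variable (c : Code)

theorem count_comma_entryWord (a v : ℕ) : (c.entryWord a v).count .comma = 1 := by
  simp [entryWord, List.count_append, List.count_replicate]

theorem count_comma_rowWord (a : ℕ) (b : Bool) :
    (c.rowWord a b).count .comma = 4 * c.1 + 1 := by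
  rw [rowWord, List.count_cons_of_ne (by simp), count_flatMap_range (c.count_comma_entryWord a),
    mul_one]

theorem delim_notMem_entryWord (a v : ℕ) : .delim ∉ c.entryWord a v := by
  simp [entryWord, List.mem_replicate]

theorem row_notMem_entryWord (a v : ℕ) (b : Bool) : .row b ∉ c.entryWord a v := by
  simp [entryWord, List.mem_replicate]

theorem delim_notMem_rowWord (a : ℕ) (b : Bool) : .delim ∉ c.rowWord a b := by
  simp [rowWord, delim_notMem_entryWord]

theorem delim_notMem_bodyWord (a : ℕ) : .delim ∉ c.bodyWord a := by
  simp [bodyWord, delim_notMem_rowWord]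

/-- The index `c.2.1` is not the number of a symbol, so `c.bodyWord c.2.1` is the table without
active row: the content of the block between the two lookups. -/
theorem exists_tableWord {a v : ℕ} (ha : a < c.2.1) (hv : v < 4 * c.1 + 1) :
    ∃ R E Z, (c.bodyWord a = tableWord R E Z true (c.entry a v).1 (c.entry a v).2 ∧
      c.bodyWord c.2.1 = tableWord R E Z false (c.entry a v).1 (c.entry a v).2) ∧
      (R.count .comma = a * (4 * c.1 + 1) ∧ E.count .comma = v) ∧
      .delim ∉ R ∧ .row true ∉ R ∧ .delim ∉ E ∧ ∀ b, .row b ∉ E := by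
  refine ⟨(List.range a).flatMap fun i => c.rowWord i false,
    (List.range v).flatMap (c.entryWord a),
    ((List.range (4 * c.1 + 1 - (v + 1))).flatMap fun i => c.entryWord a (v + 1 + i)) ++
      (List.range (c.2.1 - (a + 1))).flatMap fun i => c.rowWord (a + 1 + i) false,
    ?_, ⟨?_, ?_⟩, ?_, ?_, ?_, ?_⟩
  · have h1 (b : Bool) : c.rowWord a b = .row b :: ((List.range v).flatMap (c.entryWord a) ++
        .comma :: (List.replicate (c.entry a v).1 .tick ++ .act (c.entry a v).2 ::
          (List.range (4 * c.1 + 1 - (v + 1))).flatMap fun i => c.entryWord a (v + 1 + i))) := by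
      rw [rowWord, flatMap_range_split _ hv]
      simp [entryWord]
    have h2 (x : ℕ) (hx : x = a ∨ x = c.2.1) : c.bodyWord x =
        ((List.range a).flatMap fun i => c.rowWord i false) ++ (c.rowWord a (a == x) ++
          (List.range (c.2.1 - (a + 1))).flatMap fun i => c.rowWord (a + 1 + i) false) := by
      rw [bodyWord, flatMap_range_split _ ha]
      congr 1
      · refine flatMap_range_congr fun i hi => ?_
        rw [beq_eq_false_iff_ne.2 (by omega)]
      · congr 1
        refine flatMap_range_congr fun i hi => ?_
        rw [beq_eq_false_iff_ne.2 (by omega)]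
    constructor
    · rw [h2 a (Or.inl rfl), beq_self_eq_true, h1, tableWord]
      simp
    · rw [h2 c.2.1 (Or.inr rfl), beq_eq_false_iff_ne.2 ha.ne, h1, tableWord]
      simp
  · exact count_flatMap_range (fun i => c.count_comma_rowWord i false) a
  · rw [count_flatMap_range (c.count_comma_entryWord a), mul_one]
  · simp [delim_notMem_rowWord]
  · simp [rowWord, row_notMem_entryWord]
  · simp [delim_notMem_entryWord]
  · simp [row_notMem_entryWord]

/-- For `a < a'` the words agree before row `a`, and there one marker is active and the other is
not. -/
theorem bodyWord_injOn {a a' : ℕ} (ha : a < c.2.1) (ha' : a' < c.2.1)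
    (h : c.bodyWord a = c.bodyWord a') : a = a' := by
  wlog hlt : a < a' generalizing a a'
  · rcases Nat.lt_or_ge a' a with h' | h'
    · exact (this ha' ha h.symm h').symm
    · omega
  rw [bodyWord, bodyWord, flatMap_range_split _ ha, flatMap_range_split _ ha] at h
  rw [flatMap_range_congr (g := fun i => c.rowWord i (i == a')) (n := a)] at h
  · have := List.append_cancel_left h
    simp [rowWord, hlt.ne] at this
  · intro i hi
    rw [beq_eq_false_iff_ne.2 hi.ne, beq_eq_false_iff_ne.2 (by omega)]

end TuringMachine.Code

/-! ### Streams of blocks -/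

/-- The default letter is never used when all words have length `L > 0`. -/
def blockStream (w : ℕ → List Cell) (L : ℕ) (τ : ℕ → ℕ) : Stream' Cell :=
  fun n => (w (τ (n / L))).getD (n % L) .delim

theorem blockStream_eq {w : ℕ → List Cell} {L : ℕ} (hw : ∀ a, (w a).length = L) (hL : 0 < L)
    (τ : ℕ → ℕ) : blockStream w L τ = w (τ 0) ++ₛ blockStream w L fun i => τ (i + 1) := by
  ext n
  rcases Nat.lt_or_ge n L with h | h
  · rw [Stream'.get_append_left _ _ _ (by rwa [hw])]
    change (w (τ (n / L))).getD (n % L) .delim = _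
    rw [Nat.div_eq_of_lt h, Nat.mod_eq_of_lt h, List.getD_eq_getElem]
  · obtain ⟨d, rfl⟩ := Nat.exists_eq_add_of_le h
    have := Stream'.get_append_right d (w (τ 0)) (blockStream w L fun i => τ (i + 1))
    rw [hw] at this
    rw [this]
    change (w (τ ((L + d) / L))).getD ((L + d) % L) .delim =
      (w (τ (d / L + 1))).getD (d % L) .delim
    rw [Nat.add_mod_left, Nat.add_div_left _ hL]

namespace TuringMachine.Code

variable (c : Code)

/-- The cells to the left of block number `0`, read from right to left. -/
def lefts (σ : ℤ → ℕ) : Stream' Cell :=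
  blockStream (fun a => (c.blockWord a).reverse) c.blockLength fun i => σ (-1 - i)

/-- The cells to the right of block number `0`. -/
def rights (σ : ℤ → ℕ) : Stream' Cell :=
  blockStream c.blockWord c.blockLength fun i => σ (1 + i)

theorem lefts_eq {σ σ' : ℤ → ℕ} (h : ∀ i : ℕ, σ (-2 - i) = σ' (-1 - i)) :
    c.lefts σ = (c.bodyWord (σ (-1))).reverse ++ₛ Stream'.cons .delim (c.lefts σ') := by
  rw [lefts, blockStream_eq (fun a => by rw [List.length_reverse, c.length_blockWord])
    c.blockLength_pos, reverse_append_cons]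
  have : (fun i : ℕ => σ (-1 - ((i + 1 : ℕ) : ℤ))) = fun i : ℕ => σ' (-1 - i) := by
    funext i
    rw [← h]
    congr 1
    push_cast
    ring
  simp only [this]
  rfl

theorem rights_eq {σ σ' : ℤ → ℕ} (h : ∀ i : ℕ, σ (2 + i) = σ' (1 + i)) :
    c.rights σ = Stream'.cons .delim (c.bodyWord (σ 1) ++ₛ c.rights σ') := by
  rw [rights, blockStream_eq c.length_blockWord c.blockLength_pos]
  have : (fun i : ℕ => σ (1 + ((i + 1 : ℕ) : ℤ))) = fun i : ℕ => σ' (1 + i) := by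
    funext i
    rw [← h]
    congr 1
    push_cast
    ring
  simp only [this]
  rfl

theorem lefts_congr {σ σ' : ℤ → ℕ} (h : ∀ i < 0, σ i = σ' i) : c.lefts σ = c.lefts σ' := by
  rw [lefts, lefts]
  congr 1
  funext i
  exact h _ (by omega)

theorem rights_congr {σ σ' : ℤ → ℕ} (h : ∀ i > 0, σ i = σ' i) : c.rights σ = c.rights σ' := by
  rw [rights, rights]
  congr 1
  funext i
  exact h _ (by omega)

/-- The machine is about to look up the entry `v` of the table, and the tape encodes `σ`. -/
def lookup (v : ℕ) (σ : ℤ → ℕ) : Config :=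
  conf .find v (Stream'.cons .delim (c.lefts σ)) (c.bodyWord (σ 0) ++ₛ c.rights σ)

/-- The configuration whose tape encodes `σ`, with the state `z` instead of the first letter of
block number `0`. -/
def withState (z : Letter) (σ : ℤ → ℕ) : Config :=
  (Stream'.cons z ((c.lefts σ).map Letter.cell),
    (c.bodyWord (σ 0) ++ₛ c.rights σ).map Letter.cell)

theorem reach_lookup_zero (σ : ℤ → ℕ) : Reach (c.withState .start σ) (c.lookup 0 σ) := by
  refine Reach.head ?_
  rw [withState, lookup, conf, tally_zero, Stream'.map_cons]
  obtain ⟨x, X, hX⟩ := exists_eq_cons ((c.lefts σ).map Letter.cell)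
  obtain ⟨y, Y, hY⟩ := exists_eq_cons ((c.bodyWord (σ 0) ++ₛ c.rights σ).map Letter.cell)
  rw [hX, hY, machineStep_cons]
  exact Reach.refl _

theorem reach_halt {v : ℕ} {σ : ℤ → ℕ} (hσ : σ 0 < c.2.1) (hv : v ≤ c.1)
    (hh : c.state v = c.2.2.2.1) : Reach (c.lookup v σ) (c.withState .halt σ) := by
  obtain ⟨R, E, Z, ⟨h1, -⟩, ⟨-, hE⟩, hR, hR', hE', -⟩ := c.exists_tableWord hσ
    (v := v) (by omega)
  have he : c.entry (σ 0) v = (0, .halt) := by rw [entry, if_pos hv, if_pos hh]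
  rw [he] at h1
  rw [lookup, withState, h1]
  subst hE
  exact reach_find_halt hE' hR hR' _ _

/-- The value `e` is `ε + 1`. Shifting the tape by `ε = -1` amounts to moving the head to the right,
whence the pairing of `0` with `right` and of `2` with `left`. -/
theorem reach_move {e n : ℕ} {a : Act} {σ : ℤ → ℕ}
    (he : (e = 0 ∧ a = .right) ∨ (e = 1 ∧ a = .stay) ∨ (e = 2 ∧ a = .left)) :
    Reach (conf (.home a) n (Stream'.cons .delim (c.lefts σ)) (c.bodyWord (σ 0) ++ₛ c.rights σ))
      (c.lookup n fun i => σ (i - ((e : ℤ) - 1))) := by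
  have hscan (a : ℕ) : ∀ d ∈ c.bodyWord a, d ≠ .delim := fun d hd h =>
    c.delim_notMem_bodyWord a (h ▸ hd)
  rcases he with ⟨rfl, rfl⟩ | ⟨rfl, rfl⟩ | ⟨rfl, rfl⟩
  · refine (reach_home_right _ _ _).trans
      ((reach_scan_right (fun d hd X Y => reach_next _ _ _ (hscan _ d hd)) _ _).trans ?_)
    have h1 := c.lefts_eq (σ := fun i => σ (i - (((0 : ℕ) : ℤ) - 1))) (σ' := σ)
      fun i => congrArg σ (by push_cast; ring)
    have h2 := c.rights_eq (σ' := fun i => σ (i - (((0 : ℕ) : ℤ) - 1))) (σ := σ)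
      fun i => congrArg σ (by push_cast; ring)
    simp only [Nat.cast_zero, zero_sub, sub_neg_eq_add, neg_add_cancel] at h1 h2 ⊢
    rw [lookup, h1, h2, zero_add]
    exact reach_next_delim _ _ _
  · refine (reach_home_stay _ _ _).trans ?_
    simp only [Nat.cast_one, sub_self, sub_zero]
    exact Reach.refl _
  · refine (reach_home_left _ _ _).trans ?_
    have h1 := c.lefts_eq (σ' := fun i => σ (i - (((2 : ℕ) : ℤ) - 1))) (σ := σ)
      fun i => congrArg σ (by push_cast; ring)
    have h2 := c.rights_eq (σ := fun i => σ (i - (((2 : ℕ) : ℤ) - 1))) (σ' := σ)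
      fun i => congrArg σ (by push_cast; ring)
    have h3 : (((2 : ℕ) : ℤ) - 1) = 1 := by norm_num
    simp only [h3, sub_self] at h1 h2 ⊢
    rw [lookup, h1, h2, zero_sub]
    exact (reach_scan_left (fun d hd X Y => reach_home _ _ _ (hscan _ d hd)) _ _).trans
      (reach_home_stay _ _ _)

/-- The number of steps is stated as `n + 1` because the converse simulation is an induction on
time, for which each simulated step must take some. -/
theorem exists_lookup_step {v q' a' e : ℕ} {σ : ℤ → ℕ} (hσ : σ 0 < c.2.1) (hv : v ≤ c.1)
    (hh : c.state v ≠ c.2.2.2.1) (ht : c.transition (c.state v) (σ 0) = (q', a', e))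
    (hq' : q' < c.1) (ha' : a' < c.2.1) (he : e ≤ 2) :
    ∃ n, machineStep^[n + 1] (c.lookup v σ) =
      c.lookup (q' + 1) fun i => Function.update σ 0 a' (i - ((e : ℤ) - 1)) := by
  obtain ⟨R, E, Z, ⟨h1, h1'⟩, ⟨-, hE⟩, hR, hR', -, hE'⟩ := c.exists_tableWord hσ
    (v := v) (by omega)
  have hen : c.entry (σ 0) v = (a' * (4 * c.1 + 1) + (c.1 + 1 + (3 * q' + e)), .jump) := by
    rw [entry, if_pos hv, if_neg hh, ht]
  rw [hen] at h1 h1'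
  obtain ⟨n, hn⟩ : Reach (c.lookup v σ) (conf (.home .jump)
      (a' * (4 * c.1 + 1) + (c.1 + 1 + (3 * q' + e))) (Stream'.cons .delim (c.lefts σ))
      (c.bodyWord c.2.1 ++ₛ c.rights σ)) := by
    rw [lookup, h1, h1']
    subst hE
    exact reach_find_entry hE' hR hR' (by simp) _ _
  -- The `a' * (4 * c.1 + 1)` leading commas belong to the rows before row `a'`; the rest of the
  -- counter numbers the entry for the pair `(q', e)` in that row.
  obtain ⟨R, E, Z, ⟨h2, h2'⟩, ⟨hRc, hEc⟩, hR, hR', -, hE'⟩ := c.exists_tableWord ha'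
    (v := c.1 + 1 + (3 * q' + e)) (by omega)
  obtain ⟨a, hen2, hact⟩ : ∃ a, c.entry a' (c.1 + 1 + (3 * q' + e)) = (q' + 1, a) ∧
      ((e = 0 ∧ a = .right) ∨ (e = 1 ∧ a = .stay) ∨ (e = 2 ∧ a = .left)) := by
    refine ⟨_, by
      rw [entry, if_neg (by omega), Nat.add_sub_cancel_left, Nat.mul_add_mod,
        Nat.mul_add_div (by norm_num), Nat.mod_eq_of_lt (a := e) (by omega),
        Nat.div_eq_of_lt (a := e) (by omega), Nat.add_zero], ?_⟩
    interval_cases e <;> simp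
  rw [hen2] at h2 h2'
  have hne : a ≠ .halt := by rcases hact with ⟨-, rfl⟩ | ⟨-, rfl⟩ | ⟨-, rfl⟩ <;> simp
  have hR2 : Reach (conf (.home .jump) (a' * (4 * c.1 + 1) + (c.1 + 1 + (3 * q' + e)))
      (Stream'.cons .delim (c.lefts σ)) (c.bodyWord c.2.1 ++ₛ c.rights σ))
      (conf (.home a) (q' + 1) (Stream'.cons .delim (c.lefts σ))
        (c.bodyWord a' ++ₛ c.rights σ)) := by
    refine (reach_home_jump _ _ _).trans ?_
    rw [h2, h2']
    have := reach_skip_entry (m := q' + 1) (Z := Z) hE' hR hne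
      (Stream'.cons .delim (c.lefts σ)) (c.rights σ)
    rwa [hRc, hEc] at this
  have hR3 := c.reach_move (e := e) (n := q' + 1) (a := a) (σ := Function.update σ 0 a') hact
  rw [Function.update_self, c.lefts_congr (σ' := σ) (fun i hi => Function.update_of_ne hi.ne _ _),
    c.rights_congr (σ' := σ) (fun i hi => Function.update_of_ne hi.ne' _ _)] at hR3
  obtain ⟨m, hm⟩ := hR2.trans hR3
  -- The first lookup takes at least one step, because it begins in phase `find` and ends in phase
  -- `home`.
  rcases n with _ | n
  · exact absurd (congrArg (fun d : Config => d.1.head) hn) (by simp [lookup, conf])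
  · refine ⟨m + n, ?_⟩
    rw [add_assoc, Function.iterate_add_apply, hn, hm]

end TuringMachine.Code

/-! ### Computability of the block code -/

noncomputable instance : Primcodable Act := Primcodable.ofEquiv _ (Fintype.equivFin Act)

noncomputable instance : Primcodable Cell := Primcodable.ofEquiv _ (Fintype.equivFin Cell)

theorem primrec_list_replicate {α : Type*} [Primcodable α] (x : α) :
    Primrec fun n => List.replicate n x :=
  (Primrec.list_map Primrec.list_range (Primrec.const x).to₂).of_eq fun n => by
    rw [List.map_const', List.length_range]

namespace TuringMachine.Code

open Primrec

theorem primrec_state : Primrec₂ state :=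
  Primrec.ite (Primrec.eq.comp snd (const 0)) (fst.comp (snd.comp (snd.comp fst)))
    (nat_sub.comp snd (const 1))

theorem primrec_transition {α : Type*} [Primcodable α] {f : α → Code} {g h : α → ℕ}
    (hf : Primrec f) (hg : Primrec g) (hh : Primrec h) :
    Primrec fun x => (f x).transition (g x) (h x) :=
  (list_getD (0, 0, 0)).comp ((list_getD []).comp
    (snd.comp (snd.comp (snd.comp (snd.comp hf)))) hg) hh

theorem primrec_entry {α : Type*} [Primcodable α] {f : α → Code} {g h : α → ℕ}
    (hf : Primrec f) (hg : Primrec g) (hh : Primrec h) :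
    Primrec fun x => (f x).entry (g x) (h x) := by
  have hs : Primrec fun x => (f x).state (h x) := primrec_state.comp hf hh
  have ht := primrec_transition hf hs hg
  have hm : Primrec fun x => (f x).1 := fst.comp hf
  have h4 : Primrec fun x => 4 * (f x).1 + 1 := succ.comp (nat_mul.comp (const 4) hm)
  have h1 : Primrec fun x => (f x).1 + 1 := succ.comp hm
  have hd : Primrec fun x => h x - ((f x).1 + 1) := nat_sub.comp hh h1
  have hr : Primrec fun x => (h x - ((f x).1 + 1)) % 3 := nat_mod.comp hd (const 3)
  refine Primrec.ite (nat_le.comp hh hm) (Primrec.ite (Primrec.eq.comp hs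
    (fst.comp (snd.comp (snd.comp (snd.comp hf))))) (const _) (Primrec.pair ?_ (const _)))
    (Primrec.pair ?_ ?_)
  · exact nat_add.comp (nat_mul.comp (fst.comp (snd.comp ht)) h4)
      (nat_add.comp h1 (nat_add.comp (nat_mul.comp (const 3) (fst.comp ht))
        (snd.comp (snd.comp ht))))
  · exact succ.comp (nat_div.comp hd (const 3))
  · exact Primrec.ite (Primrec.eq.comp hr (const 0)) (const _)
      (Primrec.ite (Primrec.eq.comp hr (const 1)) (const _) (const _))

theorem primrec_entryWord {α : Type*} [Primcodable α] {f : α → Code} {g h : α → ℕ}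
    (hf : Primrec f) (hg : Primrec g) (hh : Primrec h) :
    Primrec fun x => (f x).entryWord (g x) (h x) := by
  have he := primrec_entry hf hg hh
  exact list_cons.comp (const _) (list_append.comp ((primrec_list_replicate _).comp (fst.comp he))
    (list_cons.comp ((dom_finite Cell.act).comp (snd.comp he)) (const [])))

theorem primrec_rowWord {α : Type*} [Primcodable α] {f : α → Code} {g : α → ℕ} {b : α → Bool}
    (hf : Primrec f) (hg : Primrec g) (hb : Primrec b) :
    Primrec fun x => (f x).rowWord (g x) (b x) :=
  list_cons.comp ((dom_finite Cell.row).comp hb)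
    (list_flatMap (list_range.comp (succ.comp (nat_mul.comp (const 4) (fst.comp hf))))
      (primrec_entryWord (hf.comp fst) (hg.comp fst) snd))

theorem primrec_bodyWord : Primrec₂ bodyWord :=
  list_flatMap (list_range.comp (fst.comp (snd.comp fst)))
    (primrec_rowWord (fst.comp fst) snd (Primrec.beq.comp snd (snd.comp fst)))

theorem primrec_blockWord : Primrec₂ blockWord :=
  list_cons.comp (const _) primrec_bodyWord

theorem primrec_blockLength : Primrec blockLength :=
  list_length.comp (primrec_blockWord.comp Primrec.id (const 0))

end TuringMachine.Code

section BlockCode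

open TuringMachine Primrec

variable {k : ℕ} (φ : Letter ≃ Fin (k + 1))

/-- The letters of the word for the symbol `a`. -/
def blockLetter (z : Letter) (c : Code) (o : Bool) (a r : ℕ) : Letter :=
  if o = true ∧ r = 0 then z else .cell ((c.blockWord a).getD r .delim)

theorem primrec_blockLetter (z : Letter) :
    Primrec fun p : Code × Bool × ℕ × ℕ => φ (blockLetter z p.1 p.2.1 p.2.2.1 p.2.2.2) := by
  have h1 : Primrec fun p : Code × Bool × ℕ × ℕ => (p.1.blockWord p.2.2.1).getD p.2.2.2 .delim :=
    (list_getD _).comp (Code.primrec_blockWord.comp fst (fst.comp (snd.comp snd)))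
      (snd.comp (snd.comp snd))
  have h2 : Primrec fun p : Code × Bool × ℕ × ℕ =>
      φ (.cell ((p.1.blockWord p.2.2.1).getD p.2.2.2 .delim)) :=
    (dom_finite fun d => φ (.cell d)).comp h1
  refine (Primrec.ite ((Primrec.eq.comp (fst.comp snd) (const true)).and
    (Primrec.eq.comp (snd.comp (snd.comp snd)) (const 0))) (const (φ z)) h2).of_eq fun p => ?_
  rw [blockLetter]
  split_ifs <;> rfl

/-- The number of the symbol whose word is `w`, up to the first letter of the word. -/
def readWord (c : Code) (w : List (Fin (k + 1))) : ℕ :=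
  if w.head? = some (φ (.cell .delim)) ∨ w.head? = some (φ .halt) then
    (List.range c.2.1).findIdx fun a =>
      decide ((c.bodyWord a).map (fun d => φ (.cell d)) = w.tail)
  else c.2.1

theorem primrec_readWord : Primrec₂ (readWord φ) := by
  refine Primrec.ite (((Primrec.eq.comp (list_head?.comp snd) (const _))).or
    (Primrec.eq.comp (list_head?.comp snd) (const _))) ?_ (fst.comp (snd.comp fst))
  refine list_findIdx (list_range.comp (fst.comp (snd.comp fst))) ?_
  refine (Primrec.eq.comp ?_ (list_tail.comp (snd.comp fst))).decide
  exact list_map (Code.primrec_bodyWord.comp (fst.comp fst) snd)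
    ((dom_finite fun d => φ (.cell d)).comp snd).to₂

theorem readWord_eq {c : Code} {a : ℕ} (ha : a < c.2.1) {z : Letter}
    (hz : z = .cell .delim ∨ z = .halt) :
    readWord φ c (φ z :: (c.bodyWord a).map fun d => φ (.cell d)) = a := by
  rw [readWord, if_pos (by rcases hz with rfl | rfl <;> simp),
    List.findIdx_eq (by rwa [List.length_range])]
  refine ⟨by simp, fun j hj => ?_⟩
  rw [decide_eq_false_iff_not, List.getElem_range, List.tail_cons]
  intro h
  have hinj : Function.Injective fun d => φ (.cell d) :=
    φ.injective.comp fun _ _ h => Letter.cell.inj h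
  exact hj.ne (c.bodyWord_injOn (hj.trans ha) ha (List.map_injective_iff.2 hinj h))

/-- A word with any other first letter is read as `c.2.1`, which is no symbol's number. -/
theorem head_eq_of_readWord_lt {c : Code} {x : Fin (k + 1)} {w : List (Fin (k + 1))}
    (h : readWord φ c (x :: w) < c.2.1) : x = φ (.cell .delim) ∨ x = φ .halt := by
  by_contra hx
  rw [readWord, if_neg (by simpa using hx)] at h
  exact h.false

/-- The block code of the universal machine. -/
noncomputable def blockCoding : BlockCoding k where
  len := Code.blockLength
  digit p := φ (blockLetter .start p.1 p.2.1 p.2.2.1 p.2.2.2)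
  read p := readWord φ p.1 p.2
  len_pos := Code.blockLength_pos
  computable_len := Code.primrec_blockLength.to_comp
  computable_digit := (primrec_blockLetter φ .start).to_comp
  computable_read := (primrec_readWord φ).to_comp

end BlockCode

/-! ### Configurations as two-sided tapes -/

/-- The two-sided tape of a configuration; the left stream starts in position `0`. -/
def Config.tape (d : Config) (j : ℤ) : Letter :=
  if j ≤ 0 then d.1.get (-j).toNat else d.2.get (j - 1).toNat

theorem Config.tape_neg (d : Config) (n : ℕ) : d.tape (-n) = d.1.get n := by
  rw [Config.tape, if_pos (by omega), neg_neg, Int.toNat_natCast]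

theorem Config.tape_add_one (d : Config) (n : ℕ) : d.tape (n + 1) = d.2.get n := by
  rw [Config.tape, if_neg (by omega), add_sub_cancel_right, Int.toNat_natCast]

namespace TuringMachine.Code

variable (c : Code)

theorem tape_withState (z : Letter) (σ : ℤ → ℕ) (j : ℤ) :
    (c.withState z σ).tape j = blockLetter z c (decide (j / (c.blockLength : ℤ) = 0))
      (σ (j / (c.blockLength : ℤ))) (j % (c.blockLength : ℤ)).toNat := by
  have hL := c.blockLength_pos
  set L := c.blockLength with hLdef
  rcases lt_trichotomy j 0 with hj | rfl | hj
  · obtain ⟨n, rfl⟩ : ∃ n : ℕ, j = -((n + 1 : ℕ) : ℤ) := ⟨(-j - 1).toNat, by omega⟩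
    -- Division with remainder for a negative position; the remainder runs backwards, in accordance
    -- with the reversed words in `lefts`.
    have hdm : -((n + 1 : ℕ) : ℤ) = ((L - 1 - n % L : ℕ) : ℤ) + L * (-1 - (n / L : ℕ)) := by
      have h1 := Nat.div_add_mod n L
      have h2 := Nat.mod_lt n hL
      have h3 : ((L - 1 - n % L : ℕ) : ℤ) = L - 1 - (n % L : ℕ) := by omega
      rw [h3]
      conv_lhs => rw [← h1]
      push_cast
      ring
    have hlt : ((L - 1 - n % L : ℕ) : ℤ) < L := by omega
    have hdiv : -((n + 1 : ℕ) : ℤ) / L = -1 - (n / L : ℕ) := by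
      rw [hdm, Int.add_mul_ediv_left _ _ (by omega), Int.ediv_eq_zero_of_lt (Int.natCast_nonneg _) hlt, zero_add]
    have hmod : -((n + 1 : ℕ) : ℤ) % L = (L - 1 - n % L : ℕ) := by
      rw [hdm, Int.add_mul_emod_self_left, Int.emod_eq_of_lt (Int.natCast_nonneg _) hlt]
    have hne (x : ℕ) : (-1 - (x : ℤ)) ≠ 0 := by omega
    rw [Config.tape_neg, hdiv, hmod, blockLetter,
      if_neg fun h => hne _ (of_decide_eq_true h.1), Int.toNat_natCast]
    change Letter.cell ((c.blockWord (σ (-1 - (n / L : ℕ)))).reverse.getD (n % L) .delim) = _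
    have h2 := Nat.mod_lt n hL
    have hlen := c.length_blockWord (σ (-1 - (n / L : ℕ)))
    rw [List.getD_eq_getElem _ _ (by rw [List.length_reverse, hlen]; exact h2),
      List.getD_eq_getElem _ _ (by rw [hlen]; omega), List.getElem_reverse]
    simp only [hlen, ← hLdef]
  · rw [Int.zero_ediv, Int.zero_emod, blockLetter, if_pos (by simp)]
    rfl
  · obtain ⟨n, rfl⟩ : ∃ n : ℕ, j = (n : ℤ) + 1 := ⟨(j - 1).toNat, by omega⟩
    have hc : ((n : ℤ) + 1) = ((n + 1 : ℕ) : ℤ) := by push_cast; rfl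
    rw [Config.tape_add_one, hc, ← Int.natCast_div, ← Int.natCast_mod, Int.toNat_natCast,
      blockLetter, if_neg]
    swap
    · rintro ⟨h1, h2⟩
      have h1 := of_decide_eq_true h1
      have := Nat.div_add_mod (n + 1) L
      rw [h2, show (n + 1) / L = 0 by exact_mod_cast h1] at this
      omega
    -- Positive positions do not see the first letter of block `0`, so the delimiter may be put back
    -- to obtain a plain stream of blocks.
    have key : Stream'.cons Cell.delim (c.bodyWord (σ 0) ++ₛ c.rights σ) =
        blockStream c.blockWord L fun i => σ i := by
      rw [blockStream_eq c.length_blockWord hL]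
      change c.blockWord (σ 0) ++ₛ _ = _
      congr 1
      rw [rights]
      congr 1
      funext i
      push_cast
      rw [add_comm]
    have := congrArg (fun X => Letter.cell (X.get (n + 1))) key
    exact this

theorem tapeBlock_withState (z : Letter) (σ : ℤ → ℕ) (i : ℤ) :
    tapeBlock c.blockLength (c.withState z σ).tape i =
      (if i = 0 then z else .cell .delim) :: (c.bodyWord (σ i)).map Letter.cell := by
  have hL := c.blockLength_pos
  have hlen := c.length_blockWord (σ i)
  have key (r : ℕ) (hr : r < c.blockLength) : (c.withState z σ).tape (c.blockLength * i + r) =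
      blockLetter z c (decide (i = 0)) (σ i) r := by
    rw [tape_withState, Int.mul_add_ediv_left _ _ (by omega),
      Int.ediv_eq_zero_of_lt (by omega) (by omega), add_zero, Int.mul_add_emod_self_left,
      Int.emod_eq_of_lt (by omega) (by omega), Int.toNat_natCast]
  apply List.ext_getElem
  · rw [tapeBlock, List.length_ofFn, List.length_cons, List.length_map, ← hlen, blockWord,
      List.length_cons]
  · intro r h1 h2
    rw [tapeBlock, List.length_ofFn] at h1
    simp only [tapeBlock, List.getElem_ofFn]
    rw [key r h1]
    rcases r with _ | r
    · by_cases hi : i = 0 <;> simp [blockLetter, hi, blockWord]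
    · rw [blockLetter, if_neg (by simp), List.getD_eq_getElem _ _ (by rwa [hlen])]
      simp [blockWord]

end TuringMachine.Code

theorem map_tapeBlock {α β : Type*} (f : α → β) (L : ℕ) (u : ℤ → α) (i : ℤ) :
    tapeBlock L (fun j => f (u j)) i = (tapeBlock L u i).map f := by
  rw [tapeBlock, tapeBlock, List.map_ofFn]
  rfl

/-! ### The symbolic simulation -/

def Letter.IsState : Letter → Prop
  | .cell _ => False
  | .one => False
  | _ => True

/-- Position `0` therefore holds a state letter at all times, never a delimiter. -/
theorem rule_isState {q : Letter} (hq : q.IsState) (x y : Letter) :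
    ∃ q' w, (rule q x y).1 = q' :: w ∧ q'.IsState := by
  rcases q with c | _ | _ | _ | p | ⟨p, c⟩ | ⟨p, c⟩ | p
  · exact hq.elim
  · exact hq.elim
  · exact ⟨_, _, rfl, trivial⟩
  · exact ⟨_, _, rfl, trivial⟩
  · cases p <;> simp only [rule, runRule] <;> repeat' split
    all_goals exact ⟨_, _, rfl, trivial⟩
  all_goals
    simp only [rule]
    split <;> exact ⟨_, _, rfl, trivial⟩

theorem isState_machineStep {d : Config} (h : d.1.head.IsState) :
    (machineStep d).1.head.IsState := by
  obtain ⟨q', w, hw, hq⟩ := rule_isState h d.1.tail.head d.2.head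
  have : (machineStep d).1 = (rule d.1.head d.1.tail.head d.2.head).1 ++ₛ d.1.tail.tail := rfl
  rw [this, hw]
  exact hq

theorem isState_iterate {d : Config} (h : d.1.head.IsState) (n : ℕ) :
    (machineStep^[n] d).1.head.IsState := by
  induction n with
  | zero => exact h
  | succ n ih =>
    rw [Function.iterate_succ_apply']
    exact isState_machineStep ih

theorem machineStep_of_halt {d : Config} (h : d.1.head = .halt) : machineStep d = d := by
  obtain ⟨X, Y⟩ := d
  obtain ⟨q, X, rfl⟩ := exists_eq_cons X
  obtain ⟨x, X, rfl⟩ := exists_eq_cons X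
  obtain ⟨y, Y, rfl⟩ := exists_eq_cons Y
  obtain rfl : q = .halt := h
  rfl

theorem iterate_of_halt {d : Config} {j n : ℕ} (h : (machineStep^[j] d).1.head = .halt)
    (hn : j ≤ n) : machineStep^[n] d = machineStep^[j] d := by
  obtain ⟨i, rfl⟩ := Nat.exists_eq_add_of_le' hn
  rw [Function.iterate_add_apply]
  exact Function.iterate_fixed (machineStep_of_halt h) i

/-- The letter `halt` makes a configuration fixed, so a time without `halt` precedes every time with
it. -/
theorem exists_add_of_halt {d : Config} {j n : ℕ} (h : (machineStep^[j] d).1.head = .halt)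
    (hn : (machineStep^[n] d).1.head ≠ .halt) :
    ∃ i, j = i + n ∧ machineStep^[j] d = machineStep^[i] (machineStep^[n] d) := by
  rcases Nat.lt_or_ge n j with hlt | hle
  · obtain ⟨i, rfl⟩ := Nat.exists_eq_add_of_le' hlt.le
    exact ⟨i, rfl, Function.iterate_add_apply _ _ _ _⟩
  · exact absurd (iterate_of_halt h hle ▸ h) hn

theorem getD_ofFn {α : Type*} {n : ℕ} (f : Fin n → α) (i : Fin n) (d : α) :
    (List.ofFn f).getD i d = f i := by
  rw [List.getD_eq_getElem _ _ (by rw [List.length_ofFn]; exact i.isLt), List.getElem_ofFn]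

namespace TuringMachine

variable {Q A : Type*} {m l : ℕ} (T : TuringMachine Q A) (eQ : Q ≃ Fin m) (eA : A ≃ Fin l)

theorem transition_code {q : Q} (hq : q ≠ T.halt) (a : A) :
    (T.code eQ eA).transition (eQ q) (eA a) =
      ((eQ (T.δ ⟨q, hq⟩ a).1 : ℕ), (eA (T.δ ⟨q, hq⟩ a).2.1 : ℕ),
        (((T.δ ⟨q, hq⟩ a).2.2 : ℤ) + 1).toNat) := by
  simp only [Code.transition, code]
  rw [getD_ofFn, getD_ofFn]
  simp [hq]

theorem exists_lookup_next {q : Q} (hq : q ≠ T.halt) {s : ℤ → A} {v : ℕ} (hv : v ≤ m)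
    (hs : (T.code eQ eA).state v = eQ q) :
    ∃ n, machineStep^[n + 1] ((T.code eQ eA).lookup v fun i => eA (s i)) =
      (T.code eQ eA).lookup (eQ (T.next (q, s)).1 + 1) fun i => eA ((T.next (q, s)).2 i) := by
  have hε (ε : SignType) : 0 ≤ (ε : ℤ) + 1 ∧ (ε : ℤ) + 1 ≤ 2 := by cases ε <;> decide
  have hh : (T.code eQ eA).state v ≠ (T.code eQ eA).2.2.2.1 := by
    rw [hs]
    exact fun h => hq (eQ.injective (Fin.ext h))
  have ht := T.transition_code eQ eA hq (s 0)
  rw [← hs] at ht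
  obtain ⟨n, hn⟩ := (T.code eQ eA).exists_lookup_step (σ := fun i => eA (s i)) (eA (s 0)).isLt hv hh
    ht (Fin.isLt _) (Fin.isLt _) (by
      have := (hε (T.δ ⟨q, hq⟩ (s 0)).2.2).2
      omega)
  refine ⟨n, hn.trans ?_⟩
  rw [next, dif_neg hq]
  congr 1
  funext i
  rw [Int.toNat_of_nonneg (hε _).1, add_sub_cancel_right]
  simp only [Function.update_apply]
  split_ifs <;> rfl

theorem state_code_succ (q : Q) : (T.code eQ eA).state (eQ q + 1) = eQ q := by
  rw [Code.state, if_neg (Nat.succ_ne_zero _), Nat.add_sub_cancel]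

theorem state_code_zero : (T.code eQ eA).state 0 = eQ T.start := rfl

theorem reach_of_iterate_next {N v : ℕ} {q : Q} {s t : ℤ → A}
    (h : T.next^[N] (q, s) = (T.halt, t)) (hv : v ≤ m)
    (hs : (T.code eQ eA).state v = eQ q) :
    Reach ((T.code eQ eA).lookup v fun i => eA (s i))
      ((T.code eQ eA).withState .halt fun i => eA (t i)) := by
  induction N generalizing q s v with
  | zero =>
    obtain ⟨rfl, rfl⟩ : q = T.halt ∧ s = t := Prod.ext_iff.1 h
    exact (T.code eQ eA).reach_halt (eA _).isLt hv hs
  | succ N ih =>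
    by_cases hq : q = T.halt
    · subst hq
      have : T.next (T.halt, s) = (T.halt, s) := by rw [next, dif_pos rfl]
      rw [Function.iterate_succ_apply, this] at h
      exact ih h hv hs
    · obtain ⟨n, hn⟩ := T.exists_lookup_next eQ eA hq hv hs (s := s)
      refine Reach.trans ⟨n + 1, hn⟩ (ih (q := (T.next (q, s)).1) ?_ (Fin.isLt _)
        (T.state_code_succ eQ eA _))
      rwa [Function.iterate_succ_apply] at h

/-- Strong induction on `j`: unless `q` halts, a full simulated step fits before time `j` and leaves
a smaller time. If `q` halts, fixedness identifies the configuration at time `j`. -/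
theorem exists_halt_of_head {j v : ℕ} {q : Q} {s : ℤ → A} (hv : v ≤ m)
    (hs : (T.code eQ eA).state v = eQ q)
    (h : (machineStep^[j] ((T.code eQ eA).lookup v fun i => eA (s i))).1.head = .halt) :
    ∃ t, (∃ N, T.next^[N] (q, s) = (T.halt, t)) ∧
      machineStep^[j] ((T.code eQ eA).lookup v fun i => eA (s i)) =
        (T.code eQ eA).withState .halt fun i => eA (t i) := by
  induction j using Nat.strong_induction_on generalizing q s v with
  | _ j ih =>
    by_cases hq : q = T.halt
    · subst hq
      obtain ⟨n, hn⟩ := T.reach_of_iterate_next eQ eA (N := 0) (q := T.halt) (s := s) rfl hv hs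
      refine ⟨s, ⟨0, rfl⟩, ?_⟩
      rcases le_total j n with hle | hle
      · rw [← iterate_of_halt h hle, hn]
      · rw [iterate_of_halt (by rw [hn]; rfl) hle, hn]
    · obtain ⟨n, hn⟩ := T.exists_lookup_next eQ eA hq hv hs (s := s)
      obtain ⟨i, rfl, hi⟩ := exists_add_of_halt h (n := n + 1) (by
        rw [hn]
        simp [Code.lookup, conf])
      rw [hi, hn] at h ⊢
      obtain ⟨t, ⟨N, hN⟩, ht⟩ := ih i (by omega) (q := (T.next (q, s)).1) (Fin.isLt _)
        (T.state_code_succ eQ eA _) h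
      exact ⟨t, ⟨N + 1, by rwa [Function.iterate_succ_apply]⟩, ht⟩

theorem HaltsWithTape.reach {T : TuringMachine Q A} {s t : ℤ → A} (h : T.HaltsWithTape s t) :
    Reach ((T.code eQ eA).withState .start fun i => eA (s i))
      ((T.code eQ eA).withState .halt fun i => eA (t i)) := by
  obtain ⟨N, hN⟩ := h
  exact ((T.code eQ eA).reach_lookup_zero _).trans
    (T.reach_of_iterate_next eQ eA hN (Nat.zero_le _) (T.state_code_zero eQ eA))

theorem exists_haltsWithTape {j : ℕ} {s : ℤ → A}
    (h : (machineStep^[j] ((T.code eQ eA).withState .start fun i => eA (s i))).1.head = .halt) :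
    ∃ t, T.HaltsWithTape s t ∧
      machineStep^[j] ((T.code eQ eA).withState .start fun i => eA (s i)) =
        (T.code eQ eA).withState .halt fun i => eA (t i) := by
  obtain ⟨n, hn⟩ := (T.code eQ eA).reach_lookup_zero fun i => eA (s i)
  obtain ⟨i, -, hi⟩ := exists_add_of_halt h (n := n) (by
    rw [hn]
    simp [Code.lookup, conf])
  rw [hi, hn] at h ⊢
  exact T.exists_halt_of_head eQ eA (Nat.zero_le _) (T.state_code_zero eQ eA) h

end TuringMachine

/-! ### Distances in the Cantor set -/

/-- The chord has length `2 |sin (π (s - t))|`, and Jordan's inequality bounds the sine from below.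
-/
theorem le_dist_circlePt {s t : ℝ} (h : |s - t| ≤ 1 / 2) :
    4 * |s - t| ≤ dist (circlePt s) (circlePt t) := by
  have h1 : dist (circlePt s) (circlePt t) = 2 * |Real.sin (Real.pi * (s - t))| := by
    have hs : circlePt s = circlePt (s - t) * circlePt t := by rw [← circlePt_add, sub_add_cancel]
    have hd : dist (circlePt s) (circlePt t) = dist (circlePt s : ℂ) (circlePt t) := rfl
    rw [hd, hs, dist_eq_norm, Circle.coe_mul, ← sub_one_mul, norm_mul,
      Circle.norm_coe, mul_one, circlePt, Circle.coe_exp, mul_comm _ Complex.I,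
      Complex.norm_exp_I_mul_ofReal_sub_one, norm_mul, Real.norm_eq_abs, Real.norm_eq_abs, abs_two]
    congr 3
    ring
  have hpi := Real.pi_pos
  have h2 : 2 / Real.pi * (Real.pi * |s - t|) ≤ Real.sin (Real.pi * |s - t|) :=
    Real.mul_le_sin (by positivity) (by nlinarith)
  have h3 : 2 / Real.pi * (Real.pi * |s - t|) = 2 * |s - t| := by field_simp
  have h4 : |Real.sin (Real.pi * (s - t))| = |Real.sin (Real.pi * |s - t|)| := by
    rcases abs_choice (s - t) with h | h
    · rw [h]
    · rw [h, mul_neg, Real.sin_neg, abs_neg]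
  rw [h1, h4]
  linarith [le_abs_self (Real.sin (Real.pi * |s - t|))]

/-- After multiplication by the base, distinct first digits would keep the values at least `1 - 1/9`
apart, more than the permitted `1/4`. Equal first digits cancel, and the tails satisfy the
hypothesis for `N - 1`. -/
theorem get_eq_of_abs_streamVal_sub_lt {B : Type*} {k : ℕ} (hk : 1 ≤ k) {dg : B → ℕ}
    (hinj : Function.Injective dg) (hdg : ∀ a, dg a ≤ k) {N : ℕ} {X Y : Stream' B}
    (h : 4 * |streamVal k dg X - streamVal k dg Y| < ((10 * (k : ℝ)) ^ N)⁻¹) {i : ℕ} (hi : i < N) :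
    X.get i = Y.get i := by
  have hk' : (1 : ℝ) ≤ k := by exact_mod_cast hk
  have hb : (0 : ℝ) < 10 * k := by positivity
  induction N generalizing X Y i with
  | zero => omega
  | succ N ih =>
    have hX := streamVal_le hk hdg X.tail
    have hY := streamVal_le hk hdg Y.tail
    have hX0 := streamVal_nonneg (k := k) (dg := dg) X.tail
    have hY0 := streamVal_nonneg (k := k) (dg := dg) Y.tail
    rw [streamVal_eq hk hdg X, streamVal_eq hk hdg Y, ← sub_div, abs_div, abs_of_pos hb, pow_succ,
      mul_inv, ← div_eq_mul_inv, ← mul_div_assoc, div_lt_div_iff_of_pos_right hb] at h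
    have hone : ((10 * (k : ℝ)) ^ N)⁻¹ ≤ 1 := inv_le_one_of_one_le₀ (one_le_pow₀ (by linarith))
    have hlt := abs_lt.1 (show |(dg X.head + streamVal k dg X.tail : ℝ) -
      (dg Y.head + streamVal k dg Y.tail)| < 1 / 4 by linarith)
    have hhead : dg X.head = dg Y.head := by
      rcases lt_trichotomy (dg X.head) (dg Y.head) with hlt' | heq | hlt'
      · have : (dg X.head : ℝ) + 1 ≤ dg Y.head := by exact_mod_cast hlt'
        linarith [hlt.1]
      · exact heq
      · have : (dg Y.head : ℝ) + 1 ≤ dg X.head := by exact_mod_cast hlt'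
        linarith [hlt.2]
    rcases i with _ | i
    · exact hinj hhead
    · rw [hhead, add_sub_add_left_eq_sub] at h
      exact ih h (by omega)

theorem cantorPoint_eq (k : ℕ) (u : ℤ → Fin (k + 1)) : cantorPoint k u =
    (circlePt (streamVal k (fun d : Fin (k + 1) => (d : ℕ)) fun n => u (n + 1)),
      circlePt (streamVal k (fun d : Fin (k + 1) => (d : ℕ)) fun n => u (-n))) := rfl

theorem eq_of_dist_cantorPoint_lt {k : ℕ} (hk : 1 ≤ k) {u v : ℤ → Fin (k + 1)} {N : ℕ}
    (h : dist (cantorPoint k u) (cantorPoint k v) < ((10 * (k : ℝ)) ^ N)⁻¹) {i : ℤ}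
    (hi : -(N : ℤ) < i) (hi' : i ≤ N) : u i = v i := by
  have hdg (a : Fin (k + 1)) : (a : ℕ) ≤ k := Nat.lt_succ_iff.1 a.isLt
  have key (X Y : Stream' (Fin (k + 1)))
      (hXY : dist (circlePt (streamVal k (fun d : Fin (k + 1) => (d : ℕ)) X))
        (circlePt (streamVal k (fun d : Fin (k + 1) => (d : ℕ)) Y)) < ((10 * (k : ℝ)) ^ N)⁻¹)
      (n : ℕ) (hn : n < N) : X.get n = Y.get n := by
    refine get_eq_of_abs_streamVal_sub_lt hk Fin.val_injective hdg
      ((le_dist_circlePt ?_).trans_lt hXY) hn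
    have h1 := streamVal_le hk hdg X
    have h2 := streamVal_le hk hdg Y
    have h3 := streamVal_nonneg (k := k) (dg := fun d : Fin (k + 1) => (d : ℕ)) X
    have h4 := streamVal_nonneg (k := k) (dg := fun d : Fin (k + 1) => (d : ℕ)) Y
    rw [abs_le]
    constructor <;> linarith
  rw [cantorPoint_eq, cantorPoint_eq, Prod.dist_eq, max_lt_iff] at h
  rcases le_or_gt i 0 with h0 | h0
  · obtain ⟨n, rfl⟩ := Int.exists_eq_neg_ofNat h0
    exact key _ _ h.2 n (by omega)
  · obtain ⟨n, rfl⟩ : ∃ n : ℕ, i = (n : ℤ) + 1 := ⟨(i - 1).toNat, by omega⟩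
    exact key _ _ h.1 n (by omega)

theorem tapeBlock_congr {B : Type*} {L : ℕ} {u v : ℤ → B} {i : ℤ}
    (h : ∀ j : ℤ, L * i ≤ j → j < L * i + L → u j = v j) : tapeBlock L u i = tapeBlock L v i := by
  rw [tapeBlock, tapeBlock]
  congr 1
  funext r
  have := r.isLt
  exact h _ (by omega) (by omega)

/-! ### Orbits of the diffeomorphism and runs of the machine -/

section Universality

variable {k : ℕ} (φ : Letter ≃ Fin (k + 1))

theorem cantorPoint_tape (d : Config) : cantorPoint k (fun i => φ (d.tape i)) =
    (circlePt (streamVal k (fun a => (φ a : ℕ)) d.2),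
      circlePt (streamVal k (fun a => (φ a : ℕ)) d.1)) := by
  simp only [cantorPoint_eq, Config.tape_add_one, Config.tape_neg]
  rfl

theorem blockCoding_read (c : TuringMachine.Code) (w : List (Fin (k + 1))) :
    (blockCoding φ).read (c, w) = readWord φ c w := rfl

theorem blockCoding_len (c : TuringMachine.Code) : (blockCoding φ).len c = c.blockLength := rfl

theorem inputPoint_blockCoding (c : TuringMachine.Code) {A : Type*} {l : ℕ} (eA : A ≃ Fin l)
    (s : ℤ → A) : (blockCoding φ).inputPoint c eA 0 s =
      ((circlePt 0, 1), cantorPoint k fun i => φ ((c.withState .start fun i => eA (s i)).tape i)) := by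
  have h1 : toTorus2 (((0 : ℚ × ℚ).1 : ℝ), ((0 : ℚ × ℚ).2 : ℝ)) = (circlePt 0, 1) := by
    simp [toTorus2, circlePt]
  have h2 : (blockCoding φ).encode c eA s =
      fun i => φ ((c.withState .start fun i => eA (s i)).tape i) := by
    funext j
    rw [c.tape_withState]
    rfl
  rw [BlockCoding.inputPoint, h1, h2]

theorem iterate_eq_cantorPoint {F : Torus4 → Torus4}
    (hF : ∀ (t : ℝ) (d : Config), 0 ≤ t → t ≤ 1 / 8 → ∃ t' : ℝ, 0 ≤ t' ∧ t' ≤ 1 / 8 ∧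
      F ((circlePt t, 1), (circlePt (streamVal k (fun a => (φ a : ℕ)) d.2),
        circlePt (streamVal k (fun a => (φ a : ℕ)) d.1))) =
      ((circlePt t', 1), (circlePt (streamVal k (fun a => (φ a : ℕ)) (rewriteStep rule d).2),
        circlePt (streamVal k (fun a => (φ a : ℕ)) (rewriteStep rule d).1)))) (d : Config) (j : ℕ) :
    ∃ t : ℝ, 0 ≤ t ∧ t ≤ 1 / 8 ∧
      F^[j] ((circlePt 0, 1), cantorPoint k fun i => φ (d.tape i)) =
        ((circlePt t, 1), cantorPoint k fun i => φ ((machineStep^[j] d).tape i)) := by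
  induction j with
  | zero => exact ⟨0, le_rfl, by norm_num, rfl⟩
  | succ j ih =>
    obtain ⟨t, h0, h1, h⟩ := ih
    obtain ⟨t', h0', h1', h'⟩ := hF t (machineStep^[j] d) h0 h1
    refine ⟨t', h0', h1', ?_⟩
    rw [Function.iterate_succ_apply', h, cantorPoint_tape, h', Function.iterate_succ_apply',
      cantorPoint_tape]
    rfl

/-- The arc from `1` has length at most `2π / 8 < 1`, so the history never leaves the ball. -/
theorem circlePt_mem_ball {t : ℝ} (h0 : 0 ≤ t) (h1 : t ≤ 1 / 8) :
    ((circlePt t, 1) : Torus2) ∈ Metric.ball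
      (toTorus2 (((0 : ℚ × ℚ).1 : ℝ), ((0 : ℚ × ℚ).2 : ℝ))) ((1 : ℚ) : ℝ) := by
  have hc : toTorus2 (((0 : ℚ × ℚ).1 : ℝ), ((0 : ℚ × ℚ).2 : ℝ)) = (1, 1) := by
    simp [toTorus2]
  have hd : dist (circlePt t) 1 ≤ 2 * Real.pi * t := by
    have h2 : dist (circlePt t) 1 = ‖Complex.exp (Complex.I * (2 * Real.pi * t : ℝ)) - 1‖ := by
      rw [mul_comm Complex.I, ← Circle.coe_exp, ← Circle.coe_one, ← dist_eq_norm]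
      rfl
    rw [h2]
    refine Real.norm_exp_I_mul_ofReal_sub_one_le.trans_eq ?_
    rw [Real.norm_of_nonneg (by positivity)]
  rw [hc, Metric.mem_ball, Prod.dist_eq, dist_self, max_lt_iff, Rat.cast_one]
  refine ⟨hd.trans_lt ?_, one_pos⟩
  nlinarith [Real.pi_lt_d2, Real.pi_pos]

theorem mem_outputSet_of_halt {c : TuringMachine.Code} {A : Type*} {l : ℕ} (hl : c.2.1 = l)
    (eA : A ≃ Fin l) (hk : 1 ≤ k) {x : ℝ} (h0 : 0 ≤ x) (h1 : x ≤ 1 / 8) {n : ℕ} {t' : ℤ → A}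
    {t : Set.Icc (-(n : ℤ)) (n : ℤ) → A} (ht : ∀ i : Set.Icc (-(n : ℤ)) (n : ℤ), t' i = t i) :
    ((circlePt x, 1), cantorPoint k fun i => φ ((c.withState .halt fun i => eA (t' i)).tape i)) ∈
      (blockCoding φ).outputSet c eA 0 1 n t := by
  have hk' : (1 : ℝ) ≤ k := by exact_mod_cast hk
  have hr : (0 : ℝ) < ((10 * (k : ℝ)) ^ ((n + 1) * (blockCoding φ).len c))⁻¹ := by positivity
  have hu : (fun i => φ ((c.withState .halt fun i => eA (t' i)).tape i)) ∈
      (blockCoding φ).cylinder c eA n t := by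
    intro i
    rw [blockCoding_read, blockCoding_len, map_tapeBlock, c.tapeBlock_withState, List.map_cons, List.map_map, ← ht]
    exact readWord_eq φ (by rw [hl]; exact Fin.isLt _) (by split_ifs <;> simp)
  exact Set.mk_mem_prod (circlePt_mem_ball h0 h1)
    (Metric.self_subset_thickening hr _ (Set.mem_image_of_mem _ hu))

theorem readWord_eq_of_mem_outputSet {c : TuringMachine.Code} {A : Type*} {l : ℕ}
    (eA : A ≃ Fin l) (hk : 1 ≤ k) {x : Torus2} {v : ℤ → Fin (k + 1)} {n : ℕ} {t : Set.Icc (-(n : ℤ)) (n : ℤ) → A}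
    (h : (x, cantorPoint k v) ∈ (blockCoding φ).outputSet c eA 0 1 n t)
    (i : Set.Icc (-(n : ℤ)) (n : ℤ)) :
    readWord φ c (tapeBlock c.blockLength v i) = eA (t i) := by
  obtain ⟨-, h⟩ := h
  obtain ⟨-, ⟨u, hu, rfl⟩, hd⟩ := Metric.mem_thickening_iff.1 h
  rw [← hu i]
  change _ = readWord φ c (tapeBlock c.blockLength u i)
  congr 1
  have hL := c.blockLength_pos
  -- Blocks `-n, …, n` occupy the positions from `-nL` to `(n + 1)L - 1`, all within reach of the
  -- `(n + 1)L` digits known on either side.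
  refine tapeBlock_congr fun j hj hj' => eq_of_dist_cantorPoint_lt hk hd ?_ ?_
  · change -(((n + 1) * c.blockLength : ℕ) : ℤ) < j
    have := i.2.1
    push_cast
    nlinarith
  · change j ≤ (((n + 1) * c.blockLength : ℕ) : ℤ)
    have := i.2.2
    push_cast
    nlinarith

end Universality

theorem proposition1p9 :
    ∃ (Φ : Diffeomorph torus4Model torus4Model Torus4 Torus4 ∞) (k : ℕ) (K : BlockCoding k)
      (x h : ℚ × ℚ) (ρ : ℚ),
      IsComputableTorusMap Φ ∧ 1 ≤ k ∧
      ∀ (Q : Type*) (A : Type*) (m l : ℕ) (eQ : Q ≃ Fin m) (eA : A ≃ Fin l), 2 ≤ l →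
      ∀ (T : TuringMachine Q A) (s : ℤ → A) (n : ℕ) (t : Set.Icc (-(n : ℤ)) (n : ℤ) → A),
        T.HaltsWithOutput s n t ↔
          ∃ j : ℕ, Φ^[j] (K.inputPoint (T.code eQ eA) eA x s) ∈
            K.outputSet (T.code eQ eA) eA h ρ n t := by
  have : Nonempty Letter := ⟨.one⟩
  obtain ⟨k, hk⟩ : ∃ k, Fintype.card Letter = k + 1 :=
    Nat.exists_eq_succ_of_ne_zero (Fintype.card_ne_zero (α := Letter))
  have hk1 : 1 ≤ k := by
    have : 1 < Fintype.card Letter := Fintype.one_lt_card_iff.2 ⟨.one, .start, by simp⟩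
    omega
  let φ : Letter ≃ Fin (k + 1) := (Fintype.equivFin Letter).trans (finCongr hk)
  obtain ⟨F, ⟨hlift, Φ, rfl⟩, hF⟩ := exists_diffeo_rewriteStep hk1 (dg := fun a => (φ a : ℕ))
    (Fin.val_injective.comp φ.injective) (fun a => Nat.lt_succ_iff.1 (φ a).isLt) rule
  refine ⟨Φ, k, blockCoding φ, 0, 0, 1, hlift.isComputableTorusMap, hk1, ?_⟩
  intro Q A m l eQ eA _ T s n t
  rw [inputPoint_blockCoding]
  constructor
  · rintro ⟨t', hT, ht⟩
    obtain ⟨j, hj⟩ := hT.reach eQ eA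
    obtain ⟨x, h0, h1, h⟩ := iterate_eq_cantorPoint φ hF
      ((T.code eQ eA).withState .start fun i => eA (s i)) j
    refine ⟨j, ?_⟩
    rw [h, hj]
    exact mem_outputSet_of_halt φ (c := T.code eQ eA) rfl eA hk1 h0 h1 ht
  · rintro ⟨j, hj⟩
    obtain ⟨x, -, -, h⟩ := iterate_eq_cantorPoint φ hF
      ((T.code eQ eA).withState .start fun i => eA (s i)) j
    rw [h] at hj
    have hread := readWord_eq_of_mem_outputSet φ (c := T.code eQ eA) eA hk1 hj
    have hstate := isState_iterate (d := (T.code eQ eA).withState .start fun i => eA (s i))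
      trivial j
    -- Block `0` is read as a symbol, so its first letter is a delimiter or `halt`; being a state
    -- letter, it must be `halt`.
    have hhalt : (machineStep^[j] ((T.code eQ eA).withState .start fun i => eA (s i))).1.head =
        .halt := by
      set d := machineStep^[j] ((T.code eQ eA).withState .start fun i => eA (s i)) with hd
      have h0 := hread ⟨0, by simp⟩
      obtain ⟨L, hL⟩ := Nat.exists_eq_succ_of_ne_zero (T.code eQ eA).blockLength_pos.ne'
      rw [map_tapeBlock, hL, tapeBlock, List.ofFn_succ, List.map_cons] at h0
      have hx := head_eq_of_readWord_lt φ (h0.trans_lt (eA _).isLt)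
      have h00 : d.tape (((L + 1 : ℕ) : ℤ) * 0 + ((0 : Fin (L + 1)) : ℕ)) = d.1.head := by
        simp [Config.tape]
      rcases hx with hx | hx
      · have := φ.injective (hx : φ (d.tape _) = _)
        rw [h00] at this
        rw [this] at hstate
        exact hstate.elim
      · exact h00 ▸ φ.injective (hx : φ (d.tape _) = _)
    obtain ⟨t', hT, ht'⟩ := T.exists_haltsWithTape eQ eA hhalt
    refine ⟨t', hT, fun i => eA.injective (Fin.ext ?_)⟩
    have hi := hread i
    rw [ht', map_tapeBlock, (T.code eQ eA).tapeBlock_withState, List.map_cons, List.map_map] at hi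
    exact (readWord_eq φ (c := T.code eQ eA) (eA (t' i)).isLt
      (by split_ifs <;> simp)).symm.trans hi
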